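/- **Notation.** Let $\Lambda=\begin{bmatrix}1&0\\ 1/\sqrt3&2/\sqrt3\end{bmatrix}\mathbb Z^2$, $\det\Lambda=2/\sqrt3$, $\Lambda^*=\{\gamma\in\mathbb R^2:\langle\eta,\gamma\rangle\in2\pi\mathbb Z\ \forall\eta\in\Lambda\}$, $S=\{\xi\in\mathbb R^2:|\xi_1|\le\pi,\ |\xi_1\pm\sqrt3\,\xi_2|\le2\pi\}$ (a reciprocal cell of $\Lambda$), $A_0=\tfrac12S$, $S_\epsilon=\frac{\pi-2\epsilon}{2\pi}S$ and $\Gamma_k^{\rm fr}=2\Lambda$ for $0\le k\le6$. Put $$A_{1,2}^\epsilon=\{\xi\in S\setminus S_\epsilon:|\xi_2|\le\epsilon\},\qquad A_{1,6}^\epsilon=\{\xi\in S\setminus S_\epsilon:\tfrac{\sqrt3}2|\xi_2-\xi_1/\sqrt3|\le\epsilon\},$$ $$A_{1,1}^\epsilon=\{\xi\in S\setminus S_\epsilon:\xi_1\le0,\ \tfrac{\xi_1+2\epsilon}{\sqrt3}\le\xi_2\le-\epsilon\}\cup\{\xi\in S\setminus S_\epsilon:\xi_1\ge0,\ \tfrac{\xi_1-2\epsilon}{\sqrt3}\ge\xi_2\ge\epsilon\},$$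 $A_1^\epsilon=A_{1,2}^\epsilon\cup A_{1,6}^\epsilon\cup A_{1,1}^\epsilon$. The set $A_2^\epsilon$ is the mirror image of $A_1^\epsilon$ in the $\xi_1$-axis, and $(A_3^\epsilon,A_4^\epsilon)$, $(A_5^\epsilon,A_6^\epsilon)$ are $(A_1^\epsilon,A_2^\epsilon)$ rotated by $-\pi/3$ and $+\pi/3$. Let $0<\epsilon<\pi/(4+\sqrt3)$ be such that $A_{1,2}^\epsilon\cap A_{1,6}^\epsilon=\emptyset$ (that is, $\epsilon\le\pi/(6+2\sqrt3)$), so that the following function is well defined. With $\nu(x)=\min(1,\max(0,x))$ let $\mathcal N_1$ be given on $S$ by: $\mathcal N_1=0$ off $A_1^\epsilon$; $\mathcal N_1=1$ on $A_{1,1}^\epsilon$; $\mathcal N_1(\xi)=\cos\!\big(\tfrac\pi2\nu(\pm\tfrac{\xi_2}{2\epsilon}+\tfrac12)\big)$ on $A_{1,2}^\epsilon$, with $+$ if $\xi_1<0$ and $-$ if $\xi_1>0$; $\mathcal N_1(\xi)=\cos\!\big(\tfrac\pi2\nu(\mp(\xi_2-\tfrac{\xi_1}{\sqrt3})\tfrac{\sqrt3}{4\epsilon}+\tfrac12)\big)$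 on $A_{1,6}^\epsilon$, with $-$ if $\xi_1<0$ and $+$ if $\xi_1>0$. Let $\mathcal N_2$ be the mirror image of $\mathcal N_1$ and let $(\mathcal N_3,\mathcal N_4)$, $(\mathcal N_5,\mathcal N_6)$ be $(\mathcal N_1,\mathcal N_2)$ rotated by $-\pi/3$ and $+\pi/3$. Let $\mathcal M_0:S\to[0,1]$ be any continuous function, invariant under rotation by $\pi/3$, with $\mathcal M_0=0$ on $S\setminus A_0$ and $\mathcal M_0=1$ on $S_\epsilon$. Put $\mathcal M_k=\mathcal N_k(1-\mathcal M_0^2)^{1/2}$ for $1\le k\le 6$, extend all functions $\Lambda^*$-periodically from $S$ (up to the choice of values on $\partial S+\Lambda^*$), and set $$m_k(\xi)=\mathcal M_k(\xi)e^{i\langle\xi,\eta_k^{\rm fr}\rangle},\qquad M_k=|\Lambda/\Gamma_k^{\rm fr}|^{1/2}m_k=2m_k\qquad(0\le k\le6),$$ where $\eta^{\rm fr}_0,\dots,\eta^{\rm fr}_6=(0,0),(2,0),(1,\sqrt3),(-1,\sqrt3),(-2,0),(-1,-\sqrt3),(1,-\sqrt3)$. Let $$\widehat\phi(\xi)=\prod_{p\ge1}\tfrac12M_0(2^{-p}\xi),\quad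 \widehat{\psi^k}(\xi)=\tfrac12\widehat\phi(\xi/2)M_k(\xi/2),\quad f_j(x)=2^{-j}f(2^{-j}x),\quad \psi^k_{j,n}(x)=\psi^k_j(x-n),$$ where the Fourier transform on $L^2(\mathbb R^2)$ is normalized by $\widehat f(\xi)=(\det\Lambda)^{-1/2}\int_{\mathbb R^2}f(x)e^{-i\langle x,\xi\rangle}\,dx$. The support of a continuous function is the closure of the set where it does not vanish. **Theorem.** The product defining $\widehat\phi$ converges at every point, and $\phi$ and $\psi^k$, $1\le k\le6$, are well defined functions in $L^2(\mathbb R^2)$. The filter bank $(M_k,M_k,\Lambda\to\Gamma_k^{\rm fr})_{k=0}^6$, all of whose channels are subsampled on $2\Lambda$, performs a perfect reconstruction on $\ell^2(\Lambda)$, and $\{\psi^k_{j,n}\}_{1\le k\le6,\ j\in\mathbb Z,\ n\in2^{j-1}\Gamma_k^{\rm fr}}$ is a Parseval frame of $L^2(\mathbb R^2)$. The redundancy $\big(\sum_{k=1}^6|\Lambda/\Gamma_k^{\rm fr}|^{-1}\big)\cdot\big(1-|\Lambda/\Gamma_0^{\rm fr}|^{-1}\big)^{-1}$ of the decomposition equals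 $2$. Moreover: 1. $\operatorname{supp}\widehat{\phi_1}\subseteq A_0$, and $\widehat{\psi^k_1}$ vanishes outside $A_k^\epsilon$ for $1\le k\le6$. If $\{\xi\in S:\mathcal M_0(\xi)\ne0\}$ is dense in $A_0$, then $\operatorname{supp}\widehat{\phi_1}=A_0$. If in addition the closure of $\{\xi\in S:\mathcal M_0(\xi)\neq1\}$ contains $S\setminus S_\epsilon$, then $\operatorname{supp}\widehat{\psi_1^k}=\overline{A_k^\epsilon}$ for $1\le k\le6$. 2. $\widehat\phi$ and $\widehat{\psi^k}$, $1\le k\le6$, are continuous. 3. $\phi$ and the set $\{(\psi^1,\psi^2),(\psi^3,\psi^4),(\psi^5,\psi^6)\}$ are invariant under rotation by $2\pi/3$. -/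

import Mathlib

open MeasureTheory
open scoped Pointwise FourierTransform ENNReal

noncomputable section

namespace HexFrame

/-- The Euclidean plane `ℝ²`. -/
abbrev Plane : Type := EuclideanSpace ℝ (Fin 2)

/-! ### Lattices -/

/-- The matrix whose columns generate the hexagonal lattice. -/
def hexMatrix : Matrix (Fin 2) (Fin 2) ℝ :=
  !![1, 0; 1 / √3, 2 / √3]

/-- The hexagonal lattice `Λ`: integer combinations of the columns of `hexMatrix`. -/
def hexLattice : AddSubgroup Plane :=
  AddSubgroup.closure (Set.range fun j : Fin 2 => WithLp.toLp 2 fun i : Fin 2 => hexMatrix i j)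

/-- `det Λ = √(det (Eᵀ E))`. -/
def hexDet : ℝ := √((hexMatrix.transpose * hexMatrix).det)

/-- The reciprocal lattice `L* = {γ : ⟨η, γ⟩ ∈ 2πℤ for all η ∈ L}`. -/
def reciprocal (L : AddSubgroup Plane) : AddSubgroup Plane where
  carrier := {γ | ∀ η ∈ L, ∃ m : ℤ, inner ℝ η γ = 2 * Real.pi * m}
  zero_mem' := fun η _ => ⟨0, by simp⟩
  add_mem' := by
    intro a b ha hb η hη
    obtain ⟨m, hm⟩ := ha η hη
    obtain ⟨n, hn⟩ := hb η hη
    exact ⟨m + n, by rw [inner_add_right, hm, hn]; push_cast; ring⟩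
  neg_mem' := by
    intro a ha η hη
    obtain ⟨m, hm⟩ := ha η hη
    exact ⟨-m, by rw [inner_neg_right, hm]; push_cast; ring⟩

/-- The sublattices `Γ_k^fr = 2Λ`, `k = 0, …, 6`, on which the filtered signals are sampled. -/
def frameLattice (_k : Fin 7) : AddSubgroup Plane := (2 : ℝ) • hexLattice

/-! ### The hexagon and its subsets -/

/-- The Voronoi reciprocal cell `S` of `Λ`. -/
def hexS : Set Plane :=
  {ξ | |ξ 0| ≤ Real.pi ∧ |ξ 0 + √3 * ξ 1| ≤ 2 * Real.pi ∧ |ξ 0 - √3 * ξ 1| ≤ 2 * Real.pi}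

/-- `S` with half of its boundary removed: exactly one representative modulo `Λ*` of each point. -/
def hexCell : Set Plane :=
  {ξ | ξ 0 ∈ Set.Ico (-Real.pi) Real.pi ∧
    ξ 0 + √3 * ξ 1 ∈ Set.Ico (-(2 * Real.pi)) (2 * Real.pi) ∧
    ξ 0 - √3 * ξ 1 ∈ Set.Ico (-(2 * Real.pi)) (2 * Real.pi)}

/-- The `Λ*`-periodic extension of the restriction of `f` to the cell. For each `ξ` at most one
term of the sum is nonzero. -/
def periodize (f : Plane → ℝ) (ξ : Plane) : ℝ :=
  ∑ᶠ γ : reciprocal hexLattice, hexCell.indicator f (ξ + (γ : Plane))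

/-- `A_0 = S / 2`. -/
def hexA0 : Set Plane := (1 / 2 : ℝ) • hexS

/-- `S_ε = ((π - 2ε) / (2π)) S`. -/
def hexSeps (ε : ℝ) : Set Plane := ((Real.pi - 2 * ε) / (2 * Real.pi)) • hexS

/-- Counterclockwise rotation of the plane by the angle `θ`. -/
def rot (θ : ℝ) (x : Plane) : Plane :=
  !₂[Real.cos θ * x 0 - Real.sin θ * x 1, Real.sin θ * x 0 + Real.cos θ * x 1]

/-- Reflection in the first coordinate axis. -/
def refl (x : Plane) : Plane := !₂[x 0, -x 1]

/-- `A_{1,2}^ε`. -/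
def setA12 (ε : ℝ) : Set Plane := {ξ | ξ ∈ hexS \ hexSeps ε ∧ |ξ 1| ≤ ε}

/-- `A_{1,6}^ε`. -/
def setA16 (ε : ℝ) : Set Plane :=
  {ξ | ξ ∈ hexS \ hexSeps ε ∧ √3 / 2 * |ξ 1 - ξ 0 / √3| ≤ ε}

/-- `A_{1,1}^ε`. -/
def setA11 (ε : ℝ) : Set Plane :=
  {ξ | ξ ∈ hexS \ hexSeps ε ∧ ξ 0 ≤ 0 ∧ (ξ 0 + 2 * ε) / √3 ≤ ξ 1 ∧ ξ 1 ≤ -ε} ∪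
  {ξ | ξ ∈ hexS \ hexSeps ε ∧ 0 ≤ ξ 0 ∧ ξ 1 ≤ (ξ 0 - 2 * ε) / √3 ∧ ε ≤ ξ 1}

/-- `A_1^ε`. -/
def setA1 (ε : ℝ) : Set Plane := setA12 ε ∪ setA16 ε ∪ setA11 ε

/-- `A_1^ε, …, A_6^ε` (entry `k` is `A_{k+1}^ε`): `A_2^ε` is the mirror image of `A_1^ε`,
`(A_3^ε, A_4^ε)` and `(A_5^ε, A_6^ε)` are `(A_1^ε, A_2^ε)` rotated by `-π/3` and by `π/3`. -/
def setA (ε : ℝ) : Fin 6 → Set Plane :=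
  ![setA1 ε,
    refl '' setA1 ε,
    rot (-(Real.pi / 3)) '' setA1 ε,
    rot (-(Real.pi / 3)) '' (refl '' setA1 ε),
    rot (Real.pi / 3) '' setA1 ε,
    rot (Real.pi / 3) '' (refl '' setA1 ε)]

/-! ### The filters -/

/-- The conditions on the modulus `𝓜_0` on the cell `S`. -/
structure IsRefinementModulus (ε : ℝ) (M0 : Plane → ℝ) : Prop where
  continuousOn : ContinuousOn M0 hexS
  nonneg : ∀ ξ ∈ hexS, 0 ≤ M0 ξ
  le_one : ∀ ξ ∈ hexS, M0 ξ ≤ 1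
  eq_zero : ∀ ξ ∈ hexS \ hexA0, M0 ξ = 0
  eq_one : ∀ ξ ∈ hexSeps ε, M0 ξ = 1
  rot_invariant : ∀ ξ ∈ hexS, M0 (rot (Real.pi / 3) ξ) = M0 ξ

/-- The continuous function `ν`. -/
def nu (x : ℝ) : ℝ := if x < 0 then 0 else if x ≤ 1 then x else 1

open Classical in
/-- `𝓝_1` on the cell `S`. -/
def modN1 (ε : ℝ) (ξ : Plane) : ℝ :=
  if ξ ∈ setA11 ε then 1
  else if ξ ∈ setA12 ε then
    if ξ 0 < 0 then Real.cos (nu (ξ 1 / (2 * ε) + 1 / 2) * (Real.pi / 2))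
    else Real.cos (nu (-(ξ 1 / (2 * ε)) + 1 / 2) * (Real.pi / 2))
  else if ξ ∈ setA16 ε then
    if ξ 0 < 0 then
      Real.cos (nu (-((ξ 1 - ξ 0 / √3) * (√3 / (4 * ε))) + 1 / 2) * (Real.pi / 2))
    else Real.cos (nu ((ξ 1 - ξ 0 / √3) * (√3 / (4 * ε)) + 1 / 2) * (Real.pi / 2))
  else 0

/-- `𝓝_1, …, 𝓝_6` on the cell `S` (entry `k` is `𝓝_{k+1}`), obtained from `𝓝_1` by the same
reflection and rotations as the sets `setA`; a function is moved by a map of the plane by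
composing with the inverse map. -/
def modN (ε : ℝ) : Fin 6 → Plane → ℝ :=
  ![modN1 ε,
    fun ξ => modN1 ε (refl ξ),
    fun ξ => modN1 ε (rot (Real.pi / 3) ξ),
    fun ξ => modN1 ε (refl (rot (Real.pi / 3) ξ)),
    fun ξ => modN1 ε (rot (-(Real.pi / 3)) ξ),
    fun ξ => modN1 ε (refl (rot (-(Real.pi / 3)) ξ))]

/-- The `Λ*`-periodic moduli: `𝓜_0`, and `𝓜_k = 𝓝_k (1 - 𝓜_0²)^{1/2}` for `1 ≤ k ≤ 6`. -/
def modM (ε : ℝ) (M0 : Plane → ℝ) : Fin 7 → Plane → ℝ :=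
  Fin.cons (periodize M0)
    (fun (k : Fin 6) ξ => periodize (modN ε k) ξ * √(1 - periodize M0 ξ ^ 2))

/-- The phase vectors `η_0^fr, …, η_6^fr`. -/
def etaFr : Fin 7 → Plane :=
  ![!₂[0, 0], !₂[2, 0], !₂[1, √3], !₂[-1, √3], !₂[-2, 0], !₂[-1, -√3], !₂[1, -√3]]

/-- The normalized filters `m_k(ξ) = 𝓜_k(ξ) e^{i⟨ξ, η_k^fr⟩}`. -/
def filt (ε : ℝ) (M0 : Plane → ℝ) (k : Fin 7) (ξ : Plane) : ℂ :=
  (modM ε M0 k ξ : ℂ) * Complex.exp (Complex.I * (inner ℝ ξ (etaFr k) : ℝ))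

/-- The transfer functions `M_k = |Λ/Γ_k^fr|^{1/2} m_k`. -/
def transfer (ε : ℝ) (M0 : Plane → ℝ) (k : Fin 7) (ξ : Plane) : ℂ :=
  (√((frameLattice k).relIndex hexLattice : ℝ) : ℂ) * filt ε M0 k ξ

/-! ### Filter banks and perfect reconstruction -/

/-- The Fourier coefficient `c_n` in `M(ξ) = ∑_{n ∈ Λ} c_n e^{i⟨n, ξ⟩}`: the mean over `S` of
`M(ξ) e^{-i⟨n, ξ⟩}`. -/
def coeff (M : Plane → ℂ) (n : hexLattice) : ℂ :=
  ⨍ ξ in hexS, M ξ * Complex.exp (-(Complex.I * (inner ℝ (n : Plane) ξ : ℝ)))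

/-- Filtering a `Λ`-indexed sequence with the transfer function `M`. -/
def filterSeq (M : Plane → ℂ) (x : hexLattice → ℂ) (n : hexLattice) : ℂ :=
  ∑' p : hexLattice, coeff M p * x (n - p)

open Classical in
/-- Subsampling on `Γ` followed by upsampling on `Λ` by zero padding. -/
def subUpSample (Γ : AddSubgroup Plane) (y : hexLattice → ℂ) (n : hexLattice) : ℂ :=
  if (n : Plane) ∈ Γ then y n else 0

/-- `(M_k, M_k, Λ → Γ_k)` is a filter bank with transfer functions in `L²(ℝ²/Λ*)` that performs a
perfect reconstruction: every `x ∈ ℓ²(Λ)` is recovered by filtering with `conj M_k`, subsampling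
on `Γ_k`, upsampling, filtering with `M_k` and summing over `k`. -/
def IsPRFilterBank {K : ℕ} (Γ : Fin K → AddSubgroup Plane) (M : Fin K → Plane → ℂ) : Prop :=
  (∀ k, Γ k ≤ hexLattice ∧ (Γ k).relIndex hexLattice ≠ 0) ∧
  (∀ k, (∀ γ ∈ reciprocal hexLattice, ∀ ξ, M k (ξ + γ) = M k ξ) ∧
    MemLp (M k) 2 (volume.restrict hexS)) ∧
  ∀ x : hexLattice → ℂ, Summable (fun n => ‖x n‖ ^ 2) → ∀ n,
    ∑ k, filterSeq (M k)
      (subUpSample (Γ k) (filterSeq (fun ξ => (starRingEnd ℂ) (M k ξ)) x)) n = x n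

/-! ### Fourier transform -/

/-- `f ∈ L²(ℝ²)` and `g` is (a.e.) its Fourier transform, in the normalization
`f̂(ξ) = (det Λ)^{-1/2} ∫ f(x) e^{-i⟨x, ξ⟩} dx` extended to `L²` by Plancherel. Mathlib's `𝓕` has
kernel `e^{-2πi⟨x, w⟩}`, hence the substitution `ξ = 2πw`. -/
def HasFourierTransform (f g : Plane → ℂ) : Prop :=
  ∃ hf : MemLp f 2 (volume : Measure Plane),
    (fun w : Plane => g ((2 * Real.pi) • w)) =ᵐ[volume]
      fun w => ((√hexDet)⁻¹ : ℂ) * (𝓕 (hf.toLp f) : Lp ℂ 2 (volume : Measure Plane)) w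

/-- The inverse of the Fourier transform `f̂(ξ) = (det Λ)^{-1/2} ∫ f(x) e^{-i⟨x, ξ⟩} dx`. -/
def invFourier (g : Plane → ℂ) (x : Plane) : ℂ :=
  ((√hexDet / (2 * Real.pi) ^ 2 : ℝ) : ℂ) *
    ∫ ξ, g ξ * Complex.exp (Complex.I * (inner ℝ x ξ : ℝ))

/-! ### Scaling function and wavelets for the dilation `D = 2 Id`, `|det D| = 4` -/

/-- The factor `|D|^{-1/2} M_0(D^{-p-1} ξ)` of the infinite product. -/
def phiFactor (M : Fin 7 → Plane → ℂ) (ξ : Plane) (p : ℕ) : ℂ :=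
  1 / 2 * M 0 (((2 : ℝ) ^ (p + 1))⁻¹ • ξ)

/-- `φ̂(ξ) = ∏_{p ≥ 1} |D|^{-1/2} M_0(D^{-p} ξ)`. -/
def phiHat (M : Fin 7 → Plane → ℂ) (ξ : Plane) : ℂ := ∏' p : ℕ, phiFactor M ξ p

/-- `ψ̂^{k+1}(ξ) = |D|^{-1/2} φ̂(D⁻¹ ξ) M_{k+1}(D⁻¹ ξ)`, for `k = 0, …, 5`. -/
def psiHat (M : Fin 7 → Plane → ℂ) (k : Fin 6) (ξ : Plane) : ℂ :=
  1 / 2 * phiHat M ((1 / 2 : ℝ) • ξ) * M k.succ ((1 / 2 : ℝ) • ξ)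

/-- The scaling function `φ`. -/
def phi (M : Fin 7 → Plane → ℂ) : Plane → ℂ := invFourier (phiHat M)

/-- The wavelets `ψ^{k+1}`, `k = 0, …, 5`. -/
def psi (M : Fin 7 → Plane → ℂ) (k : Fin 6) : Plane → ℂ := invFourier (psiHat M k)

/-- `f_j(x) = |D|^{-j/2} f(D^{-j} x)`. -/
def dilate (j : ℤ) (f : Plane → ℂ) (x : Plane) : ℂ :=
  (((2 : ℝ) ^ (-j) : ℝ) : ℂ) * f ((2 : ℝ) ^ (-j) • x)

/-- The Fourier transform `|D|^{j/2} g(D^j ξ)` of `f_j` when `g` is that of `f`. -/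
def dilateHat (j : ℤ) (g : Plane → ℂ) (ξ : Plane) : ℂ :=
  (((2 : ℝ) ^ j : ℝ) : ℂ) * g ((2 : ℝ) ^ j • ξ)

/-- Indices `(k, j, n)` with `j ∈ ℤ` and `n ∈ 2^{j-1} Γ_{k+1}`. -/
abbrev WaveletIndex (Γ : Fin 7 → AddSubgroup Plane) : Type :=
  Σ (k : Fin 6) (j : ℤ), ((2 : ℝ) ^ (j - 1) • Γ k.succ : AddSubgroup Plane)

/-- The wavelet system `ψ^k_{j,n}(x) = ψ^k_j(x - n)`. -/
def waveletSystem (Γ : Fin 7 → AddSubgroup Plane) (M : Fin 7 → Plane → ℂ)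
    (i : WaveletIndex Γ) (x : Plane) : ℂ :=
  dilate i.2.1 (psi M i.1) (x - (i.2.2 : Plane))

/-- A family of functions is a Parseval frame of `L²(ℝ²)`. -/
def IsParsevalFrame {ι : Type*} (e : ι → Plane → ℂ) : Prop :=
  ∃ he : ∀ i, MemLp (e i) 2 (volume : Measure Plane),
    ∀ f : Lp ℂ 2 (volume : Measure Plane),
      HasSum (fun i => ‖inner ℂ ((he i).toLp (e i)) f‖ ^ 2) (‖f‖ ^ 2)

/-- The redundancy `(∑_{k=1}^6 1/|Λ/Γ_k|) · 1/(1 - 1/|Λ/Γ_0|)` of the full decomposition. -/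
def redundancy (Γ : Fin 7 → AddSubgroup Plane) : ℝ :=
  (∑ k : Fin 6, 1 / ((Γ k.succ).relIndex hexLattice : ℝ)) *
    (1 / (1 - 1 / ((Γ 0).relIndex hexLattice : ℝ)))

/-- The set of pairs `{(ψ¹, ψ²), (ψ³, ψ⁴), (ψ⁵, ψ⁶)}`. -/
def waveletPairs (M : Fin 7 → Plane → ℂ) : Set ((Plane → ℂ) × (Plane → ℂ)) :=
  {(psi M 0, psi M 1), (psi M 2, psi M 3), (psi M 4, psi M 5)}

end HexFrame

end

/-!
With `a = ξ 0`, `b = hexB ξ`, the numbers `a`, `b`, `a - b` are the inner products of `ξ` with the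
normals of the sides of `S`. In these coordinates `S`, `A_0` and `S_ε` are hexagons `InHex r a b`,
the rotation by `π/3` is `(a, b) ↦ (a - b, a)`, and outside `S_ε` the function `𝓝_k` is a product
formula `sector`: a smoothed indicator of one of the six double sectors cut out by the twelve
directions of angle `30j` degrees. The condition on `ε` says that the transition strips around
these directions do not meet outside `S_ε` (`smallEps_of_disjoint`), so that `∑ 𝓝_k² = 1` there
(`sum_sector_sq`).

**Perfect reconstruction.** Subsampling on `2Λ` averages a `Λ*`-periodic function over its
translates by `Λ*/2` modulo `Λ*` (`coeff_aliasMean`), so that perfect reconstruction amounts to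
`∑_k m_k(ξ + γ) conj (m_k(ξ)) = δ_γ` for `γ ∈ Λ*/2` modulo `Λ*` (`sum_filt`). For `γ ∈ Λ*` this is
`𝓜_0² + (1 - 𝓜_0²) ∑ 𝓝_k² = 1`. For other `γ` the translates of the support of `𝓜_0` are disjoint.
Among the other channels, `ξ` and `ξ + γ` can be in the same double sector only along the strips
around two opposite directions; there two adjacent channels contribute equal products of moduli,
and the phases `e^{i⟨ξ, η_k⟩}` give these products opposite signs. By symmetry it is enough to
consider two shifts (`aliasFree_one_zero`, `aliasFree_one_one`). Fourier series on the cell are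
transported from the torus `UnitAddTorus (Fin 2)`.

**Scaling function and wavelets.** Since `𝓜_0 = 0` off `A_0` and `𝓜_0 = 1` on `S_ε ⊇ A_0 / 2`, the
infinite product collapses to its first factor: `φ̂(ξ)` is `𝓜_0(ξ/2)` for `ξ/2 ∈ S`, and `0`
elsewhere (`phiHat_eq`). This gives convergence, continuity and the supports. All these functions
are continuous with compact support, and the `L²` inverse Fourier transform of a function in
`L¹ ∩ L²` is the Fourier integral (`fourierInv_ae_eq`).

**Parseval frame.** Because `φ̂` is supported in the cell, the coefficients of `f` at scale `j` are
Fourier coefficients on the cell (`norm_inner_waveletSystem`). The alias identity for the six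
channels `1 ≤ k ≤ 6` then evaluates the energy of the scale
(`exists_hasSum_channels`, `integral_localized`) as
`∫ (φ̂(2^{j-1} ξ)² - φ̂(2^j ξ)²) ‖f̂(ξ)‖²`, up to the Plancherel constant; the sum over `j`
telescopes to `‖f‖²` (`hasSum_integral_scales`).

**Rotations.** The rotation by `2π/3` preserves `φ̂`, and it permutes the double sectors and the
phase vectors in the same way (`waveCore_rot`), hence also the pairs of wavelets.
-/

noncomputable section

namespace HexFrame

/-! ### Coordinates, lattices and the hexagonal cell -/

/-- The second hexagonal coordinate: with `a = ξ 0` and `b = hexB ξ`, the numbers `a`, `b`, `a - b`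
are the inner products of `ξ` with the three unit normals of the sides of `S`. -/
def hexB (ξ : Plane) : ℝ := (ξ 0 + √3 * ξ 1) / 2

/-- The hexagon of inradius `r`, in the coordinates `(a, b)`. -/
def InHex (r a b : ℝ) : Prop := |a| ≤ r ∧ |b| ≤ r ∧ |a - b| ≤ r

/-- The point of the plane with coordinates `s, t` in the basis `(2π, 0), (π, √3 π)` of `Λ*`. -/
def latPt (s t : ℝ) : Plane := !₂[Real.pi * (2 * s + t), √3 * Real.pi * t]

/-- The point of the plane with coordinates `m, n` in the basis of `Λ` dual (up to the factor `2π`)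
to the basis used in `latPt`. -/
def hexPt (m n : ℝ) : Plane := !₂[m, (2 * n - m) / √3]

lemma sqrt_three_sq : √(3 : ℝ) * √3 = 3 := Real.mul_self_sqrt (by norm_num)

lemma sqrt_three_pos : 0 < √(3 : ℝ) := by positivity

lemma plane_ext {x y : Plane} (h0 : x 0 = y 0) (h1 : x 1 = y 1) : x = y := by
  ext i; fin_cases i <;> assumption

@[simp] lemma latPt_zero (s t : ℝ) : latPt s t 0 = Real.pi * (2 * s + t) := by simp [latPt]
@[simp] lemma latPt_one (s t : ℝ) : latPt s t 1 = √3 * Real.pi * t := by simp [latPt]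
@[simp] lemma hexB_latPt (s t : ℝ) : hexB (latPt s t) = Real.pi * (s + 2 * t) := by
  simp only [hexB, latPt_zero, latPt_one]; linear_combination Real.pi * t / 2 * sqrt_three_sq
@[simp] lemma hexPt_zero (s t : ℝ) : hexPt s t 0 = s := by simp [hexPt]
@[simp] lemma hexPt_one (s t : ℝ) : hexPt s t 1 = (2 * t - s) / √3 := by simp [hexPt]

lemma hexB_add (x y : Plane) : hexB (x + y) = hexB x + hexB y := by simp [hexB]; ring
lemma hexB_smul (r : ℝ) (x : Plane) : hexB (r • x) = r * hexB x := by simp [hexB]; ring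

lemma inner_plane (x y : Plane) : inner ℝ x y = x 0 * y 0 + x 1 * y 1 := by
  simp [PiLp.inner_apply, Fin.sum_univ_two]; ring

lemma inner_hexPt_latPt (m n s t : ℝ) :
    inner ℝ (hexPt m n) (latPt s t) = 2 * Real.pi * (m * s + n * t) := by
  have := sqrt_three_pos
  rw [inner_plane]; simp; field_simp; ring

lemma latPt_add (s t s' t' : ℝ) : latPt s t + latPt s' t' = latPt (s + s') (t + t') := by
  apply plane_ext <;> simp <;> ring

lemma hexPt_add (s t s' t' : ℝ) : hexPt s t + hexPt s' t' = hexPt (s + s') (t + t') := by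
  apply plane_ext <;> simp
  ring

lemma neg_hexPt (s t : ℝ) : -hexPt s t = hexPt (-s) (-t) := by
  apply plane_ext <;> simp
  ring

lemma smul_hexPt (r s t : ℝ) : r • hexPt s t = hexPt (r * s) (r * t) := by
  apply plane_ext <;> simp
  ring

/-- The first coordinate of a point in the basis used in `latPt`. -/
def latS (ξ : Plane) : ℝ := inner ℝ (hexPt 1 0) ξ / (2 * Real.pi)

/-- The second coordinate of a point in the basis used in `latPt`. -/
def latT (ξ : Plane) : ℝ := inner ℝ (hexPt 0 1) ξ / (2 * Real.pi)

@[simp] lemma latS_latPt (s t : ℝ) : latS (latPt s t) = s := by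
  rw [latS, inner_hexPt_latPt]; field_simp; ring
@[simp] lemma latT_latPt (s t : ℝ) : latT (latPt s t) = t := by
  rw [latT, inner_hexPt_latPt]; field_simp; ring

lemma latPt_latS_latT (ξ : Plane) : latPt (latS ξ) (latT ξ) = ξ := by
  have := sqrt_three_pos
  have hp := Real.pi_pos
  apply plane_ext <;> simp [latS, latT, inner_plane] <;> field_simp
  ring

lemma exists_latPt (ξ : Plane) : ∃ s t, ξ = latPt s t := ⟨_, _, (latPt_latS_latT ξ).symm⟩

lemma inner_hexPt (m n : ℝ) (ξ : Plane) :
    inner ℝ (hexPt m n) ξ = 2 * Real.pi * (m * latS ξ + n * latT ξ) := by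
  conv_lhs => rw [← latPt_latS_latT ξ, inner_hexPt_latPt]

lemma mem_hexLattice {x : Plane} : x ∈ hexLattice ↔ ∃ m n : ℤ, x = hexPt m n := by
  have h3 := sqrt_three_pos
  have e0 : (WithLp.toLp 2 fun i : Fin 2 => hexMatrix i 0 : Plane) = hexPt 1 1 := by
    apply plane_ext <;> simp [hexMatrix]; norm_num
  have e1 : (WithLp.toLp 2 fun i : Fin 2 => hexMatrix i 1 : Plane) = hexPt 0 1 := by
    apply plane_ext <;> simp [hexMatrix]
  constructor
  · intro hx
    induction hx using AddSubgroup.closure_induction with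
    | mem x hx =>
      obtain ⟨j, rfl⟩ := hx
      fin_cases j
      · exact ⟨1, 1, by simpa using e0⟩
      · exact ⟨0, 1, by simpa using e1⟩
    | zero => exact ⟨0, 0, by apply plane_ext <;> simp⟩
    | add x y _ _ hx hy =>
      obtain ⟨m, n, rfl⟩ := hx
      obtain ⟨m', n', rfl⟩ := hy
      exact ⟨m + m', n + n', by rw [hexPt_add]; push_cast; rfl⟩
    | neg x _ hx =>
      obtain ⟨m, n, rfl⟩ := hx
      exact ⟨-m, -n, by rw [neg_hexPt]; push_cast; rfl⟩
  · rintro ⟨m, n, rfl⟩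
    have : hexPt m n = m • hexPt 1 1 + (n - m) • hexPt 0 1 := by
      rw [← Int.cast_smul_eq_zsmul ℝ, ← Int.cast_smul_eq_zsmul ℝ, smul_hexPt, smul_hexPt, hexPt_add]
      push_cast; congr 1 <;> ring
    rw [this, ← e0, ← e1]
    exact add_mem (zsmul_mem (AddSubgroup.subset_closure (Set.mem_range_self 0)) _)
      (zsmul_mem (AddSubgroup.subset_closure (Set.mem_range_self 1)) _)

lemma mem_reciprocal {γ : Plane} :
    γ ∈ reciprocal hexLattice ↔ ∃ m n : ℤ, γ = latPt m n := by
  have hp := Real.pi_pos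
  constructor
  · intro h
    replace h : ∀ η ∈ hexLattice, ∃ m : ℤ, inner ℝ η γ = 2 * Real.pi * m := h
    obtain ⟨m, hm⟩ := h (hexPt 1 0) (mem_hexLattice.2 ⟨1, 0, by norm_num⟩)
    obtain ⟨n, hn⟩ := h (hexPt 0 1) (mem_hexLattice.2 ⟨0, 1, by norm_num⟩)
    refine ⟨m, n, ?_⟩
    rw [inner_hexPt] at hm hn
    have h1 := mul_left_cancel₀ (by positivity) hm
    have h2 := mul_left_cancel₀ (by positivity) hn
    rw [← latPt_latS_latT γ, ← h1, ← h2]; simp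
  · rintro ⟨m, n, rfl⟩ η hη
    obtain ⟨p, q, rfl⟩ := mem_hexLattice.1 hη
    exact ⟨p * m + q * n, by rw [inner_hexPt_latPt]; push_cast; ring⟩

lemma mem_hexS {ξ : Plane} : ξ ∈ hexS ↔ InHex Real.pi (ξ 0) (hexB ξ) := by
  simp only [hexS, InHex, hexB, Set.mem_ofPred_eq, abs_le]
  constructor <;> rintro ⟨⟨_, _⟩, ⟨_, _⟩, ⟨_, _⟩⟩ <;>
    refine ⟨⟨?_, ?_⟩, ⟨?_, ?_⟩, ⟨?_, ?_⟩⟩ <;> linarith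

lemma InHex.smul {r a b c : ℝ} (h : InHex r a b) : InHex (|c| * r) (c * a) (c * b) := by
  obtain ⟨h1, h2, h3⟩ := h
  refine ⟨?_, ?_, ?_⟩
  · rw [abs_mul]; gcongr
  · rw [abs_mul]; gcongr
  · rw [← mul_sub, abs_mul]; gcongr

lemma mem_smul_hexS {r : ℝ} (hr : 0 < r) {ξ : Plane} :
    ξ ∈ r • hexS ↔ InHex (r * Real.pi) (ξ 0) (hexB ξ) := by
  rw [Set.mem_smul_set_iff_inv_smul_mem₀ hr.ne', mem_hexS, hexB_smul]
  constructor
  · intro h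
    have := h.smul (c := r)
    simpa [abs_of_pos hr, mul_inv_cancel_left₀ hr.ne'] using this
  · intro h
    have := h.smul (c := r⁻¹)
    simpa [abs_of_pos hr, inv_mul_cancel_left₀ hr.ne'] using this

lemma mem_hexA0 {ξ : Plane} : ξ ∈ hexA0 ↔ InHex (Real.pi / 2) (ξ 0) (hexB ξ) := by
  rw [hexA0, mem_smul_hexS (by norm_num)]; ring_nf

lemma mem_hexSeps {ε : ℝ} (h : 2 * ε < Real.pi) {ξ : Plane} :
    ξ ∈ hexSeps ε ↔ InHex (Real.pi / 2 - ε) (ξ 0) (hexB ξ) := by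
  have hp := Real.pi_pos
  rw [hexSeps, mem_smul_hexS (by apply div_pos <;> linarith)]
  congr! 1; field_simp

lemma mem_hexCell {ξ : Plane} : ξ ∈ hexCell ↔ ξ 0 ∈ Set.Ico (-Real.pi) Real.pi ∧
    hexB ξ ∈ Set.Ico (-Real.pi) Real.pi ∧ ξ 0 - hexB ξ ∈ Set.Ico (-Real.pi) Real.pi := by
  simp only [hexCell, hexB, Set.mem_ofPred_eq, Set.mem_Ico]
  constructor <;> rintro ⟨⟨_, _⟩, ⟨_, _⟩, ⟨_, _⟩⟩ <;>
    refine ⟨⟨?_, ?_⟩, ⟨?_, ?_⟩, ⟨?_, ?_⟩⟩ <;> linarith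

lemma hexCell_subset : hexCell ⊆ hexS := by
  intro ξ h
  obtain ⟨⟨_, _⟩, ⟨_, _⟩, ⟨_, _⟩⟩ := mem_hexCell.1 h
  rw [mem_hexS]
  refine ⟨abs_le.2 ⟨?_, ?_⟩, abs_le.2 ⟨?_, ?_⟩, abs_le.2 ⟨?_, ?_⟩⟩ <;> linarith

lemma latPt_mem_hexCell {s t : ℝ} : latPt s t ∈ hexCell ↔ 2 * s + t ∈ Set.Ico (-1) 1 ∧
    s + 2 * t ∈ Set.Ico (-1) 1 ∧ s - t ∈ Set.Ico (-1) 1 := by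
  have hp := Real.pi_pos
  have key (x : ℝ) : Real.pi * x ∈ Set.Ico (-Real.pi) Real.pi ↔ x ∈ Set.Ico (-1 : ℝ) 1 := by
    simp only [Set.mem_Ico]
    constructor <;> rintro ⟨h1, h2⟩ <;> constructor <;> nlinarith
  rw [mem_hexCell, latPt_zero, hexB_latPt, ← mul_sub, key, key, key]
  congr! 3; ring

/-- The cell meets each coset of `Λ*` in exactly one point. -/
lemma existsUnique_vadd_mem_hexCell (ξ : Plane) :
    ∃! γ : reciprocal hexLattice, γ +ᵥ ξ ∈ hexCell := by
  obtain ⟨s, t, rfl⟩ := exists_latPt ξ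
  have hs0 := Int.fract_nonneg s
  have hs1 := Int.fract_lt_one s
  have ht0 := Int.fract_nonneg t
  have ht1 := Int.fract_lt_one t
  have hs := Int.fract_add_floor s
  have ht := Int.fract_add_floor t
  set x := Int.fract s
  set y := Int.fract t
  obtain ⟨p, q, hpq⟩ : ∃ p q : ℤ, latPt (x + p) (y + q) ∈ hexCell := by
    simp only [latPt_mem_hexCell, Set.mem_Ico]
    by_cases h1 : 2 * x + y < 1 ∧ x + 2 * y < 1
    · refine ⟨0, 0, ?_⟩; push_cast; refine ⟨⟨?_, ?_⟩, ⟨?_, ?_⟩, ?_, ?_⟩ <;> linarith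
    by_cases h2 : 2 ≤ 2 * x + y ∧ 2 ≤ x + 2 * y
    · refine ⟨-1, -1, ?_⟩; push_cast; refine ⟨⟨?_, ?_⟩, ⟨?_, ?_⟩, ?_, ?_⟩ <;> linarith
    rcases le_or_gt y x with h3 | h3
    · have h4 : 1 ≤ 2 * x + y := by by_contra! h; exact h1 ⟨h, by linarith⟩
      have h5 : x + 2 * y < 2 := by by_contra! h; exact h2 ⟨by linarith, h⟩
      refine ⟨-1, 0, ?_⟩; push_cast; refine ⟨⟨?_, ?_⟩, ⟨?_, ?_⟩, ?_, ?_⟩ <;> linarith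
    · have h4 : 1 ≤ x + 2 * y := by by_contra! h; exact h1 ⟨by linarith, h⟩
      have h5 : 2 * x + y < 2 := by by_contra! h; exact h2 ⟨h, by linarith⟩
      refine ⟨0, -1, ?_⟩; push_cast; refine ⟨⟨?_, ?_⟩, ⟨?_, ?_⟩, ?_, ?_⟩ <;> linarith
  refine ⟨⟨latPt ((p - ⌊s⌋ : ℤ)) ((q - ⌊t⌋ : ℤ)), mem_reciprocal.2 ⟨_, _, rfl⟩⟩, ?_, ?_⟩
  · change latPt _ _ + latPt s t ∈ hexCell
    rw [latPt_add]
    convert hpq using 2 <;> push_cast <;> linarith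
  · rintro ⟨γ, hγ⟩ h
    obtain ⟨m, n, rfl⟩ := mem_reciprocal.1 hγ
    change latPt _ _ + latPt s t ∈ hexCell at h
    rw [latPt_add, latPt_mem_hexCell] at h
    rw [latPt_mem_hexCell] at hpq
    obtain ⟨⟨a1, a2⟩, ⟨a3, a4⟩, ⟨a5, a6⟩⟩ := h
    obtain ⟨⟨b1, b2⟩, ⟨b3, b4⟩, ⟨b5, b6⟩⟩ := hpq
    have cast (z w : ℤ) (h : (z : ℝ) < w) : z < w := by exact_mod_cast h
    have u1 := cast (2 * (m + ⌊s⌋ - p) + (n + ⌊t⌋ - q)) 2 (by push_cast; linarith)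
    have u2 := cast (-2) (2 * (m + ⌊s⌋ - p) + (n + ⌊t⌋ - q)) (by push_cast; linarith)
    have u3 := cast ((m + ⌊s⌋ - p) + 2 * (n + ⌊t⌋ - q)) 2 (by push_cast; linarith)
    have u4 := cast (-2) ((m + ⌊s⌋ - p) + 2 * (n + ⌊t⌋ - q)) (by push_cast; linarith)
    have u5 := cast ((m + ⌊s⌋ - p) - (n + ⌊t⌋ - q)) 2 (by push_cast; linarith)
    have u6 := cast (-2) ((m + ⌊s⌋ - p) - (n + ⌊t⌋ - q)) (by push_cast; linarith)
    have e1 : m = p - ⌊s⌋ := by omega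
    have e2 : n = q - ⌊t⌋ := by omega
    simp only [e1, e2]

/-- The representative of `ξ` modulo `Λ*` in the cell. -/
def cellRep (ξ : Plane) : Plane := (existsUnique_vadd_mem_hexCell ξ).choose +ᵥ ξ

lemma cellRep_mem (ξ : Plane) : cellRep ξ ∈ hexCell :=
  (existsUnique_vadd_mem_hexCell ξ).choose_spec.1

lemma exists_cellRep_eq (ξ : Plane) : ∃ m n : ℤ, cellRep ξ = ξ + latPt m n := by
  obtain ⟨m, n, h⟩ := mem_reciprocal.1 (existsUnique_vadd_mem_hexCell ξ).choose.2
  exact ⟨m, n, by rw [cellRep, ← h, add_comm]; rfl⟩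

lemma cellRep_eq_of_mem {ξ γ : Plane} (hγ : γ ∈ reciprocal hexLattice) (h : ξ + γ ∈ hexCell) :
    cellRep ξ = ξ + γ := by
  have := (existsUnique_vadd_mem_hexCell ξ).choose_spec.2 ⟨γ, hγ⟩
    (show γ + ξ ∈ hexCell by rwa [add_comm])
  rw [cellRep, ← this, add_comm]; rfl

lemma cellRep_of_mem {ξ : Plane} (h : ξ ∈ hexCell) : cellRep ξ = ξ := by
  have := cellRep_eq_of_mem (ξ := ξ) (zero_mem _) (by simpa using h)
  simpa using this

lemma cellRep_add {ξ γ : Plane} (hγ : γ ∈ reciprocal hexLattice) :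
    cellRep (ξ + γ) = cellRep ξ := by
  obtain ⟨m, n, h⟩ := exists_cellRep_eq ξ
  have h2 : latPt m n ∈ reciprocal hexLattice := mem_reciprocal.2 ⟨_, _, rfl⟩
  rw [cellRep_eq_of_mem (sub_mem h2 hγ) (by
    rw [add_add_sub_cancel, ← h]; exact cellRep_mem ξ), add_add_sub_cancel, h]

lemma periodize_eq (f : Plane → ℝ) (ξ : Plane) : periodize f ξ = f (cellRep ξ) := by
  rw [periodize, finsum_eq_single _ (existsUnique_vadd_mem_hexCell ξ).choose]
  · rw [add_comm]
    exact Set.indicator_of_mem (cellRep_mem ξ) f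
  · intro γ hγ
    apply Set.indicator_of_notMem
    intro h
    apply hγ
    exact (existsUnique_vadd_mem_hexCell ξ).choose_spec.2 γ (show (γ : Plane) + ξ ∈ hexCell by
      rwa [add_comm])

lemma periodize_add {f : Plane → ℝ} {ξ γ : Plane} (hγ : γ ∈ reciprocal hexLattice) :
    periodize f (ξ + γ) = periodize f ξ := by
  rw [periodize_eq, periodize_eq, cellRep_add hγ]

/-! ### The angular partition of unity -/

/-- A continuous transition from `1` to `0` over the interval `[-ε, ε]`, with
`cut ε t ^ 2 + cut ε (-t) ^ 2 = 1`. -/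
def cut (ε t : ℝ) : ℝ := Real.cos (nu (t / (2 * ε) + 1 / 2) * (Real.pi / 2))

/-- The smoothed indicator of the double sector `{u ≥ 0, v ≤ 0} ∪ {u ≤ 0, v ≥ 0}`. -/
def wedge (ε u v : ℝ) : ℝ := cut ε (-u) * cut ε v + cut ε u * cut ε (-v)

/-- The smoothed indicator of the double sector of the plane between the directions of angle
`30j` and `30(j+1)` degrees, in the coordinates `(a, b)`. -/
def sector (ε : ℝ) (j : Fin 6) (a b : ℝ) : ℝ :=
  ![wedge ε ((2 * b - a) / √3) (b - a), wedge ε (b - a) ((b - 2 * a) / √3),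
    wedge ε ((b - 2 * a) / √3) (-a), wedge ε (-a) (-(a + b) / √3),
    wedge ε (-(a + b) / √3) (-b), wedge ε (-b) (-((2 * b - a) / √3))] j

lemma nu_eq (x : ℝ) : nu x = max 0 (min x 1) := by
  unfold nu
  split_ifs with h1 h2
  · rw [max_eq_left]; exact (min_le_left _ _).trans h1.le
  · rw [min_eq_left h2, max_eq_right (not_lt.1 h1)]
  · rw [min_eq_right (not_le.1 h2).le, max_eq_right zero_le_one]

lemma continuous_nu : Continuous nu := by
  rw [funext nu_eq]; fun_prop

lemma nu_mem (x : ℝ) : nu x ∈ Set.Icc 0 1 := by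
  rw [nu_eq]; exact ⟨le_max_left _ _, max_le zero_le_one (min_le_right _ _)⟩

lemma continuous_cut (ε : ℝ) : Continuous (cut ε) := by
  have := continuous_nu
  unfold cut; fun_prop

lemma cut_nonneg (ε t : ℝ) : 0 ≤ cut ε t := by
  have hp := Real.pi_pos
  obtain ⟨h0, h1⟩ := nu_mem (t / (2 * ε) + 1 / 2)
  apply Real.cos_nonneg_of_neg_pi_div_two_le_of_le <;> nlinarith

lemma cut_of_le {ε t : ℝ} (hε : 0 < ε) (h : t ≤ -ε) : cut ε t = 1 := by
  have : t / (2 * ε) + 1 / 2 ≤ 0 := by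
    have : t / (2 * ε) ≤ -(1 / 2) := by rw [div_le_iff₀ (by positivity)]; linarith
    linarith
  rw [cut, nu_eq, min_eq_left (by linarith), max_eq_left this]; simp

lemma cut_of_ge {ε t : ℝ} (hε : 0 < ε) (h : ε ≤ t) : cut ε t = 0 := by
  have : 1 ≤ t / (2 * ε) + 1 / 2 := by
    have : 1 / 2 ≤ t / (2 * ε) := by rw [le_div_iff₀ (by positivity)]; linarith
    linarith
  rw [cut, nu_eq, min_eq_right (by linarith), max_eq_right zero_le_one]; simp

lemma cut_pos {ε t : ℝ} (hε : 0 < ε) (h : t < ε) : 0 < cut ε t := by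
  have hp := Real.pi_pos
  have h1 : t / (2 * ε) + 1 / 2 < 1 := by
    have : t / (2 * ε) < 1 / 2 := by rw [div_lt_iff₀ (by positivity)]; linarith
    linarith
  have h2 : nu (t / (2 * ε) + 1 / 2) < 1 := by
    rw [nu_eq]; exact max_lt one_pos ((min_le_left _ _).trans_lt h1)
  have h0 := (nu_mem (t / (2 * ε) + 1 / 2)).1
  apply Real.cos_pos_of_mem_Ioo
  constructor <;> nlinarith

lemma lt_of_cut_ne_zero {ε t : ℝ} (hε : 0 < ε) (h : cut ε t ≠ 0) : t < ε := by
  by_contra! h'; exact h (cut_of_ge hε h')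

lemma cut_sq_add_cut_neg_sq {ε : ℝ} (hε : 0 < ε) (t : ℝ) : cut ε t ^ 2 + cut ε (-t) ^ 2 = 1 := by
  rcases le_total t (-ε) with h | h
  · rw [cut_of_le hε h, cut_of_ge hε (by linarith)]; norm_num
  rcases le_total ε t with h' | h'
  · rw [cut_of_ge hε h', cut_of_le hε (by linarith)]; norm_num
  have e1 : -(1 / 2) ≤ t / (2 * ε) := by rw [le_div_iff₀ (by positivity)]; linarith
  have e2 : t / (2 * ε) ≤ 1 / 2 := by rw [div_le_iff₀ (by positivity)]; linarith
  have e3 : cut ε (-t) = Real.sin ((t / (2 * ε) + 1 / 2) * (Real.pi / 2)) := by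
    rw [cut, nu_eq, neg_div, min_eq_left (by linarith), max_eq_right (by linarith),
      ← Real.cos_pi_div_two_sub]
    congr 1; ring
  rw [e3, cut, nu_eq, min_eq_left (by linarith), max_eq_right (by linarith), Real.cos_sq_add_sin_sq]

lemma wedge_neg_neg (ε u v : ℝ) : wedge ε (-u) (-v) = wedge ε u v := by
  simp only [wedge, neg_neg]; ring

lemma wedge_swap (ε u v : ℝ) : wedge ε (-v) (-u) = wedge ε u v := by
  simp only [wedge, neg_neg]; ring

lemma wedge_nonneg (ε u v : ℝ) : 0 ≤ wedge ε u v :=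
  add_nonneg (mul_nonneg (cut_nonneg _ _) (cut_nonneg _ _))
    (mul_nonneg (cut_nonneg _ _) (cut_nonneg _ _))

lemma wedge_ne_zero {ε u v : ℝ} (hε : 0 < ε) (h : wedge ε u v ≠ 0) :
    (-ε < u ∧ v < ε) ∨ (u < ε ∧ -ε < v) := by
  rcases ne_or_eq (cut ε (-u) * cut ε v) 0 with h1 | h1
  · left
    have := lt_of_cut_ne_zero hε (left_ne_zero_of_mul h1)
    exact ⟨by linarith, lt_of_cut_ne_zero hε (right_ne_zero_of_mul h1)⟩
  · rw [wedge, h1, zero_add] at h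
    right
    have := lt_of_cut_ne_zero hε (right_ne_zero_of_mul h)
    exact ⟨lt_of_cut_ne_zero hε (left_ne_zero_of_mul h), by linarith⟩

lemma wedge_pos {ε u v : ℝ} (hε : 0 < ε) (h : (-ε < u ∧ v < ε) ∨ (u < ε ∧ -ε < v)) :
    0 < wedge ε u v := by
  rcases h with ⟨h1, h2⟩ | ⟨h1, h2⟩
  · exact add_pos_of_pos_of_nonneg (mul_pos (cut_pos hε (by linarith)) (cut_pos hε h2))
      (mul_nonneg (cut_nonneg _ _) (cut_nonneg _ _))
  · exact add_pos_of_nonneg_of_pos (mul_nonneg (cut_nonneg _ _) (cut_nonneg _ _))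
      (mul_pos (cut_pos hε h1) (cut_pos hε (by linarith)))

lemma neg_lt_div_sqrt_three {ε x : ℝ} : -ε < x / √3 ↔ -(√3 * ε) < x := by
  rw [lt_div_iff₀ sqrt_three_pos, neg_mul, mul_comm]

lemma div_sqrt_three_lt {ε x : ℝ} : x / √3 < ε ↔ x < √3 * ε := by
  rw [div_lt_iff₀ sqrt_three_pos, mul_comm]

lemma le_div_sqrt_three {ε x : ℝ} : ε ≤ x / √3 ↔ √3 * ε ≤ x := by
  rw [le_div_iff₀ sqrt_three_pos, mul_comm]

lemma div_sqrt_three_le {ε x : ℝ} : x / √3 ≤ ε ↔ x ≤ √3 * ε := by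
  rw [div_le_iff₀ sqrt_three_pos, mul_comm]

lemma div_sqrt_three_le_neg {ε x : ℝ} : x / √3 ≤ -ε ↔ x ≤ -(√3 * ε) := by
  rw [div_le_iff₀ sqrt_three_pos, neg_mul, mul_comm]

lemma neg_le_div_sqrt_three {ε x : ℝ} : -ε ≤ x / √3 ↔ -(√3 * ε) ≤ x := by
  rw [le_div_iff₀ sqrt_three_pos, neg_mul, mul_comm]

/-- The admissible range of the transition parameter: the transition strips around neighbouring
directions do not meet outside `S_ε`. -/
structure SmallEps (ε : ℝ) : Prop where
  pos : 0 < ε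
  le : 3 * ε + √3 * ε ≤ Real.pi / 2

lemma SmallEps.bounds {ε : ℝ} (h : SmallEps ε) :
    0 < ε ∧ 3 * ε + √3 * ε ≤ Real.pi / 2 ∧ ε ≤ √3 * ε ∧ √3 * ε ≤ 2 * ε := by
  refine ⟨h.pos, h.le, ?_, ?_⟩
  · exact le_mul_of_one_le_left h.pos.le (Real.one_le_sqrt.2 (by norm_num))
  · have := h.pos
    gcongr
    rw [Real.sqrt_le_left (by norm_num)]; norm_num

lemma not_inHex {r a b : ℝ} (h : ¬ InHex r a b) :
    r < a ∨ a < -r ∨ r < b ∨ b < -r ∨ r < a - b ∨ a - b < -r := by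
  by_contra! h'
  obtain ⟨h1, h2, h3, h4, h5, h6⟩ := h'
  exact h ⟨abs_le.2 ⟨h2, h1⟩, abs_le.2 ⟨h4, h3⟩, abs_le.2 ⟨h6, h5⟩⟩

lemma sector_rot (ε a b : ℝ) :
    sector ε 0 (a - b) a = sector ε 4 a b ∧ sector ε 1 (a - b) a = sector ε 5 a b ∧
    sector ε 2 (a - b) a = sector ε 0 a b ∧ sector ε 3 (a - b) a = sector ε 1 a b ∧
    sector ε 4 (a - b) a = sector ε 2 a b ∧ sector ε 5 (a - b) a = sector ε 3 a b := by
  refine ⟨?_, ?_, ?_, ?_, ?_, ?_⟩ <;> simp only [sector, Matrix.cons_val] <;> first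
    | (congr 1 <;> ring1)
    | (rw [← wedge_neg_neg]; congr 1 <;> ring1)

lemma sector_refl (ε a b : ℝ) :
    sector ε 0 b a = sector ε 1 a b ∧ sector ε 1 b a = sector ε 0 a b ∧
    sector ε 2 b a = sector ε 5 a b ∧ sector ε 5 b a = sector ε 2 a b ∧
    sector ε 3 b a = sector ε 4 a b ∧ sector ε 4 b a = sector ε 3 a b := by
  refine ⟨?_, ?_, ?_, ?_, ?_, ?_⟩ <;> simp only [sector, Matrix.cons_val] <;>
    rw [← wedge_swap] <;> first
    | (congr 1 <;> ring1)
    | (rw [← wedge_neg_neg]; congr 1 <;> ring1)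

/-- The rotation by 60 degrees and the reflection in the axis of angle 30 degrees move each point
into the sector between the angles 0 and 30 degrees. -/
lemma hex_induction {P : ℝ → ℝ → Prop} (hrot : ∀ a b, P (a - b) a → P a b)
    (hrefl : ∀ a b, P b a → P a b) (h : ∀ a b, 0 ≤ 2 * b - a → b - a ≤ 0 → P a b) (a b : ℝ) :
    P a b := by
  have q0 : ∀ a b, 0 ≤ 2 * b - a → b - 2 * a ≤ 0 → P a b := fun a b h1 h2 => by
    rcases le_total b a with h3 | h3
    · exact h _ _ h1 (by linarith)
    · exact hrefl _ _ (h _ _ (by linarith) (by linarith))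
  have q1 : ∀ a b, 2 * b - a ≤ 0 → 0 ≤ a + b → P a b := fun a b h1 h2 =>
    hrot _ _ (q0 _ _ (by linarith) (by linarith))
  have q2 : ∀ a b, a + b ≤ 0 → b - 2 * a ≤ 0 → P a b := fun a b h1 h2 =>
    hrot _ _ (q1 _ _ (by linarith) (by linarith))
  have q3 : ∀ a b, 2 * b - a ≤ 0 → 0 ≤ b - 2 * a → P a b := fun a b h1 h2 =>
    hrot _ _ (q2 _ _ (by linarith) (by linarith))
  have q4 : ∀ a b, a + b ≤ 0 → 0 ≤ 2 * b - a → P a b := fun a b h1 h2 =>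
    hrot _ _ (q3 _ _ (by linarith) (by linarith))
  have q5 : ∀ a b, 0 ≤ a + b → 0 ≤ b - 2 * a → P a b := fun a b h1 h2 =>
    hrot _ _ (q4 _ _ (by linarith) (by linarith))
  rcases le_total 0 (2 * b - a) with h1 | h1 <;> rcases le_total 0 (b - 2 * a) with h2 | h2 <;>
    rcases le_total 0 (a + b) with h3 | h3 <;> first
    | exact q0 _ _ h1 h2 | exact q1 _ _ h1 h3 | exact q2 _ _ h3 h2 | exact q3 _ _ h1 h2
    | exact q4 _ _ h3 h1 | exact q5 _ _ h3 h2

lemma InHex.rot {r a b : ℝ} (h : InHex r a b) : InHex r (a - b) a := by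
  obtain ⟨h1, h2, h3⟩ := h
  exact ⟨h3, h1, by rwa [show a - b - a = -b by ring, abs_neg]⟩

lemma InHex.of_rot {r a b : ℝ} (h : InHex r (a - b) a) : InHex r a b := by
  obtain ⟨h1, h2, h3⟩ := h
  rw [show a - b - a = -b by ring, abs_neg] at h3
  exact ⟨h2, h3, h1⟩

lemma InHex.swap {r a b : ℝ} (h : InHex r a b) : InHex r b a :=
  ⟨h.2.1, h.1, by rw [abs_sub_comm]; exact h.2.2⟩

/-- Outside `S_ε` the squares of the sector functions add up to `1`: each of the twelve directions is
surrounded by a strip in which only the two adjacent sectors are active, and these strips do not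
meet. -/
lemma sum_sector_sq {ε : ℝ} (hε : SmallEps ε) (a b : ℝ) (h : ¬ InHex (Real.pi / 2 - ε) a b) :
    ∑ j, sector ε j a b ^ 2 = 1 := by
  revert h
  obtain ⟨h0, h1, h2, h3⟩ := hε.bounds
  refine hex_induction (P := fun a b => ¬ InHex (Real.pi / 2 - ε) a b →
    ∑ j, sector ε j a b ^ 2 = 1) ?_ ?_ ?_ a b
  · intro a b ih h
    have := ih fun h' => h h'.of_rot
    obtain ⟨e0, e1, e2, e3, e4, e5⟩ := sector_rot ε a b
    rw [Fin.sum_univ_six] at this ⊢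
    rw [e0, e1, e2, e3, e4, e5] at this
    linarith
  · intro a b ih h
    have := ih fun h' => h h'.swap
    obtain ⟨e0, e1, e2, e3, e4, e5⟩ := sector_refl ε a b
    rw [Fin.sum_univ_six] at this ⊢
    rw [e0, e1, e2, e3, e4, e5] at this
    linarith
  · intro a b ha hb h
    have ha' : Real.pi / 2 - ε < a := by
      rcases not_inHex h with h | h | h | h | h | h <;> linarith
    have c2 := cut_of_le h0 (div_sqrt_three_le_neg.2 (show b - 2 * a ≤ -(√3 * ε) by linarith))
    have c2' := cut_of_ge h0 (t := -((b - 2 * a) / √3))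
      (by rw [← neg_div]; exact le_div_sqrt_three.2 (by linarith))
    have c3 := cut_of_le h0 (show -a ≤ -ε by linarith)
    have c3' := cut_of_ge h0 (show ε ≤ a by linarith)
    have c4 := cut_of_le h0 (div_sqrt_three_le_neg.2 (show -(a + b) ≤ -(√3 * ε) by linarith))
    have c4' := cut_of_ge h0 (t := -(-(a + b) / √3))
      (by rw [← neg_div]; exact le_div_sqrt_three.2 (by linarith))
    have c5 := cut_of_le h0 (show -b ≤ -ε by linarith)
    have c5' := cut_of_ge h0 (show ε ≤ b by linarith)
    have s0 := cut_sq_add_cut_neg_sq h0 ((2 * b - a) / √3)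
    have s1 := cut_sq_add_cut_neg_sq h0 (b - a)
    simp only [Fin.sum_univ_six, sector, wedge, Matrix.cons_val, neg_neg, c2, c2', c3, c3',
      c4, c4', c5, c5']
    rcases le_or_gt (√3 * ε) (2 * b - a) with h | h
    · rw [cut_of_ge h0 (le_div_sqrt_three.2 h), cut_of_le h0 (t := -((2 * b - a) / √3))
        (by rw [← neg_div]; exact div_sqrt_three_le_neg.2 (by linarith))]
      linarith
    · rw [cut_of_le h0 (show b - a ≤ -ε by linarith), cut_of_ge h0 (show ε ≤ -(b - a) by linarith)]
      linarith

/-! ### Cancellation of the aliasing terms -/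

/-- The alternating sum controlling the aliasing between `ξ = (a, b)` and
`ξ' = (a', b') = ξ + latPt (m/2) (n/2)`. -/
def aliasSum (ε : ℝ) (m n : ℤ) (a b a' b' : ℝ) : ℝ :=
  (-1) ^ n * (sector ε 0 a b * sector ε 0 a' b' + sector ε 3 a b * sector ε 3 a' b') +
  (-1) ^ (m + n) * (sector ε 1 a b * sector ε 1 a' b' + sector ε 4 a b * sector ε 4 a' b') +
  (-1) ^ m * (sector ε 2 a b * sector ε 2 a' b' + sector ε 5 a b * sector ε 5 a' b')

/-- The aliasing terms cancel for the shift `latPt (m/2) (n/2)`. -/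
def AliasFree (ε : ℝ) (m n : ℤ) : Prop :=
  ∀ a b a' b' : ℝ, InHex Real.pi a b → InHex Real.pi a' b' →
    ¬ InHex (Real.pi / 2 - ε) a b → ¬ InHex (Real.pi / 2 - ε) a' b' →
    a' = a + Real.pi * (2 * m + n) / 2 → b' = b + Real.pi * (m + 2 * n) / 2 →
    aliasSum ε m n a b a' b' = 0

lemma AliasFree.of_rot {ε : ℝ} {m n : ℤ} (h : AliasFree ε (-n) (m + n)) : AliasFree ε m n := by
  intro a b a' b' h1 h2 h3 h4 ha hb
  have := h (a - b) a (a' - b') a' h1.rot h2.rot (fun h => h3 h.of_rot) (fun h => h4 h.of_rot)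
    (by rw [ha, hb]; push_cast; ring) (by rw [ha]; push_cast; ring)
  obtain ⟨e0, e1, e2, e3, e4, e5⟩ := sector_rot ε a b
  obtain ⟨f0, f1, f2, f3, f4, f5⟩ := sector_rot ε a' b'
  rw [aliasSum, e0, e1, e2, e3, e4, e5, f0, f1, f2, f3, f4, f5,
    show -n + (m + n) = m by ring] at this
  have hn : (-1 : ℝ) ^ (-n) = (-1) ^ n := by rw [zpow_neg, ← inv_zpow]; norm_num
  rw [hn] at this
  rw [aliasSum]
  linarith

lemma sector_ne_zero {ε : ℝ} (h0 : 0 < ε) {a b : ℝ} :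
    (sector ε 0 a b ≠ 0 → (-(√3 * ε) < 2 * b - a ∧ b - a < ε) ∨
      (2 * b - a < √3 * ε ∧ -ε < b - a)) ∧
    (sector ε 1 a b ≠ 0 → (-ε < b - a ∧ b - 2 * a < √3 * ε) ∨
      (b - a < ε ∧ -(√3 * ε) < b - 2 * a)) ∧
    (sector ε 2 a b ≠ 0 → (-(√3 * ε) < b - 2 * a ∧ -a < ε) ∨
      (b - 2 * a < √3 * ε ∧ -ε < -a)) ∧
    (sector ε 3 a b ≠ 0 → (-ε < -a ∧ -(a + b) < √3 * ε) ∨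
      (-a < ε ∧ -(√3 * ε) < -(a + b))) ∧
    (sector ε 4 a b ≠ 0 → (-(√3 * ε) < -(a + b) ∧ -b < ε) ∨
      (-(a + b) < √3 * ε ∧ -ε < -b)) ∧
    (sector ε 5 a b ≠ 0 → (-ε < -b ∧ -(2 * b - a) < √3 * ε) ∨
      (-b < ε ∧ -(√3 * ε) < -(2 * b - a))) := by
  have := fun u v => wedge_ne_zero (u := u) (v := v) h0
  refine ⟨?_, ?_, ?_, ?_, ?_, ?_⟩ <;> intro h <;> have := this _ _ h <;>
    simpa only [← neg_div, neg_lt_div_sqrt_three, div_sqrt_three_lt] using this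

lemma mul_eq_zero_of_imp {x y : ℝ} (h : x ≠ 0 → y ≠ 0 → False) : x * y = 0 := by
  by_contra h'
  exact h (left_ne_zero_of_mul h') (right_ne_zero_of_mul h')

/-- The values of `cut` at a pair of opposite points, away from the transition interval. -/
lemma cut_pair {ε t : ℝ} (h0 : 0 < ε) (h : ε ≤ t) : cut ε t = 0 ∧ cut ε (-t) = 1 :=
  ⟨cut_of_ge h0 h, cut_of_le h0 (by linarith)⟩

lemma cut_pair' {ε t : ℝ} (h0 : 0 < ε) (h : t ≤ -ε) : cut ε t = 1 ∧ cut ε (-t) = 0 :=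
  ⟨cut_of_le h0 h, cut_of_ge h0 (by linarith)⟩

/-- For the shift by `(π, 0)` only the two strips around the directions `0` and `180` degrees
interact, and there the contributions of the two adjacent sectors cancel. -/
lemma aliasFree_one_zero {ε : ℝ} (hε : SmallEps ε) : AliasFree ε 1 0 := by
  intro a b a' b' hin hin' hout hout' ha hb
  obtain ⟨h0, h1, h2, h3⟩ := hε.bounds
  push_cast at ha hb
  obtain ⟨i1, i2, i3⟩ := hin
  obtain ⟨j1, j2, j3⟩ := hin'
  rw [abs_le] at i1 i2 i3 j1 j2 j3
  obtain ⟨_, _⟩ := i1; obtain ⟨_, _⟩ := i2; obtain ⟨_, _⟩ := i3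
  obtain ⟨_, _⟩ := j1; obtain ⟨_, _⟩ := j2; obtain ⟨_, _⟩ := j3
  have hout := not_inHex hout
  have hout' := not_inHex hout'
  obtain ⟨-, n1, n2, n3, n4, -⟩ := sector_ne_zero h0 (a := a) (b := b)
  obtain ⟨-, n1', n2', n3', n4', -⟩ := sector_ne_zero h0 (a := a') (b := b')
  have z1 : sector ε 1 a b * sector ε 1 a' b' = 0 := mul_eq_zero_of_imp fun h h' => by
    rcases n1 h with ⟨_, _⟩ | ⟨_, _⟩ <;> rcases n1' h' with ⟨_, _⟩ | ⟨_, _⟩ <;> linarith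
  have z2 : sector ε 2 a b * sector ε 2 a' b' = 0 := mul_eq_zero_of_imp fun h h' => by
    rcases n2 h with ⟨_, _⟩ | ⟨_, _⟩ <;> rcases n2' h' with ⟨_, _⟩ | ⟨_, _⟩ <;> linarith
  have z3 : sector ε 3 a b * sector ε 3 a' b' = 0 := mul_eq_zero_of_imp fun h h' => by
    rcases n3 h with ⟨_, _⟩ | ⟨_, _⟩ <;> rcases n3' h' with ⟨_, _⟩ | ⟨_, _⟩ <;> linarith
  have z4 : sector ε 4 a b * sector ε 4 a' b' = 0 := mul_eq_zero_of_imp fun h h' => by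
    rcases n4 h with ⟨_, _⟩ | ⟨_, _⟩ <;> rcases n4' h' with ⟨_, _⟩ | ⟨_, _⟩ <;> linarith
  have z05 : sector ε 0 a b * sector ε 0 a' b' = sector ε 5 a b * sector ε 5 a' b' := by
    have hY : (2 * b' - a') / √3 = (2 * b - a) / √3 := by congr 1; linarith
    simp only [sector, wedge, Matrix.cons_val, neg_neg, hY]
    rcases le_or_gt (√3 * ε) (2 * b - a) with h | h
    · obtain ⟨e0, e0'⟩ := cut_pair h0 (le_div_sqrt_three.2 h)
      obtain ⟨e1, e1'⟩ := cut_pair h0 (show ε ≤ b - a by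
        rcases hout with h | h | h | h | h | h <;> linarith)
      obtain ⟨e2, e2'⟩ := cut_pair h0 (show ε ≤ b' by
        rcases hout' with h | h | h | h | h | h <;> linarith)
      rw [e0, e0', e1, e2]; ring
    rcases le_or_gt (2 * b - a) (-(√3 * ε)) with h' | h'
    · obtain ⟨e0, e0'⟩ := cut_pair' h0 (div_sqrt_three_le_neg.2 h')
      obtain ⟨e1, e1'⟩ := cut_pair' h0 (show b' - a' ≤ -ε by
        rcases hout' with h | h | h | h | h | h <;> linarith)
      obtain ⟨e2, e2'⟩ := cut_pair' h0 (show b ≤ -ε by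
        rcases hout with h | h | h | h | h | h <;> linarith)
      rw [e0, e0', e1', e2']; ring
    obtain ⟨e1, e1'⟩ := cut_pair h0 (show ε ≤ b - a by
        rcases hout with h | h | h | h | h | h <;> linarith)
    obtain ⟨e2, e2'⟩ := cut_pair' h0 (show b ≤ -ε by
        rcases hout with h | h | h | h | h | h <;> linarith)
    obtain ⟨f1, f1'⟩ := cut_pair' h0 (show b' - a' ≤ -ε by
        rcases hout' with h | h | h | h | h | h <;> linarith)
    obtain ⟨f2, f2'⟩ := cut_pair h0 (show ε ≤ b' by
        rcases hout' with h | h | h | h | h | h <;> linarith)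
    rw [e1, e1', e2, e2', f1, f1', f2, f2']; ring
  rw [aliasSum, z1, z2, z3, z4, z05]
  norm_num

/-- For the shift by `(3π/2, √3π/2)` only the two strips around the directions `30` and `210`
degrees interact, and there the contributions of the two adjacent sectors cancel. -/
lemma aliasFree_one_one {ε : ℝ} (hε : SmallEps ε) : AliasFree ε 1 1 := by
  intro a b a' b' hin hin' hout hout' ha hb
  obtain ⟨h0, h1, h2, h3⟩ := hε.bounds
  push_cast at ha hb
  obtain ⟨i1, i2, i3⟩ := hin
  obtain ⟨j1, j2, j3⟩ := hin'
  rw [abs_le] at i1 i2 i3 j1 j2 j3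
  obtain ⟨_, _⟩ := i1; obtain ⟨_, _⟩ := i2; obtain ⟨_, _⟩ := i3
  obtain ⟨_, _⟩ := j1; obtain ⟨_, _⟩ := j2; obtain ⟨_, _⟩ := j3
  obtain ⟨-, -, n2, n3, n4, n5⟩ := sector_ne_zero h0 (a := a) (b := b)
  obtain ⟨-, -, n2', n3', n4', n5'⟩ := sector_ne_zero h0 (a := a') (b := b')
  have z2 : sector ε 2 a b * sector ε 2 a' b' = 0 := mul_eq_zero_of_imp fun h h' => by
    rcases n2 h with ⟨_, _⟩ | ⟨_, _⟩ <;> rcases n2' h' with ⟨_, _⟩ | ⟨_, _⟩ <;> linarith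
  have z3 : sector ε 3 a b * sector ε 3 a' b' = 0 := mul_eq_zero_of_imp fun h h' => by
    rcases n3 h with ⟨_, _⟩ | ⟨_, _⟩ <;> rcases n3' h' with ⟨_, _⟩ | ⟨_, _⟩ <;> linarith
  have z4 : sector ε 4 a b * sector ε 4 a' b' = 0 := mul_eq_zero_of_imp fun h h' => by
    rcases n4 h with ⟨_, _⟩ | ⟨_, _⟩ <;> rcases n4' h' with ⟨_, _⟩ | ⟨_, _⟩ <;> linarith
  have z5 : sector ε 5 a b * sector ε 5 a' b' = 0 := mul_eq_zero_of_imp fun h h' => by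
    rcases n5 h with ⟨_, _⟩ | ⟨_, _⟩ <;> rcases n5' h' with ⟨_, _⟩ | ⟨_, _⟩ <;> linarith
  have z01 : sector ε 0 a b * sector ε 0 a' b' = sector ε 1 a b * sector ε 1 a' b' := by
    have hD : b' - a' = b - a := by linarith
    simp only [sector, wedge, Matrix.cons_val, neg_neg, hD]
    rcases le_or_gt ε (b - a) with h | h
    · obtain ⟨e0, e0'⟩ := cut_pair h0 h
      obtain ⟨e1, -⟩ := cut_pair h0
        (le_div_sqrt_three.2 (show √3 * ε ≤ 2 * b' - a' by linarith))
      obtain ⟨e2, -⟩ := cut_pair h0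
        (le_div_sqrt_three.2 (show √3 * ε ≤ b - 2 * a by linarith))
      rw [e0, e0', e1, e2]; ring
    rcases le_or_gt (b - a) (-ε) with h' | h'
    · obtain ⟨e0, e0'⟩ := cut_pair' h0 h'
      obtain ⟨-, e1⟩ := cut_pair' h0
        (div_sqrt_three_le_neg.2 (show 2 * b - a ≤ -(√3 * ε) by linarith))
      obtain ⟨-, e2⟩ := cut_pair' h0
        (div_sqrt_three_le_neg.2 (show b' - 2 * a' ≤ -(√3 * ε) by linarith))
      rw [e0, e0', e1, e2]; ring
    obtain ⟨e1, e1'⟩ := cut_pair' h0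
      (div_sqrt_three_le_neg.2 (show 2 * b - a ≤ -(√3 * ε) by linarith))
    obtain ⟨e2, e2'⟩ := cut_pair h0
      (le_div_sqrt_three.2 (show √3 * ε ≤ b - 2 * a by linarith))
    obtain ⟨f1, f1'⟩ := cut_pair h0
      (le_div_sqrt_three.2 (show √3 * ε ≤ 2 * b' - a' by linarith))
    obtain ⟨f2, f2'⟩ := cut_pair' h0
      (div_sqrt_three_le_neg.2 (show b' - 2 * a' ≤ -(√3 * ε) by linarith))
    rw [e1, e1', e2, e2', f1, f1', f2, f2']; ring
  rw [aliasSum, z2, z3, z4, z5, z01]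
  norm_num

/-- The vectors of `Λ*/2` outside `Λ*` that are differences of two points of `S` form the two
orbits, under the rotation by 60 degrees, treated in `aliasFree_one_zero` and
`aliasFree_one_one`. -/
lemma aliasSum_eq_zero {ε : ℝ} (hε : SmallEps ε) {m n : ℤ} (hmn : ¬ (Even m ∧ Even n))
    {a b a' b' : ℝ} (h1 : InHex Real.pi a b) (h2 : InHex Real.pi a' b')
    (h3 : ¬ InHex (Real.pi / 2 - ε) a b) (h4 : ¬ InHex (Real.pi / 2 - ε) a' b')
    (ha : a' = a + Real.pi * (2 * m + n) / 2) (hb : b' = b + Real.pi * (m + 2 * n) / 2) :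
    aliasSum ε m n a b a' b' = 0 := by
  suffices h : AliasFree ε m n from h a b a' b' h1 h2 h3 h4 ha hb
  have hp := Real.pi_pos
  obtain ⟨i1, i2, i3⟩ := h1
  obtain ⟨j1, j2, j3⟩ := h2
  rw [abs_le] at i1 i2 i3 j1 j2 j3
  have bound (z : ℤ) (h : |Real.pi * z / 2| ≤ 2 * Real.pi) : |z| ≤ 4 := by
    rw [abs_div, abs_mul, abs_of_pos hp, abs_two, div_le_iff₀ (by norm_num)] at h
    have : |(z : ℝ)| ≤ 4 := by
      by_contra! h'
      nlinarith
    exact_mod_cast this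
  have k1 := bound (2 * m + n) (by push_cast; rw [abs_le]; constructor <;> linarith)
  have k2 := bound (m + 2 * n) (by push_cast; rw [abs_le]; constructor <;> linarith)
  have k3 := bound (m - n) (by push_cast; rw [abs_le]; constructor <;> linarith)
  rw [abs_le] at k1 k2 k3
  have A := aliasFree_one_zero hε
  have A1 : AliasFree ε 1 (-1) := .of_rot A
  have A2 : AliasFree ε 0 (-1) := .of_rot A1
  have A3 : AliasFree ε (-1) 0 := .of_rot A2
  have A4 : AliasFree ε (-1) 1 := .of_rot A3
  have A5 : AliasFree ε 0 1 := .of_rot A4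
  have B := aliasFree_one_one hε
  have B1 : AliasFree ε 2 (-1) := .of_rot B
  have B2 : AliasFree ε 1 (-2) := .of_rot B1
  have B3 : AliasFree ε (-1) (-1) := .of_rot B2
  have B4 : AliasFree ε (-2) 1 := .of_rot B3
  have B5 : AliasFree ε (-1) 2 := .of_rot B4
  have hm1 : -2 ≤ m := by omega
  have hm2 : m ≤ 2 := by omega
  have hn1 : -2 ≤ n := by omega
  have hn2 : n ≤ 2 := by omega
  interval_cases m <;> interval_cases n <;> first
    | assumption
    | omega
    | exact absurd (by decide) hmn

/-! ### The moduli of the filters on the cell -/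

/-- The disjointness of `A_{1,2}^ε` and `A_{1,6}^ε` forces the upper bound in `SmallEps`: for larger
`ε` the strips meet in the point `((2 + √3) ε, ε)`, which lies in `S` but not in `S_ε`. -/
lemma smallEps_of_disjoint {ε : ℝ} (h0 : 0 < ε) (h : ε < Real.pi / (4 + √3))
    (hd : Disjoint (setA12 ε) (setA16 ε)) : SmallEps ε := by
  refine ⟨h0, ?_⟩
  have hs := sqrt_three_sq
  have hs0 := sqrt_three_pos
  have hb1 : ε ≤ √3 * ε := le_mul_of_one_le_left h0.le (Real.one_le_sqrt.2 (by norm_num))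
  have hb2 : √3 * ε ≤ 2 * ε := by
    gcongr; rw [Real.sqrt_le_left (by norm_num)]; norm_num
  rw [lt_div_iff₀ (by positivity)] at h
  by_contra! hlt
  -- the common point of the upper edge of one strip and the lower edge of the other one
  obtain ⟨p, p0, p1⟩ : ∃ p : Plane, p 0 = √3 * ε + 2 * ε ∧ p 1 = ε := ⟨!₂[_, _], rfl, rfl⟩
  have hB : hexB p = √3 * ε + ε := by simp only [hexB, p0, p1]; ring
  have hmem : p ∈ hexS \ hexSeps ε := by
    refine ⟨mem_hexS.2 ?_, fun h' => ?_⟩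
    · rw [hB, p0]
      refine ⟨?_, ?_, ?_⟩ <;> rw [abs_le] <;> constructor <;> linarith
    · have h1 := (abs_le.1 ((mem_hexSeps (by linarith)).1 h').1).2
      rw [p0] at h1
      linarith
  refine Set.disjoint_left.1 hd (show p ∈ setA12 ε from ⟨hmem, ?_⟩) ⟨hmem, ?_⟩
  · rw [p1, abs_of_pos h0]
  · rw [p0, p1]
    have : ε - (√3 * ε + 2 * ε) / √3 = -(2 * ε / √3) := by field_simp; ring
    rw [this, abs_neg, abs_of_pos (by positivity)]
    apply le_of_eq; field_simp

lemma rot_zero (θ : ℝ) (x : Plane) : rot θ x 0 = Real.cos θ * x 0 - Real.sin θ * x 1 := by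
  simp [rot]
lemma rot_one (θ : ℝ) (x : Plane) : rot θ x 1 = Real.sin θ * x 0 + Real.cos θ * x 1 := by
  simp [rot]
lemma refl_zero (x : Plane) : refl x 0 = x 0 := by simp [refl]
lemma refl_one (x : Plane) : refl x 1 = -x 1 := by simp [refl]
lemma hexB_refl (x : Plane) : hexB (refl x) = x 0 - hexB x := by
  simp only [hexB, refl_zero, refl_one]; ring

lemma rot_add_angle (θ θ' : ℝ) (x : Plane) : rot θ (rot θ' x) = rot (θ + θ') x := by
  apply plane_ext <;> simp only [rot_zero, rot_one, Real.cos_add, Real.sin_add] <;> ring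

lemma rot_zero_angle (x : Plane) : rot 0 x = x := by
  apply plane_ext <;> simp [rot_zero, rot_one]

lemma refl_refl (x : Plane) : refl (refl x) = x := by
  apply plane_ext <;> simp [refl_zero, refl_one]

lemma rot_pi_div_three (x : Plane) :
    rot (Real.pi / 3) x 0 = x 0 - hexB x ∧ hexB (rot (Real.pi / 3) x) = x 0 := by
  have := sqrt_three_sq
  constructor <;> simp only [hexB, rot_zero, rot_one, Real.cos_pi_div_three,
    Real.sin_pi_div_three]
  · ring
  · linear_combination x 0 / 4 * this

lemma rot_neg_pi_div_three (x : Plane) :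
    rot (-(Real.pi / 3)) x 0 = hexB x ∧ hexB (rot (-(Real.pi / 3)) x) = hexB x - x 0 := by
  have := sqrt_three_sq
  constructor <;> simp only [hexB, rot_zero, rot_one, Real.cos_neg, Real.sin_neg,
    Real.cos_pi_div_three, Real.sin_pi_div_three]
  · ring
  · linear_combination -x 0 / 4 * this

lemma rot_two_pi_div_three (x : Plane) :
    rot (2 * Real.pi / 3) x 0 = -hexB x ∧ hexB (rot (2 * Real.pi / 3) x) = x 0 - hexB x := by
  have e : 2 * Real.pi / 3 = Real.pi / 3 + Real.pi / 3 := by ring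
  rw [e, ← rot_add_angle]
  obtain ⟨h1, h2⟩ := rot_pi_div_three x
  obtain ⟨h3, h4⟩ := rot_pi_div_three (rot (Real.pi / 3) x)
  rw [h3, h4, h1, h2]
  exact ⟨by ring, rfl⟩

/-- The symmetry of the hexagon carrying the `k`-th double sector to the first one. -/
def symMap : Fin 6 → Plane → Plane :=
  ![fun ξ => ξ, refl, rot (Real.pi / 3), fun ξ => refl (rot (Real.pi / 3) ξ),
    rot (-(Real.pi / 3)), fun ξ => refl (rot (-(Real.pi / 3)) ξ)]

/-- The numbering of the double sectors by angle that corresponds to the numbering of the sets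
`setA`. -/
def sectorIdx : Fin 6 → Fin 6 := ![0, 5, 4, 3, 2, 1]

lemma modN_eq_symMap (ε : ℝ) (k : Fin 6) (ξ : Plane) : modN ε k ξ = modN1 ε (symMap k ξ) := by
  fin_cases k <;> rfl

lemma image_eq_of_inv {α : Type*} {f g : α → α} (hfg : ∀ x, f (g x) = x) (hgf : ∀ x, g (f x) = x)
    (s : Set α) (x : α) : x ∈ f '' s ↔ g x ∈ s := by
  constructor
  · rintro ⟨y, hy, rfl⟩; rwa [hgf]
  · intro h; exact ⟨g x, h, hfg x⟩

/-- Each `A_k^ε` is the preimage of `A_1^ε` under a symmetry of the hexagon, so that statements on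
`A_k^ε` reduce to `k = 1`. -/
lemma mem_setA_iff_symMap {ε : ℝ} {k : Fin 6} {ξ : Plane} :
    ξ ∈ setA ε k ↔ symMap k ξ ∈ setA1 ε := by
  have r1 (x : Plane) : rot (-(Real.pi / 3)) (rot (Real.pi / 3) x) = x := by
    rw [rot_add_angle, neg_add_cancel, rot_zero_angle]
  have r2 (x : Plane) : rot (Real.pi / 3) (rot (-(Real.pi / 3)) x) = x := by
    rw [rot_add_angle, add_neg_cancel, rot_zero_angle]
  have i1 := fun s => image_eq_of_inv r1 r2 s
  have i2 := fun s => image_eq_of_inv r2 r1 s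
  have i3 := fun s => image_eq_of_inv refl_refl refl_refl s
  fin_cases k
  · exact Iff.rfl
  · exact i3 _ _
  · exact i1 _ _
  · exact (i1 _ _).trans (i3 _ _)
  · exact i2 _ _
  · exact (i2 _ _).trans (i3 _ _)

lemma symMap_coord (k : Fin 6) (ξ : Plane) : (symMap k ξ 0, hexB (symMap k ξ)) =
    (![(ξ 0, hexB ξ), (ξ 0, ξ 0 - hexB ξ), (ξ 0 - hexB ξ, ξ 0), (ξ 0 - hexB ξ, -hexB ξ),
      (hexB ξ, hexB ξ - ξ 0), (hexB ξ, ξ 0)] : Fin 6 → ℝ × ℝ) k := by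
  fin_cases k <;> simp [symMap, hexB_refl, refl_zero, rot_pi_div_three, rot_neg_pi_div_three]

lemma continuous_hexB : Continuous hexB := by unfold hexB; fun_prop

lemma inHex_symMap {r : ℝ} {k : Fin 6} {ξ : Plane} :
    InHex r (symMap k ξ 0) (hexB (symMap k ξ)) ↔ InHex r (ξ 0) (hexB ξ) := by
  have h := symMap_coord k ξ
  have e1 : ξ 0 - (ξ 0 - hexB ξ) = hexB ξ := by ring
  have e2 : ξ 0 - hexB ξ - -hexB ξ = ξ 0 := by ring
  have e3 : hexB ξ - (hexB ξ - ξ 0) = ξ 0 := by ring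
  have e4 : ξ 0 - hexB ξ - ξ 0 = -hexB ξ := by ring
  fin_cases k <;> simp only [Fin.zero_eta, Fin.mk_one, Fin.reduceFinMk, Matrix.cons_val,
    Prod.mk.injEq] at h ⊢ <;> rw [h.1, h.2] <;>
    simp only [InHex, e1, e2, e3, e4, abs_neg, abs_sub_comm (hexB ξ) (ξ 0)] <;> tauto

lemma sector_symMap (ε : ℝ) (k : Fin 6) (ξ : Plane) :
    sector ε 0 (symMap k ξ 0) (hexB (symMap k ξ)) = sector ε (sectorIdx k) (ξ 0) (hexB ξ) := by
  have h := symMap_coord k ξ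
  fin_cases k <;> simp only [Fin.zero_eta, Fin.mk_one, Fin.reduceFinMk, Matrix.cons_val,
    Prod.mk.injEq, sectorIdx] at h ⊢ <;> rw [h.1, h.2] <;> simp only [sector, Matrix.cons_val] <;>
    first
    | (congr 1 <;> ring1)
    | (rw [← wedge_neg_neg]; congr 1 <;> ring1)
    | (rw [← wedge_swap]; congr 1 <;> ring1)
    | (rw [← wedge_swap, ← wedge_neg_neg]; congr 1 <;> ring1)

lemma mem_annulus {ε : ℝ} (hε : SmallEps ε) {ξ : Plane} : ξ ∈ hexS \ hexSeps ε ↔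
    InHex Real.pi (ξ 0) (hexB ξ) ∧ ¬ InHex (Real.pi / 2 - ε) (ξ 0) (hexB ξ) := by
  obtain ⟨h0, h1, h2, h3⟩ := hε.bounds
  rw [Set.mem_sdiff, mem_hexS, mem_hexSeps (by linarith)]

lemma sqrt_three_mul_apply_one (ξ : Plane) : ξ 1 = (2 * hexB ξ - ξ 0) / √3 := by
  have := sqrt_three_pos
  simp only [hexB]; field_simp; ring

lemma setA12_cond (ε : ℝ) (ξ : Plane) :
    |ξ 1| ≤ ε ↔ -(√3 * ε) ≤ 2 * hexB ξ - ξ 0 ∧ 2 * hexB ξ - ξ 0 ≤ √3 * ε := by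
  rw [sqrt_three_mul_apply_one, abs_le, neg_le_div_sqrt_three, div_sqrt_three_le]

lemma setA16_cond (ε : ℝ) (ξ : Plane) :
    √3 / 2 * |ξ 1 - ξ 0 / √3| ≤ ε ↔ -ε ≤ hexB ξ - ξ 0 ∧ hexB ξ - ξ 0 ≤ ε := by
  have h := sqrt_three_pos
  have : √3 / 2 * |ξ 1 - ξ 0 / √3| = |hexB ξ - ξ 0| := by
    nth_rw 1 [← abs_of_pos (show 0 < √3 / 2 by positivity)]
    rw [← abs_mul, hexB]
    congr 1; field_simp; ring
  rw [this, abs_le]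

lemma setA11_cond (ε : ℝ) (ξ : Plane) :
    ((ξ 0 + 2 * ε) / √3 ≤ ξ 1 ↔ ε ≤ hexB ξ - ξ 0) ∧
    (ξ 1 ≤ (ξ 0 - 2 * ε) / √3 ↔ hexB ξ - ξ 0 ≤ -ε) ∧
    (ξ 1 ≤ -ε ↔ 2 * hexB ξ - ξ 0 ≤ -(√3 * ε)) ∧
    (ε ≤ ξ 1 ↔ √3 * ε ≤ 2 * hexB ξ - ξ 0) := by
  have h := sqrt_three_pos
  refine ⟨?_, ?_, ?_, ?_⟩
  · rw [div_le_iff₀ h, hexB]; constructor <;> intro <;> linarith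
  · rw [le_div_iff₀ h, hexB]; constructor <;> intro <;> linarith
  · rw [sqrt_three_mul_apply_one, div_sqrt_three_le_neg]
  · rw [sqrt_three_mul_apply_one, le_div_sqrt_three]

/-- Outside `S_ε` the set `A_1^ε` is a double sector, enlarged by `ε` on each side. -/
lemma mem_setA1 {ε : ℝ} (hε : SmallEps ε) {ξ : Plane} : ξ ∈ setA1 ε ↔ ξ ∈ hexS \ hexSeps ε ∧
    ((-(√3 * ε) ≤ 2 * hexB ξ - ξ 0 ∧ hexB ξ - ξ 0 ≤ ε) ∨
      (2 * hexB ξ - ξ 0 ≤ √3 * ε ∧ -ε ≤ hexB ξ - ξ 0)) := by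
  obtain ⟨h0, h1, h2, h3⟩ := hε.bounds
  obtain ⟨c1, c2, c3, c4⟩ := setA11_cond ε ξ
  simp only [setA1, setA12, setA16, setA11, Set.mem_union, Set.mem_ofPred_eq, setA12_cond,
    setA16_cond, c1, c2, c3, c4]
  constructor
  · rintro ((⟨h, h4, h5⟩ | ⟨h, h4, h5⟩) | ⟨h, h4, h5, h6⟩ | ⟨h, h4, h5, h6⟩)
    · refine ⟨h, ?_⟩
      rcases le_total (hexB ξ - ξ 0) 0 with h7 | h7
      · left; constructor <;> linarith
      · right; constructor <;> linarith
    · refine ⟨h, ?_⟩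
      rcases le_total (2 * hexB ξ - ξ 0) 0 with h7 | h7
      · right; constructor <;> linarith
      · left; constructor <;> linarith
    · exact ⟨h, Or.inr ⟨by linarith, by linarith⟩⟩
    · exact ⟨h, Or.inl ⟨by linarith, by linarith⟩⟩
  · rintro ⟨h, ⟨h4, h5⟩ | ⟨h4, h5⟩⟩
    · rcases le_total (2 * hexB ξ - ξ 0) (√3 * ε) with h6 | h6
      · exact Or.inl (Or.inl ⟨h, h4, h6⟩)
      rcases le_total (-ε) (hexB ξ - ξ 0) with h7 | h7
      · exact Or.inl (Or.inr ⟨h, h7, h5⟩)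
      · exact Or.inr (Or.inr ⟨h, by linarith, h7, h6⟩)
    · rcases le_total (-(√3 * ε)) (2 * hexB ξ - ξ 0) with h6 | h6
      · exact Or.inl (Or.inl ⟨h, h6, h4⟩)
      rcases le_total (hexB ξ - ξ 0) ε with h7 | h7
      · exact Or.inl (Or.inr ⟨h, h5, h7⟩)
      · exact Or.inr (Or.inl ⟨h, by linarith, h7, h6⟩)

lemma modN1_support {ε : ℝ} {ξ : Plane} (h : modN1 ε ξ ≠ 0) : ξ ∈ setA1 ε := by
  unfold modN1 at h
  split_ifs at h with h1 h2 _ h3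
  · exact Or.inr h1
  · exact Or.inl (Or.inl h2)
  · exact Or.inl (Or.inl h2)
  · exact Or.inl (Or.inr h3)
  · exact Or.inl (Or.inr h3)
  · exact absurd rfl h

/-- Outside `S_ε` the case distinctions in the definition of `𝓝_1` merge into the single continuous
formula `sector`. -/
lemma modN1_eq {ε : ℝ} (hε : SmallEps ε) {ξ : Plane} (hξ : ξ ∈ hexS \ hexSeps ε) :
    modN1 ε ξ = sector ε 0 (ξ 0) (hexB ξ) := by
  obtain ⟨h0, h1, h2, h3⟩ := hε.bounds
  obtain ⟨hin, hout⟩ := (mem_annulus hε).1 hξ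
  have hout := not_inHex hout
  have h3' := sqrt_three_pos
  by_cases hA : ξ ∈ setA1 ε
  swap
  · rw [not_imp_comm.1 modN1_support hA]
    by_contra hz
    apply hA
    rw [mem_setA1 hε]
    rcases (sector_ne_zero h0).1 (Ne.symm hz) with ⟨h, h'⟩ | ⟨h, h'⟩
    · exact ⟨hξ, Or.inl ⟨h.le, h'.le⟩⟩
    · exact ⟨hξ, Or.inr ⟨h.le, h'.le⟩⟩
  obtain ⟨c1, c2, c3, c4⟩ := setA11_cond ε ξ
  have e12 : ξ 1 / (2 * ε) = (2 * hexB ξ - ξ 0) / √3 / (2 * ε) := by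
    rw [← sqrt_three_mul_apply_one]
  have e16 : (ξ 1 - ξ 0 / √3) * (√3 / (4 * ε)) = (hexB ξ - ξ 0) / (2 * ε) := by
    simp only [hexB]; field_simp; ring
  unfold modN1
  simp only [sector, wedge, Matrix.cons_val]
  split_ifs with hA11 hA12 hneg hA16 hneg
  · rcases hA11 with ⟨-, h4, h5, h6⟩ | ⟨-, h4, h5, h6⟩
    · rw [c1] at h5
      rw [c3] at h6
      obtain ⟨e0, e0'⟩ := cut_pair' h0 (div_sqrt_three_le_neg.2 h6)
      obtain ⟨e1, e1'⟩ := cut_pair h0 h5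
      rw [e0, e0', e1, e1']; ring
    · rw [c2] at h5
      rw [c4] at h6
      obtain ⟨e0, e0'⟩ := cut_pair h0 (le_div_sqrt_three.2 h6)
      obtain ⟨e1, e1'⟩ := cut_pair' h0 h5
      rw [e0, e0', e1, e1']; ring
  · obtain ⟨h4, h5⟩ := (setA12_cond ε ξ).1 hA12.2
    obtain ⟨e1, e1'⟩ := cut_pair h0 (show ε ≤ hexB ξ - ξ 0 by
      rcases hout with h | h | h | h | h | h <;> linarith)
    rw [e1, e1', e12]
    simp only [mul_zero, mul_one, zero_add, cut, neg_div]
  · obtain ⟨h4, h5⟩ := (setA12_cond ε ξ).1 hA12.2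
    obtain ⟨e1, e1'⟩ := cut_pair' h0 (show hexB ξ - ξ 0 ≤ -ε by
      rcases hout with h | h | h | h | h | h <;> linarith)
    rw [e1, e1', e12]
    simp only [mul_zero, mul_one, add_zero, cut, neg_div]
  · obtain ⟨h4, h5⟩ := (setA16_cond ε ξ).1 hA16.2
    obtain ⟨e1, e1'⟩ := cut_pair' h0 (div_sqrt_three_le_neg.2
      (show 2 * hexB ξ - ξ 0 ≤ -(√3 * ε) by
        rcases hout with h | h | h | h | h | h <;> linarith))
    rw [e1, e1', e16]
    simp only [zero_mul, one_mul, zero_add, cut, neg_div]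
  · obtain ⟨h4, h5⟩ := (setA16_cond ε ξ).1 hA16.2
    obtain ⟨e1, e1'⟩ := cut_pair h0 (le_div_sqrt_three.2
      (show √3 * ε ≤ 2 * hexB ξ - ξ 0 by
        rcases hout with h | h | h | h | h | h <;> linarith))
    rw [e1, e1', e16]
    simp only [zero_mul, one_mul, add_zero, cut, neg_div]
  · rcases hA with (h | h) | h <;> exact absurd h ‹_›

lemma modN_eq {ε : ℝ} (hε : SmallEps ε) (k : Fin 6) {ξ : Plane} (hξ : ξ ∈ hexS \ hexSeps ε) :
    modN ε k ξ = sector ε (sectorIdx k) (ξ 0) (hexB ξ) := by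
  rw [modN_eq_symMap, modN1_eq hε, sector_symMap]
  rw [mem_annulus hε] at hξ ⊢
  rwa [inHex_symMap, inHex_symMap]

lemma modN_support {ε : ℝ} {k : Fin 6} {ξ : Plane} (h : modN ε k ξ ≠ 0) : ξ ∈ setA ε k := by
  rw [modN_eq_symMap] at h
  exact mem_setA_iff_symMap.2 (modN1_support h)

lemma sum_modN_sq {ε : ℝ} (hε : SmallEps ε) {ξ : Plane} (hξ : ξ ∈ hexS \ hexSeps ε) :
    ∑ k, modN ε k ξ ^ 2 = 1 := by
  rw [← sum_sector_sq hε _ _ ((mem_annulus hε).1 hξ).2]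
  simp only [modN_eq hε _ hξ]
  refine Function.Bijective.sum_comp (e := sectorIdx) ?_ fun j => sector ε j (ξ 0) (hexB ξ) ^ 2
  decide

/-! ### The refinement filter -/

/-- The interior of the hexagon of inradius `r`, in the coordinates `(a, b)`. -/
def InHexLt (r a b : ℝ) : Prop := |a| < r ∧ |b| < r ∧ |a - b| < r

lemma InHexLt.inHex {r a b : ℝ} (h : InHexLt r a b) : InHex r a b := ⟨h.1.le, h.2.1.le, h.2.2.le⟩

lemma int_eq_zero_of_hex {m n : ℤ} (h1 : |Real.pi * (2 * m + n)| < 2 * Real.pi)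
    (h2 : |Real.pi * (m + 2 * n)| < 2 * Real.pi) (h3 : |Real.pi * (m - n)| < 2 * Real.pi) :
    m = 0 ∧ n = 0 := by
  have hp := Real.pi_pos
  have bound (z : ℤ) (h : |Real.pi * z| < 2 * Real.pi) : |z| < 2 := by
    rw [abs_mul, abs_of_pos hp, mul_comm] at h
    exact_mod_cast lt_of_mul_lt_mul_right h hp.le
  have k1 := bound (2 * m + n) (by push_cast; exact h1)
  have k2 := bound (m + 2 * n) (by push_cast; exact h2)
  have k3 := bound (m - n) (by push_cast; exact h3)
  rw [abs_lt] at k1 k2 k3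
  omega

namespace IsRefinementModulus

variable {ε : ℝ} {M0 : Plane → ℝ}

/-- By continuity `𝓜_0` also vanishes on the boundary of `A_0`. -/
lemma inHexLt_of_ne_zero (h : IsRefinementModulus ε M0) {ξ : Plane} (hξ : ξ ∈ hexS)
    (h0 : M0 ξ ≠ 0) : InHexLt (Real.pi / 2) (ξ 0) (hexB ξ) := by
  have hp := Real.pi_pos
  by_contra hlt
  have hA : ξ ∈ hexA0 := by
    by_contra hA
    exact h0 (h.eq_zero ξ ⟨hξ, hA⟩)
  have hA' := mem_hexA0.1 hA
  -- the dilates of `ξ` by factors between `1` and `2` are in `S`, but not in `A_0`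
  have key : ∀ t ∈ Set.Ioc (1 : ℝ) 2, M0 (t • ξ) = 0 ∧ t • ξ ∈ hexS := by
    intro t ht
    have hS : t • ξ ∈ hexS := by
      rw [mem_hexS, hexB_smul]
      have := hA'.smul (c := t)
      have habs : |t| * (Real.pi / 2) ≤ Real.pi := by
        rw [abs_of_pos (by linarith [ht.1])]; nlinarith [ht.2]
      exact ⟨this.1.trans habs, this.2.1.trans habs, this.2.2.trans habs⟩
    refine ⟨h.eq_zero _ ⟨hS, fun hA2 => hlt ?_⟩, hS⟩
    have h2 := (mem_hexA0.1 hA2).smul (c := t⁻¹)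
    have ht0 : 0 < t := by linarith [ht.1]
    have e1 : t⁻¹ * (t • ξ) 0 = ξ 0 := by
      simp only [PiLp.smul_apply, smul_eq_mul]; field_simp
    have e2 : t⁻¹ * hexB (t • ξ) = hexB ξ := by rw [hexB_smul]; field_simp
    rw [e1, e2] at h2
    have habs : |t⁻¹| * (Real.pi / 2) < Real.pi / 2 := by
      rw [abs_of_pos (inv_pos.2 ht0)]
      have : t⁻¹ < 1 := inv_lt_one_of_one_lt₀ ht.1
      nlinarith
    exact ⟨h2.1.trans_lt habs, h2.2.1.trans_lt habs, h2.2.2.trans_lt habs⟩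
  apply h0
  have hlim : Filter.Tendsto (fun t : ℝ => M0 (t • ξ)) (nhdsWithin 1 (Set.Ioc 1 2))
      (nhds (M0 ξ)) := by
    refine (h.continuousOn ξ hξ).tendsto.comp ?_
    refine tendsto_nhdsWithin_of_tendsto_nhds_of_eventually_within _ ?_ ?_
    · have : Filter.Tendsto (fun t : ℝ => t • ξ) (nhds 1) (nhds ((1 : ℝ) • ξ)) :=
        (continuous_id.smul continuous_const).tendsto _
      rw [one_smul] at this
      exact this.mono_left nhdsWithin_le_nhds
    · exact eventually_nhdsWithin_of_forall fun t ht => (key t ht).2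
  have hz : Filter.Tendsto (fun t : ℝ => M0 (t • ξ)) (nhdsWithin 1 (Set.Ioc 1 2)) (nhds 0) :=
    tendsto_nhdsWithin_congr (f := fun _ => 0) (fun t ht => (key t ht).1.symm)
      tendsto_const_nhds
  have : (nhdsWithin (1 : ℝ) (Set.Ioc 1 2)).NeBot := by
    rw [nhdsWithin_Ioc_eq_nhdsGT one_lt_two]; infer_instance
  exact tendsto_nhds_unique hlim hz

/-- As `𝓜_0` vanishes near the boundary of `S`, the choice of representatives on this boundary does
not affect its periodic extension. -/
lemma periodize_eq_of_mem (h : IsRefinementModulus ε M0) {ξ : Plane} (hξ : ξ ∈ hexS) :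
    periodize M0 ξ = M0 ξ := by
  have hp := Real.pi_pos
  obtain ⟨m, n, hmn⟩ := exists_cellRep_eq ξ
  have hr := hexCell_subset (cellRep_mem ξ)
  rw [periodize_eq]
  by_contra hne
  have hor : InHexLt (Real.pi / 2) (ξ 0) (hexB ξ) ∨
      InHexLt (Real.pi / 2) (cellRep ξ 0) (hexB (cellRep ξ)) := by
    rcases ne_or_eq (M0 ξ) 0 with h0 | h0
    · exact Or.inl (h.inHexLt_of_ne_zero hξ h0)
    · exact Or.inr (h.inHexLt_of_ne_zero hr fun h1 => hne (h1.trans h0.symm))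
  have h1 := mem_hexS.1 hξ
  have h2 := mem_hexS.1 hr
  have e1 : cellRep ξ 0 = ξ 0 + Real.pi * (2 * m + n) := by rw [hmn]; simp
  have e2 : hexB (cellRep ξ) = hexB ξ + Real.pi * (m + 2 * n) := by
    rw [hmn, hexB_add, hexB_latPt]
  simp only [InHex, InHexLt, abs_le, abs_lt] at hor h1 h2
  obtain ⟨rfl, rfl⟩ : m = 0 ∧ n = 0 := by
    apply int_eq_zero_of_hex <;> rw [abs_lt] <;> rcases hor with hor | hor <;>
      constructor <;> linarith
  apply hne
  rw [hmn]
  congr 1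
  apply plane_ext <;> simp

lemma periodize_mem (h : IsRefinementModulus ε M0) (ξ : Plane) :
    periodize M0 ξ ∈ Set.Icc 0 1 := by
  rw [periodize_eq]
  exact ⟨h.nonneg _ (hexCell_subset (cellRep_mem ξ)), h.le_one _ (hexCell_subset (cellRep_mem ξ))⟩

/-- The supports of `𝓜_0` and of its translates by the nonzero vectors of `Λ*/2` modulo `Λ*` are
disjoint. -/
lemma periodize_mul_periodize (h : IsRefinementModulus ε M0) (ξ : Plane) {m n : ℤ}
    (hmn : ¬ (Even m ∧ Even n)) :
    periodize M0 ξ * periodize M0 (ξ + latPt (m / 2) (n / 2)) = 0 := by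
  have hp := Real.pi_pos
  refine mul_eq_zero_of_imp fun h1 h2 => hmn ?_
  rw [periodize_eq] at h1 h2
  obtain ⟨p, q, hpq⟩ := exists_cellRep_eq ξ
  obtain ⟨p', q', hpq'⟩ := exists_cellRep_eq (ξ + latPt (m / 2) (n / 2))
  have i1 := h.inHexLt_of_ne_zero (hexCell_subset (cellRep_mem _)) h1
  have i2 := h.inHexLt_of_ne_zero (hexCell_subset (cellRep_mem _)) h2
  rw [hpq, hexB_add, hexB_latPt] at i1
  rw [hpq', hexB_add, hexB_latPt, hexB_add, hexB_latPt] at i2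
  simp only [InHexLt, abs_lt, PiLp.add_apply, latPt_zero] at i1 i2
  have : m + 2 * (p' - p) = 0 ∧ n + 2 * (q' - q) = 0 := by
    apply int_eq_zero_of_hex <;> rw [abs_lt] <;> push_cast <;> constructor <;> linarith
  constructor
  · rw [Int.even_iff]; omega
  · rw [Int.even_iff]; omega

end IsRefinementModulus

/-! ### The matrix identities behind perfect reconstruction -/

/-- The coordinates of the lattice points. -/
def latticeEquiv : (ℤ × ℤ) ≃+ hexLattice :=
  AddEquiv.ofBijective
    ({ toFun := fun p => ⟨hexPt p.1 p.2, mem_hexLattice.2 ⟨_, _, rfl⟩⟩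
       map_zero' := by ext1; apply plane_ext <;> simp
       map_add' := fun p q => by ext1; simp [hexPt_add] } : (ℤ × ℤ) →+ hexLattice) <| by
    constructor
    · rintro ⟨m, n⟩ ⟨m', n'⟩ h
      have h1 : hexPt m n = hexPt m' n' := congrArg Subtype.val h
      have h2 := congrArg (inner ℝ · (latPt 1 0)) h1
      have h3 := congrArg (inner ℝ · (latPt 0 1)) h1
      simp only [inner_hexPt_latPt, mul_one, mul_zero, add_zero, zero_add] at h2 h3
      have h4 : m = m' := by exact_mod_cast mul_left_cancel₀ (by positivity) h2
      have h5 : n = n' := by exact_mod_cast mul_left_cancel₀ (by positivity) h3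
      rw [h4, h5]
    · rintro ⟨x, hx⟩
      obtain ⟨m, n, rfl⟩ := mem_hexLattice.1 hx
      exact ⟨(m, n), rfl⟩

lemma coe_latticeEquiv (p : ℤ × ℤ) : (latticeEquiv p : Plane) = hexPt p.1 p.2 := rfl

lemma latticeEquiv_mem_frameLattice (k : Fin 7) (p : ℤ × ℤ) :
    (latticeEquiv p : Plane) ∈ frameLattice k ↔ Even p.1 ∧ Even p.2 := by
  obtain ⟨m, n⟩ := p
  change hexPt m n ∈ (2 : ℝ) • hexLattice ↔ _
  rw [AddSubgroup.mem_smul_pointwise_iff_exists]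
  constructor
  · rintro ⟨x, hx, h⟩
    obtain ⟨p, q, rfl⟩ := mem_hexLattice.1 hx
    rw [smul_hexPt] at h
    have h' : latticeEquiv (2 * p, 2 * q) = latticeEquiv (m, n) := by
      ext1; simpa [coe_latticeEquiv] using h
    have := latticeEquiv.injective h'
    simp only [Prod.mk.injEq] at this
    exact ⟨⟨p, by omega⟩, ⟨q, by omega⟩⟩
  · rintro ⟨⟨p, rfl⟩, ⟨q, rfl⟩⟩
    refine ⟨hexPt p q, mem_hexLattice.2 ⟨_, _, rfl⟩, ?_⟩
    rw [smul_hexPt]; push_cast; congr 1 <;> ring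

lemma relIndex_frameLattice (k : Fin 7) : (frameLattice k).relIndex hexLattice = 4 := by
  -- reduction modulo `2` of the coordinates has kernel `2Λ`
  let red : (ℤ × ℤ) →+ ZMod 2 × ZMod 2 :=
    (Int.castAddHom (ZMod 2)).prodMap (Int.castAddHom (ZMod 2))
  have hred : Function.Surjective red :=
    Function.Surjective.prodMap ZMod.intCast_surjective ZMod.intCast_surjective
  have hker : ((frameLattice k).addSubgroupOf hexLattice).comap
      (latticeEquiv : (ℤ × ℤ) →+ hexLattice) = red.ker := by
    ext ⟨m, n⟩
    rw [AddSubgroup.mem_comap, AddSubgroup.mem_addSubgroupOf, AddMonoidHom.mem_ker]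
    have hr : red (m, n) = 0 ↔ Even m ∧ Even n := by
      simp only [red, AddMonoidHom.prodMap, AddMonoidHom.prod_apply, Prod.mk_eq_zero,
        AddMonoidHom.comp_apply, AddMonoidHom.coe_fst, AddMonoidHom.coe_snd,
        Int.coe_castAddHom, ZMod.intCast_eq_zero_iff_even]
    rw [hr]
    exact latticeEquiv_mem_frameLattice k (m, n)
  rw [AddSubgroup.relIndex, ← AddSubgroup.index_comap_of_surjective _ (f :=
    (latticeEquiv : (ℤ × ℤ) →+ hexLattice)) latticeEquiv.surjective, hker,
    AddSubgroup.index_ker, AddMonoidHom.range_eq_top.2 hred]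
  simp [Nat.card_eq_fintype_card]

lemma transfer_eq (ε : ℝ) (M0 : Plane → ℝ) (k : Fin 7) (ξ : Plane) :
    transfer ε M0 k ξ = 2 * filt ε M0 k ξ := by
  have h : √((4 : ℕ) : ℝ) = 2 := by
    rw [show ((4 : ℕ) : ℝ) = 2 ^ 2 by norm_num, Real.sqrt_sq (by norm_num)]
  rw [transfer, relIndex_frameLattice, h]
  norm_num

/-- The coordinates of the phase vectors in the basis of `Λ` used in `hexPt`. -/
def etaCoord : Fin 7 → ℤ × ℤ := ![(0, 0), (2, 1), (1, 2), (-1, 1), (-2, -1), (-1, -2), (1, -1)]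

lemma etaFr_eq (k : Fin 7) : etaFr k = hexPt (etaCoord k).1 (etaCoord k).2 := by
  have h := sqrt_three_pos
  have hs := sqrt_three_sq
  fin_cases k <;> apply plane_ext <;> simp [etaFr, etaCoord] <;> field_simp <;> norm_num

lemma filt_add_reciprocal (ε : ℝ) (M0 : Plane → ℝ) (k : Fin 7) {γ : Plane}
    (hγ : γ ∈ reciprocal hexLattice) (ξ : Plane) : filt ε M0 k (ξ + γ) = filt ε M0 k ξ := by
  have h1 : modM ε M0 k (ξ + γ) = modM ε M0 k ξ := by
    refine Fin.cases ?_ (fun j => ?_) k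
    · simp [modM, periodize_add hγ]
    · simp [modM, periodize_add hγ]
  obtain ⟨m, hm⟩ : ∃ m : ℤ, inner ℝ (etaFr k) γ = 2 * Real.pi * m :=
    hγ _ (by rw [etaFr_eq]; exact mem_hexLattice.2 ⟨_, _, rfl⟩)
  have h2 : Complex.exp (Complex.I * ((2 * Real.pi * m : ℝ) : ℂ)) = 1 := by
    rw [Complex.exp_eq_one_iff]
    exact ⟨m, by push_cast; ring⟩
  rw [filt, filt, h1, inner_add_left, real_inner_comm (etaFr k) γ, hm]
  rw [Complex.ofReal_add, mul_add, Complex.exp_add, h2, mul_one]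

lemma exp_pi_int (z : ℤ) : Complex.exp (Complex.I * ((Real.pi * z : ℝ) : ℂ)) = (-1) ^ z := by
  rw [← Complex.exp_pi_mul_I, ← Complex.exp_int_mul]
  congr 1; push_cast; ring

lemma filt_mul_conj (ε : ℝ) (M0 : Plane → ℝ) (k : Fin 7) (ξ : Plane) (m n : ℤ) :
    filt ε M0 k (ξ + latPt (m / 2) (n / 2)) * (starRingEnd ℂ) (filt ε M0 k ξ) =
      ((-1) ^ ((etaCoord k).1 * m + (etaCoord k).2 * n) *
        (modM ε M0 k ξ * modM ε M0 k (ξ + latPt (m / 2) (n / 2))) : ℝ) := by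
  have e1 : inner ℝ (ξ + latPt (m / 2) (n / 2)) (etaFr k) =
      inner ℝ ξ (etaFr k) + Real.pi * (((etaCoord k).1 * m + (etaCoord k).2 * n : ℤ) : ℝ) := by
    rw [inner_add_left, real_inner_comm _ (latPt _ _), etaFr_eq, inner_hexPt_latPt]
    push_cast; ring
  rw [filt, filt, e1, Complex.ofReal_add, mul_add, Complex.exp_add, exp_pi_int, map_mul,
    Complex.conj_ofReal, ← Complex.exp_conj, map_mul, Complex.conj_I, Complex.conj_ofReal]
  have e2 : Complex.exp (Complex.I * (inner ℝ ξ (etaFr k) : ℝ)) *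
      Complex.exp (-Complex.I * (inner ℝ ξ (etaFr k) : ℝ)) = 1 := by
    rw [← Complex.exp_add, neg_mul, add_neg_cancel, Complex.exp_zero]
  push_cast
  linear_combination (modM ε M0 k (ξ + latPt (m / 2) (n / 2)) : ℂ) *
    (-1) ^ ((etaCoord k).1 * m + (etaCoord k).2 * n) * (modM ε M0 k ξ : ℂ) * e2

/-- The identity `∑_{k=1}^6 m_k(ξ + γ) conj (m_k(ξ)) = δ_γ (1 - 𝓜_0(ξ)²)` for `γ ∈ Λ*/2` modulo `Λ*`,
in terms of the moduli: the quotient of the phases of `m_k` at `ξ + γ` and `ξ` is a sign. -/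
lemma sum_modM_mul {ε : ℝ} {M0 : Plane → ℝ} (hε : SmallEps ε) (h : IsRefinementModulus ε M0)
    (ξ : Plane) (m n : ℤ) :
    ∑ k : Fin 6, (-1) ^ ((etaCoord k.succ).1 * m + (etaCoord k.succ).2 * n) *
      (modM ε M0 k.succ ξ * modM ε M0 k.succ (ξ + latPt (m / 2) (n / 2))) =
      if Even m ∧ Even n then 1 - periodize M0 ξ ^ 2 else 0 := by
  have hin := hexCell_subset (cellRep_mem ξ)
  have hin' := hexCell_subset (cellRep_mem (ξ + latPt (m / 2) (n / 2)))
  -- the square root factor kills everything on `S_ε`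
  have hz : ∀ ξ, cellRep ξ ∈ hexSeps ε → ∀ k : Fin 6, modM ε M0 k.succ ξ = 0 := by
    intro ξ hξ k
    have : periodize M0 ξ = 1 := by rw [periodize_eq, h.eq_one _ hξ]
    simp [modM, this]
  by_cases hS : cellRep ξ ∈ hexSeps ε
  · have : periodize M0 ξ = 1 := by rw [periodize_eq, h.eq_one _ hS]
    simp [hz _ hS, this]
  have hmod : ∀ ξ, cellRep ξ ∉ hexSeps ε → ∀ k : Fin 6, modM ε M0 k.succ ξ =
      sector ε (sectorIdx k) (cellRep ξ 0) (hexB (cellRep ξ)) * √(1 - periodize M0 ξ ^ 2) := by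
    intro ξ hξ k
    rw [← modN_eq hε k ⟨hexCell_subset (cellRep_mem ξ), hξ⟩, ← periodize_eq (modN ε k)]
    rfl
  split_ifs with hmn
  · have hrec : latPt (m / 2) (n / 2) ∈ reciprocal hexLattice := by
      obtain ⟨⟨p, rfl⟩, ⟨q, rfl⟩⟩ := hmn
      refine mem_reciprocal.2 ⟨p, q, ?_⟩
      congr 1 <;> push_cast <;> ring
    have hsgn : ∀ k : Fin 6, (-1 : ℝ) ^ ((etaCoord k.succ).1 * m + (etaCoord k.succ).2 * n) = 1 :=
      fun k => Even.neg_one_zpow ((hmn.1.mul_left _).add (hmn.2.mul_left _))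
    have hper : ∀ k : Fin 6, modM ε M0 k.succ (ξ + latPt (m / 2) (n / 2)) =
        modM ε M0 k.succ ξ := fun k => by simp [modM, periodize_add hrec]
    have hsum := sum_modN_sq hε (ξ := cellRep ξ) ⟨hin, hS⟩
    have hP := h.periodize_mem ξ
    have hsq : √(1 - periodize M0 ξ ^ 2) ^ 2 = 1 - periodize M0 ξ ^ 2 :=
      Real.sq_sqrt (by nlinarith [hP.1, hP.2])
    calc _ = (∑ k, modN ε k (cellRep ξ) ^ 2) * √(1 - periodize M0 ξ ^ 2) ^ 2 := by
          rw [Finset.sum_mul]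
          refine Finset.sum_congr rfl fun k _ => ?_
          rw [hsgn, hper, hmod ξ hS, modN_eq hε k ⟨hin, hS⟩]
          ring
      _ = _ := by rw [hsum, hsq, one_mul]
  · by_cases hS' : cellRep (ξ + latPt (m / 2) (n / 2)) ∈ hexSeps ε
    · simp [hz _ hS']
    obtain ⟨p, q, hpq⟩ := exists_cellRep_eq ξ
    obtain ⟨p', q', hpq'⟩ := exists_cellRep_eq (ξ + latPt (m / 2) (n / 2))
    have hal := aliasSum_eq_zero hε (m := m + 2 * (p' - p)) (n := n + 2 * (q' - q))
      (by
        simp only [Int.even_iff] at hmn ⊢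
        omega)
      (mem_hexS.1 hin) (mem_hexS.1 hin')
      ((mem_annulus hε).1 ⟨hin, hS⟩).2 ((mem_annulus hε).1 ⟨hin', hS'⟩).2
      (by rw [hpq, hpq']; simp; ring)
      (by rw [hpq, hpq']; simp only [hexB_add, hexB_latPt]; push_cast; ring)
    have ev (x y : ℤ) (h : Even (x - y)) : (-1 : ℝ) ^ x = (-1) ^ y := by
      rw [show x = y + (x - y) by ring, zpow_add₀ (by norm_num), h.neg_one_zpow, mul_one]
    rw [aliasSum, ev (n + 2 * (q' - q)) n ⟨q' - q, by ring⟩,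
      ev (m + 2 * (p' - p)) m ⟨p' - p, by ring⟩,
      ev (m + 2 * (p' - p) + (n + 2 * (q' - q))) (m + n) ⟨q' - q + (p' - p), by ring⟩] at hal
    simp only [hmod _ hS, hmod _ hS']
    rw [Fin.sum_univ_six]
    have c0 : etaCoord (Fin.succ 0) = (2, 1) := rfl
    have c1 : etaCoord (Fin.succ 1) = (1, 2) := rfl
    have c2 : etaCoord (Fin.succ 2) = (-1, 1) := rfl
    have c3 : etaCoord (Fin.succ 3) = (-2, -1) := rfl
    have c4 : etaCoord (Fin.succ 4) = (-1, -2) := rfl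
    have c5 : etaCoord (Fin.succ 5) = (1, -1) := rfl
    rw [c0, c1, c2, c3, c4, c5]
    simp only [sectorIdx, Matrix.cons_val]
    rw [ev (2 * m + 1 * n) n ⟨m, by ring⟩, ev (1 * m + 2 * n) m ⟨n, by ring⟩,
      ev (-1 * m + 1 * n) (m + n) ⟨-m, by ring⟩, ev (-2 * m + -1 * n) n ⟨-m - n, by ring⟩,
      ev (-1 * m + -2 * n) m ⟨-m - n, by ring⟩, ev (1 * m + -1 * n) (m + n) ⟨-n, by ring⟩]
    linear_combination (√(1 - periodize M0 ξ ^ 2) *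
      √(1 - periodize M0 (ξ + latPt (m / 2) (n / 2)) ^ 2)) * hal

lemma sum_filt_succ {ε : ℝ} {M0 : Plane → ℝ} (hε : SmallEps ε) (h : IsRefinementModulus ε M0)
    (ξ : Plane) (m n : ℤ) :
    ∑ k : Fin 6, filt ε M0 k.succ (ξ + latPt (m / 2) (n / 2)) *
      (starRingEnd ℂ) (filt ε M0 k.succ ξ) =
      if Even m ∧ Even n then ((1 - periodize M0 ξ ^ 2 : ℝ) : ℂ) else 0 := by
  simp only [filt_mul_conj]
  rw [← Complex.ofReal_sum, sum_modM_mul hε h]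
  split_ifs <;> simp

lemma filt_zero_mul {ε : ℝ} {M0 : Plane → ℝ} (h : IsRefinementModulus ε M0)
    (ξ : Plane) (m n : ℤ) :
    filt ε M0 0 (ξ + latPt (m / 2) (n / 2)) * (starRingEnd ℂ) (filt ε M0 0 ξ) =
      if Even m ∧ Even n then ((periodize M0 ξ ^ 2 : ℝ) : ℂ) else 0 := by
  rw [filt_mul_conj]
  have hc : etaCoord 0 = (0, 0) := rfl
  have hM : modM ε M0 0 = periodize M0 := rfl
  rw [hc, hM]
  split_ifs with hmn
  · have hrec : latPt (m / 2) (n / 2) ∈ reciprocal hexLattice := by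
      obtain ⟨⟨p, rfl⟩, ⟨q, rfl⟩⟩ := hmn
      refine mem_reciprocal.2 ⟨p, q, ?_⟩
      congr 1 <;> push_cast <;> ring
    rw [periodize_add hrec]
    simp [sq]
  · rw [h.periodize_mul_periodize ξ hmn]; simp

lemma sum_filt {ε : ℝ} {M0 : Plane → ℝ} (hε : SmallEps ε) (h : IsRefinementModulus ε M0)
    (ξ : Plane) (m n : ℤ) :
    ∑ k : Fin 7, filt ε M0 k (ξ + latPt (m / 2) (n / 2)) * (starRingEnd ℂ) (filt ε M0 k ξ) =
      if Even m ∧ Even n then 1 else 0 := by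
  rw [Fin.sum_univ_succ, filt_zero_mul h, sum_filt_succ hε h]
  split_ifs <;> simp

/-! ### Integration over the cell and Fourier series -/

section Torus

attribute [local instance] instMeasureSpaceUnitAddCircle

/-- The quotient map from the plane to `ℝ²/Λ*`, identified with the standard torus. -/
def toTorus (ξ : Plane) : UnitAddTorus (Fin 2) := fun i => ((![latS ξ, latT ξ] i : ℝ) : UnitAddCircle)

lemma measurable_latS : Measurable latS := by
  unfold latS; fun_prop

lemma measurable_latT : Measurable latT := by
  unfold latT; fun_prop

lemma measurable_toTorus : Measurable toTorus := by
  refine measurable_pi_lambda _ fun i => ?_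
  have h1 := measurable_latS
  have h2 := measurable_latT
  fin_cases i
  · exact AddCircle.measurable_mk'.comp h1
  · exact AddCircle.measurable_mk'.comp h2

lemma latS_add (x y : Plane) : latS (x + y) = latS x + latS y := by
  simp only [latS, inner_add_right, add_div]

lemma latT_add (x y : Plane) : latT (x + y) = latT x + latT y := by
  simp only [latT, inner_add_right, add_div]

lemma toTorus_add {ξ γ : Plane} (hγ : γ ∈ reciprocal hexLattice) :
    toTorus (ξ + γ) = toTorus ξ := by
  obtain ⟨m, n, rfl⟩ := mem_reciprocal.1 hγ
  funext i
  fin_cases i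
  · simp [toTorus, latS_add]
  · simp [toTorus, latT_add]

lemma toTorus_eq_iff {ξ ξ' : Plane} (h : toTorus ξ = toTorus ξ') :
    ξ' - ξ ∈ reciprocal hexLattice := by
  have h0 := congrFun h 0
  have h1 := congrFun h 1
  simp only [toTorus, Matrix.cons_val] at h0 h1
  rw [eq_comm, ← sub_eq_zero, ← AddCircle.coe_sub, AddCircle.coe_eq_zero_iff] at h0 h1
  obtain ⟨m, hm⟩ := h0
  obtain ⟨n, hn⟩ := h1
  refine mem_reciprocal.2 ⟨m, n, ?_⟩
  rw [← latPt_latS_latT (ξ' - ξ)]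
  have e1 := latS_add (ξ' - ξ) ξ
  have e2 := latT_add (ξ' - ξ) ξ
  rw [sub_add_cancel] at e1 e2
  simp only [zsmul_eq_mul, mul_one] at hm hn
  congr 1 <;> linarith

lemma measurableSet_hexCell : MeasurableSet hexCell := by
  have h1 : Measurable fun ξ : Plane => ξ 0 := by fun_prop
  have h2 : Measurable fun ξ : Plane => ξ 0 + √3 * ξ 1 := by fun_prop
  have h3 : Measurable fun ξ : Plane => ξ 0 - √3 * ξ 1 := by fun_prop
  exact (h1 measurableSet_Ico).inter ((h2 measurableSet_Ico).inter (h3 measurableSet_Ico))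

instance : Countable (reciprocal hexLattice) := by
  have : Function.Surjective fun p : ℤ × ℤ =>
      (⟨latPt p.1 p.2, mem_reciprocal.2 ⟨_, _, rfl⟩⟩ : reciprocal hexLattice) := by
    rintro ⟨γ, hγ⟩
    obtain ⟨m, n, rfl⟩ := mem_reciprocal.1 hγ
    exact ⟨(m, n), rfl⟩
  exact this.countable

lemma isAddFundamentalDomain_hexCell :
    IsAddFundamentalDomain (reciprocal hexLattice) hexCell (volume : Measure Plane) :=
  .mk' measurableSet_hexCell.nullMeasurableSet existsUnique_vadd_mem_hexCell

/-- The fundamental parallelogram of `Λ*`. -/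
def latCell : Set Plane := {ξ | latS ξ ∈ Set.Ioc 0 1 ∧ latT ξ ∈ Set.Ioc 0 1}

lemma measurableSet_latCell : MeasurableSet latCell :=
  (measurable_latS measurableSet_Ioc).inter (measurable_latT measurableSet_Ioc)

lemma isAddFundamentalDomain_latCell :
    IsAddFundamentalDomain (reciprocal hexLattice) latCell (volume : Measure Plane) := by
  refine .mk' measurableSet_latCell.nullMeasurableSet fun ξ => ?_
  obtain ⟨m, hm, hm'⟩ := existsUnique_add_zsmul_mem_Ioc one_pos (latS ξ) 0
  obtain ⟨n, hn, hn'⟩ := existsUnique_add_zsmul_mem_Ioc one_pos (latT ξ) 0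
  simp only [zsmul_eq_mul, mul_one, zero_add] at hm hm' hn hn'
  refine ⟨⟨latPt m n, mem_reciprocal.2 ⟨m, n, rfl⟩⟩, ?_, ?_⟩
  · change latPt m n + ξ ∈ latCell
    rw [add_comm]
    exact ⟨by rwa [latS_add, latS_latPt], by rwa [latT_add, latT_latPt]⟩
  · rintro ⟨γ, hγ⟩ h
    obtain ⟨p, q, rfl⟩ := mem_reciprocal.1 hγ
    change latPt p q + ξ ∈ latCell at h
    rw [add_comm] at h
    obtain ⟨h1, h2⟩ := h
    rw [latS_add, latS_latPt] at h1
    rw [latT_add, latT_latPt] at h2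
    simp only [hm' p h1, hn' q h2]

/-- The area of the hexagon `S`. -/
def hexArea : ℝ := 2 * √3 * Real.pi ^ 2

lemma hexArea_pos : 0 < hexArea := by unfold hexArea; positivity

/-- The linear map `latPt` as a map on coordinate vectors. -/
def latLin : (Fin 2 → ℝ) →ₗ[ℝ] (Fin 2 → ℝ) :=
  Matrix.toLin' !![2 * Real.pi, Real.pi; 0, √3 * Real.pi]

lemma latLin_apply (p : Fin 2 → ℝ) : WithLp.toLp 2 (latLin p) = latPt (p 0) (p 1) := by
  apply plane_ext <;> simp [latLin, Matrix.toLin'_apply, Matrix.mulVec, dotProduct,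
    Fin.sum_univ_two]
  ring

lemma det_latLin : LinearMap.det latLin = hexArea := by
  rw [latLin, LinearMap.det_toLin', Matrix.det_fin_two_of, hexArea]; ring

lemma volume_preimage_latPt {s : Set Plane} (hs : MeasurableSet s) :
    volume s = ENNReal.ofReal hexArea * volume {p : Fin 2 → ℝ | latPt (p 0) (p 1) ∈ s} := by
  have hA := hexArea_pos
  have h1 : {p : Fin 2 → ℝ | latPt (p 0) (p 1) ∈ s} =
      latLin ⁻¹' ((WithLp.toLp 2) ⁻¹' s) := by
    ext p; simp only [Set.mem_preimage, latLin_apply, Set.mem_ofPred_eq]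
  rw [h1, Measure.addHaar_preimage_linearMap _ (by rw [det_latLin]; exact hA.ne'), det_latLin,
    (PiLp.volume_preserving_toLp (Fin 2)).measure_preimage hs.nullMeasurableSet, ← mul_assoc,
    ← ENNReal.ofReal_mul hA.le, abs_of_pos (inv_pos.2 hA), mul_inv_cancel₀ hA.ne',
    ENNReal.ofReal_one, one_mul]

lemma volume_latCell_inter {A : Set (UnitAddTorus (Fin 2))} (hA : MeasurableSet A) :
    volume (toTorus ⁻¹' A ∩ latCell) = ENNReal.ofReal hexArea * volume A := by
  rw [volume_preimage_latPt ((measurable_toTorus hA).inter measurableSet_latCell)]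
  congr 1
  have h := UnitAddTorus.lintegral_preimage (A.indicator 1) (0 : Fin 2 → ℝ)
  rw [lintegral_indicator_one hA] at h
  have hm : Measurable fun (x : Fin 2 → ℝ) => (fun i => (x i : UnitAddCircle)) :=
    measurable_pi_lambda _ fun i => AddCircle.measurable_mk'.comp (measurable_pi_apply i)
  have h2 : (fun x : Fin 2 → ℝ => A.indicator (1 : UnitAddTorus (Fin 2) → ℝ≥0∞)
      (fun i => (x i : UnitAddCircle))) =
      ((fun (x : Fin 2 → ℝ) => (fun i => (x i : UnitAddCircle))) ⁻¹' A).indicator 1 := rfl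
  rw [h, h2, lintegral_indicator_one (hm hA), Measure.restrict_apply (hm hA)]
  congr 1
  ext p
  have e : toTorus (latPt (p 0) (p 1)) = fun i => (p i : UnitAddCircle) := by
    funext i; fin_cases i <;> simp [toTorus]
  simp only [Set.mem_ofPred_eq, Set.mem_inter_iff, Set.mem_preimage, e, latCell, latS_latPt,
    latT_latPt, Pi.zero_apply, zero_add, Fin.forall_fin_two]

lemma volume_hexCell_inter {A : Set (UnitAddTorus (Fin 2))} (hA : MeasurableSet A) :
    volume (toTorus ⁻¹' A ∩ hexCell) = ENNReal.ofReal hexArea * volume A := by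
  rw [← volume_latCell_inter hA]
  refine isAddFundamentalDomain_hexCell.measure_set_eq isAddFundamentalDomain_latCell
    (measurable_toTorus hA) fun g => ?_
  ext ξ
  change toTorus (g + ξ) ∈ A ↔ toTorus ξ ∈ A
  rw [add_comm, toTorus_add g.2]

lemma volume_univ_torus : (volume : Measure (UnitAddTorus (Fin 2))) Set.univ = 1 := by
  have h := UnitAddTorus.lintegral_preimage (1 : UnitAddTorus (Fin 2) → ℝ≥0∞) (0 : Fin 2 → ℝ)
  have hs : {x : Fin 2 → ℝ | ∀ i, x i ∈ Set.Ioc ((0 : Fin 2 → ℝ) i) ((0 : Fin 2 → ℝ) i + 1)} =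
      Set.univ.pi fun _ => Set.Ioc 0 1 := by ext; simp
  simp only [Pi.one_apply, lintegral_one, Measure.restrict_apply_univ, hs] at h
  rw [h, volume_pi_pi]
  simp

lemma volume_hexCell : volume hexCell = ENNReal.ofReal hexArea := by
  have := volume_hexCell_inter MeasurableSet.univ
  rwa [Set.preimage_univ, Set.univ_inter, volume_univ_torus, mul_one] at this

/-- The normalized measure on the cell. -/
def cellMeasure : Measure Plane := (ENNReal.ofReal hexArea)⁻¹ • volume.restrict hexCell

lemma measurePreserving_toTorus : MeasurePreserving toTorus cellMeasure volume := by
  refine ⟨measurable_toTorus, Measure.ext fun A hA => ?_⟩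
  have h0 : ENNReal.ofReal hexArea ≠ 0 := by simpa using hexArea_pos
  rw [Measure.map_apply measurable_toTorus hA, cellMeasure, Measure.smul_apply,
    Measure.restrict_apply (measurable_toTorus hA), volume_hexCell_inter hA, smul_eq_mul,
    ← mul_assoc, ENNReal.inv_mul_cancel h0 ENNReal.ofReal_ne_top, one_mul]

lemma injOn_toTorus : Set.InjOn toTorus hexCell := by
  intro ξ hξ ξ' hξ' h
  have := cellRep_eq_of_mem (toTorus_eq_iff h) (by rwa [add_sub_cancel])
  rwa [cellRep_of_mem hξ, add_sub_cancel] at this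

lemma exists_toTorus_eq (x : UnitAddTorus (Fin 2)) : ∃ ξ ∈ hexCell, toTorus ξ = x := by
  obtain ⟨s, hs⟩ := QuotientAddGroup.mk_surjective (x 0)
  obtain ⟨t, ht⟩ := QuotientAddGroup.mk_surjective (x 1)
  refine ⟨cellRep (latPt s t), cellRep_mem _, ?_⟩
  obtain ⟨m, n, h⟩ := exists_cellRep_eq (latPt s t)
  rw [h, toTorus_add (mem_reciprocal.2 ⟨m, n, rfl⟩)]
  funext i
  fin_cases i
  · simpa [toTorus] using hs
  · simpa [toTorus] using ht

/-- The section of `toTorus` with values in the cell. -/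
def ofTorus (x : UnitAddTorus (Fin 2)) : Plane := (exists_toTorus_eq x).choose

lemma ofTorus_mem (x : UnitAddTorus (Fin 2)) : ofTorus x ∈ hexCell :=
  (exists_toTorus_eq x).choose_spec.1

lemma toTorus_ofTorus (x : UnitAddTorus (Fin 2)) : toTorus (ofTorus x) = x :=
  (exists_toTorus_eq x).choose_spec.2

lemma ofTorus_toTorus {ξ : Plane} (h : ξ ∈ hexCell) : ofTorus (toTorus ξ) = ξ :=
  injOn_toTorus (ofTorus_mem _) h (toTorus_ofTorus _)

lemma measurable_ofTorus : Measurable ofTorus := by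
  have hemb : MeasurableEmbedding (fun ξ : hexCell => toTorus ξ) := by
    have : StandardBorelSpace hexCell := measurableSet_hexCell.standardBorel
    exact (measurable_toTorus.comp measurable_subtype_coe).measurableEmbedding
      (Set.injOn_iff_injective.1 injOn_toTorus)
  intro B hB
  have : ofTorus ⁻¹' B = (fun ξ : hexCell => toTorus ξ) '' (Subtype.val ⁻¹' B) := by
    ext x
    constructor
    · intro hx
      exact ⟨⟨ofTorus x, ofTorus_mem x⟩, hx, toTorus_ofTorus x⟩
    · rintro ⟨⟨ξ, hξ⟩, hB', rfl⟩
      change ofTorus (toTorus ξ) ∈ B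
      rw [ofTorus_toTorus hξ]
      exact hB'
  rw [this]
  exact hemb.measurableSet_image' (measurable_subtype_coe hB)

lemma ae_cellMeasure_mem : ∀ᵐ ξ ∂cellMeasure, ξ ∈ hexCell :=
  Measure.ae_smul_measure (ae_restrict_mem measurableSet_hexCell) _

lemma measurePreserving_ofTorus : MeasurePreserving ofTorus volume cellMeasure := by
  refine ⟨measurable_ofTorus, ?_⟩
  rw [← measurePreserving_toTorus.map_eq, Measure.map_map measurable_ofTorus measurable_toTorus]
  have : ofTorus ∘ toTorus =ᵐ[cellMeasure] id := by
    filter_upwards [ae_cellMeasure_mem] with ξ hξ using ofTorus_toTorus hξ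
  rw [Measure.map_congr this, Measure.map_id]

attribute [local instance] instIsAddHaarMeasureUnitAddCircleVolume
attribute [local instance] instIsProbabilityMeasureUnitAddCircleVolume

lemma cellRep_eq_ofTorus (ξ : Plane) : cellRep ξ = ofTorus (toTorus ξ) := by
  obtain ⟨m, n, h⟩ := exists_cellRep_eq ξ
  rw [← toTorus_add (ξ := ξ) (mem_reciprocal.2 ⟨m, n, rfl⟩), ← h, ofTorus_toTorus (cellRep_mem ξ)]

lemma measurable_cellRep : Measurable cellRep := by
  rw [funext cellRep_eq_ofTorus]
  exact measurable_ofTorus.comp measurable_toTorus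

lemma toTorus_add_eq (ξ v : Plane) : toTorus (ξ + v) = toTorus ξ + toTorus v := by
  funext i
  fin_cases i
  · simp [toTorus, latS_add]
  · simp [toTorus, latT_add]

/-- Translations of the plane modulo `Λ*` preserve the measure on the cell. -/
lemma measurePreserving_shift (v : Plane) :
    MeasurePreserving (fun ξ => cellRep (ξ + v)) cellMeasure cellMeasure := by
  have : (fun ξ => cellRep (ξ + v)) = ofTorus ∘ (· + toTorus v) ∘ toTorus := by
    funext ξ
    rw [cellRep_eq_ofTorus, toTorus_add_eq]; rfl
  rw [this]
  exact measurePreserving_ofTorus.comp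
    ((measurePreserving_add_right volume (toTorus v)).comp measurePreserving_toTorus)

instance : IsProbabilityMeasure cellMeasure := by
  refine ⟨?_⟩
  have h0 : ENNReal.ofReal hexArea ≠ 0 := by simpa using hexArea_pos
  rw [cellMeasure, Measure.smul_apply, Measure.restrict_apply_univ, volume_hexCell, smul_eq_mul,
    ENNReal.inv_mul_cancel h0 ENNReal.ofReal_ne_top]

/-- Coordinates of lattice points, indexed as in the theory of Fourier series on the torus. -/
def latticeEquivFin : (Fin 2 → ℤ) ≃ hexLattice := (finTwoArrowEquiv ℤ).trans latticeEquiv.toEquiv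

lemma coe_latticeEquivFin (n : Fin 2 → ℤ) : (latticeEquivFin n : Plane) = hexPt (n 0) (n 1) := rfl

lemma mFourier_toTorus (n : Fin 2 → ℤ) (ξ : Plane) : UnitAddTorus.mFourier n (toTorus ξ) =
    Complex.exp (Complex.I * (inner ℝ (latticeEquivFin n : Plane) ξ : ℝ)) := by
  rw [coe_latticeEquivFin, inner_hexPt, UnitAddTorus.mFourier]
  simp only [ContinuousMap.coe_mk, Fin.prod_univ_two, toTorus, Matrix.cons_val, fourier_coe_apply]
  rw [← Complex.exp_add]
  congr 1; push_cast; ring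

lemma mFourierCoeff_ofTorus (F : Plane → ℂ) (n : Fin 2 → ℤ) :
    UnitAddTorus.mFourierCoeff (F ∘ ofTorus) n =
      ∫ ξ, F ξ * Complex.exp (-(Complex.I * (inner ℝ (latticeEquivFin n : Plane) ξ : ℝ)))
        ∂cellMeasure := by
  have hinj : Function.Injective ofTorus := Function.LeftInverse.injective toTorus_ofTorus
  rw [← measurePreserving_ofTorus.integral_comp (measurable_ofTorus.measurableEmbedding hinj),
    UnitAddTorus.mFourierCoeff]
  congr 1
  funext t
  have ht := mFourier_toTorus n (ofTorus t)
  rw [toTorus_ofTorus] at ht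
  rw [smul_eq_mul, mul_comm, UnitAddTorus.mFourier_neg, ht, ← Complex.exp_conj, map_mul,
    Complex.conj_I, Complex.conj_ofReal, neg_mul]
  rfl

lemma mFourierCoeff_congr_ae {f g : UnitAddTorus (Fin 2) → ℂ} (h : f =ᵐ[volume] g) (n : Fin 2 → ℤ) :
    UnitAddTorus.mFourierCoeff f n = UnitAddTorus.mFourierCoeff g n := by
  refine integral_congr_ae ?_
  filter_upwards [h] with t ht
  rw [ht]

/-- The hexagon `S` and the half-open cell differ by a null set. The cell contains the dilates `r S`,
`r < 1`, so that the areas agree by homogeneity of the measure. -/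
lemma hexCell_ae_eq_hexS : hexCell =ᵐ[volume] hexS := by
  have hA := hexArea_pos
  have hp := Real.pi_pos
  have hle : volume hexS ≤ volume hexCell := by
    have key : ∀ r ∈ Set.Ioo (0 : ℝ) 1, ENNReal.ofReal (r ^ 2) * volume hexS ≤ volume hexCell := by
      intro r hr
      have h2 : Module.finrank ℝ Plane = 2 := by simp
      have := Measure.addHaar_smul (volume : Measure Plane) r hexS
      rw [h2, abs_of_nonneg (by positivity)] at this
      rw [← this]
      apply measure_mono
      intro ξ hξ
      obtain ⟨h3, h4, h5⟩ := (mem_smul_hexS hr.1).1 hξ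
      have h6 : r * Real.pi < Real.pi := by nlinarith [hr.2]
      rw [abs_le] at h3 h4 h5
      exact mem_hexCell.2 ⟨⟨by linarith, by linarith⟩, ⟨by linarith, by linarith⟩,
        by linarith, by linarith⟩
    have hlim : Filter.Tendsto (fun r : ℝ => ENNReal.ofReal (r ^ 2) * volume hexS)
        (nhdsWithin 1 (Set.Iio 1)) (nhds (ENNReal.ofReal (1 ^ 2) * volume hexS)) := by
      refine ENNReal.Tendsto.mul_const ?_ (by simp)
      refine ENNReal.tendsto_ofReal (Filter.Tendsto.mono_left ?_ nhdsWithin_le_nhds)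
      exact (continuous_pow 2).tendsto 1
    rw [one_pow, ENNReal.ofReal_one, one_mul] at hlim
    refine le_of_tendsto hlim ?_
    filter_upwards [Ioo_mem_nhdsLT one_pos] with r hr using key r hr
  refine ae_eq_of_subset_of_measure_ge hexCell_subset hle measurableSet_hexCell.nullMeasurableSet ?_
  exact ((hle.trans_lt (by rw [volume_hexCell]; exact ENNReal.ofReal_lt_top))).ne

lemma restrict_hexS_eq : (volume : Measure Plane).restrict hexS = volume.restrict hexCell :=
  (Measure.restrict_congr_set hexCell_ae_eq_hexS).symm

lemma coeff_eq_integral (F : Plane → ℂ) (n : hexLattice) : coeff F n =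
    ∫ ξ, F ξ * Complex.exp (-(Complex.I * (inner ℝ (n : Plane) ξ : ℝ))) ∂cellMeasure := by
  rw [coeff, average, restrict_hexS_eq, Measure.restrict_apply_univ, volume_hexCell, cellMeasure]

lemma memLp_hexS_iff {F : Plane → ℂ} :
    MemLp F 2 (volume.restrict hexS) ↔ MemLp F 2 cellMeasure := by
  have h0 : ENNReal.ofReal hexArea ≠ 0 := by simpa using hexArea_pos
  rw [restrict_hexS_eq, cellMeasure]
  constructor
  · intro h
    exact h.smul_measure (ENNReal.inv_ne_top.2 h0)
  · intro h
    have := h.smul_measure (c := ENNReal.ofReal hexArea) ENNReal.ofReal_ne_top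
    rwa [smul_smul, ENNReal.mul_inv_cancel h0 ENNReal.ofReal_ne_top, one_smul] at this

/-- **Parseval's identity** on the cell. -/
lemma hasSum_coeff_mul {F G : Plane → ℂ} (hF : MemLp F 2 cellMeasure) (hG : MemLp G 2 cellMeasure) :
    HasSum (fun n => (starRingEnd ℂ) (coeff F n) * coeff G n)
      (∫ ξ, (starRingEnd ℂ) (F ξ) * G ξ ∂cellMeasure) := by
  have hF' := hF.comp_measurePreserving measurePreserving_ofTorus
  have hG' := hG.comp_measurePreserving measurePreserving_ofTorus
  have hinj : Function.Injective ofTorus := Function.LeftInverse.injective toTorus_ofTorus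
  have h := UnitAddTorus.hasSum_prod_mFourierCoeff hF'.toLp hG'.toLp
  simp only [mFourierCoeff_congr_ae hF'.coeFn_toLp, mFourierCoeff_congr_ae hG'.coeFn_toLp,
    mFourierCoeff_ofTorus, ← coeff_eq_integral] at h
  have e : ∫ t, (starRingEnd ℂ) ((hF'.toLp (F ∘ ofTorus)) t) * (hG'.toLp (G ∘ ofTorus)) t =
      ∫ ξ, (starRingEnd ℂ) (F ξ) * G ξ ∂cellMeasure := by
    rw [← measurePreserving_ofTorus.integral_comp (measurable_ofTorus.measurableEmbedding hinj)]
    refine integral_congr_ae ?_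
    filter_upwards [hF'.coeFn_toLp, hG'.coeFn_toLp] with t h1 h2
    rw [h1, h2]; rfl
  rw [e] at h
  exact (latticeEquivFin.hasSum_iff
    (f := fun n => (starRingEnd ℂ) (coeff F n) * coeff G n)).1 h

/-- **Riesz-Fischer theorem** on the cell. -/
lemma exists_coeff_eq {x : hexLattice → ℂ} (hx : Summable fun n => ‖x n‖ ^ 2) :
    ∃ X : Plane → ℂ, MemLp X 2 cellMeasure ∧
      (∀ γ ∈ reciprocal hexLattice, ∀ ξ, X (ξ + γ) = X ξ) ∧ coeff X = x := by
  have hx' : Memℓp (fun n => x (latticeEquivFin n)) 2 := by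
    apply memℓp_gen
    have := latticeEquivFin.summable_iff.2 hx
    simpa [Function.comp_def] using this
  let f := UnitAddTorus.mFourierBasis.repr.symm ⟨_, hx'⟩
  have hf : ∀ n, UnitAddTorus.mFourierCoeff f n = x (latticeEquivFin n) := by
    intro n
    rw [← UnitAddTorus.mFourierBasis_repr]
    simp [f]
  refine ⟨f ∘ toTorus, (Lp.memLp f).comp_measurePreserving measurePreserving_toTorus,
    fun γ hγ ξ => by simp only [Function.comp_apply, toTorus_add hγ], ?_⟩
  funext n
  obtain ⟨n, rfl⟩ := latticeEquivFin.surjective n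
  rw [coeff_eq_integral, ← mFourierCoeff_ofTorus, ← hf]
  congr 1
  funext t
  simp only [Function.comp_apply, toTorus_ofTorus]

end Torus

/-! ### Filtering and subsampling in the Fourier domain -/

/-- A function on the plane is `Λ*`-periodic. -/
def IsPeriodic (F : Plane → ℂ) : Prop := ∀ γ ∈ reciprocal hexLattice, ∀ ξ, F (ξ + γ) = F ξ

lemma IsPeriodic.cellRep {F : Plane → ℂ} (h : IsPeriodic F) (ξ : Plane) :
    F (cellRep ξ) = F ξ := by
  obtain ⟨m, n, hmn⟩ := exists_cellRep_eq ξ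
  rw [hmn, h _ (mem_reciprocal.2 ⟨m, n, rfl⟩)]

lemma IsPeriodic.shift_eq {F : Plane → ℂ} (h : IsPeriodic F) (v : Plane) :
    (fun ξ => F (ξ + v)) = F ∘ fun ξ => HexFrame.cellRep (ξ + v) :=
  funext fun ξ => (h.cellRep (ξ + v)).symm

lemma IsPeriodic.memLp_shift {F : Plane → ℂ} (h : IsPeriodic F) (hF : MemLp F 2 cellMeasure)
    (v : Plane) : MemLp (fun ξ => F (ξ + v)) 2 cellMeasure := by
  rw [h.shift_eq]
  exact hF.comp_measurePreserving (measurePreserving_shift v)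

lemma IsPeriodic.integral_shift {F : Plane → ℂ} (h : IsPeriodic F)
    (hF : AEStronglyMeasurable F cellMeasure) (v : Plane) :
    ∫ ξ, F (ξ + v) ∂cellMeasure = ∫ ξ, F ξ ∂cellMeasure := by
  have hm := measurePreserving_shift v
  rw [h.shift_eq]
  conv_rhs => rw [← hm.map_eq]
  rw [integral_map hm.measurable.aemeasurable (by rwa [hm.map_eq])]
  rfl

lemma norm_exp_neg_I_mul (x : ℝ) : ‖Complex.exp (-(Complex.I * x))‖ = 1 := by
  rw [← mul_neg, mul_comm, ← Complex.ofReal_neg, Complex.norm_exp_ofReal_mul_I]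

lemma measurable_character (n : Plane) :
    Measurable fun ξ : Plane => Complex.exp (-(Complex.I * (inner ℝ n ξ : ℝ))) := by
  fun_prop

lemma memLp_mul_character {F : Plane → ℂ} {μ : Measure Plane} {p : ℝ≥0∞} (hF : MemLp F p μ)
    (n : Plane) :
    MemLp (fun ξ => F ξ * Complex.exp (-(Complex.I * (inner ℝ n ξ : ℝ)))) p μ := by
  refine hF.of_le (hF.1.mul (measurable_character n).aestronglyMeasurable) (.of_forall fun ξ => ?_)
  rw [norm_mul, norm_exp_neg_I_mul, mul_one]

lemma isPeriodic_character (n : hexLattice) :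
    IsPeriodic fun ξ => Complex.exp (-(Complex.I * (inner ℝ (n : Plane) ξ : ℝ))) := by
  intro γ hγ ξ
  obtain ⟨m, hm⟩ : ∃ m : ℤ, inner ℝ (n : Plane) γ = 2 * Real.pi * m := hγ n n.2
  simp only [inner_add_right, hm]
  rw [Complex.ofReal_add, mul_add, neg_add, Complex.exp_add]
  have : Complex.exp (-(Complex.I * ((2 * Real.pi * m : ℝ) : ℂ))) = 1 := by
    rw [Complex.exp_eq_one_iff]
    exact ⟨-m, by push_cast; ring⟩
  rw [this, mul_one]

lemma coeff_shift {F : Plane → ℂ} (h : IsPeriodic F) (hF : MemLp F 2 cellMeasure) (v : Plane)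
    (n : hexLattice) : coeff (fun ξ => F (ξ + v)) n =
      Complex.exp (Complex.I * (inner ℝ (n : Plane) v : ℝ)) * coeff F n := by
  rw [coeff_eq_integral, coeff_eq_integral, ← integral_const_mul]
  have hp : IsPeriodic fun ξ => F ξ * Complex.exp (-(Complex.I * (inner ℝ (n : Plane) ξ : ℝ))) :=
    fun γ hγ ξ => by simp only [h γ hγ, isPeriodic_character n γ hγ ξ]
  have hm := (memLp_mul_character hF (n : Plane)).1
  rw [integral_const_mul, ← hp.integral_shift hm v, ← integral_const_mul]
  congr 1
  funext ξ
  rw [inner_add_right, Complex.ofReal_add, mul_add, neg_add, Complex.exp_add, ← mul_assoc]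
  have e : Complex.exp (Complex.I * (inner ℝ (n : Plane) v : ℝ)) *
      Complex.exp (-(Complex.I * (inner ℝ (n : Plane) v : ℝ))) = 1 := by
    rw [← Complex.exp_add, add_neg_cancel, Complex.exp_zero]
  linear_combination -(F (ξ + v) * Complex.exp (-(Complex.I * (inner ℝ (n : Plane) ξ : ℝ)))) * e

/-- The half-lattice vector `latPt (p/2) (q/2)`. -/
def halfPt (p q : Fin 2) : Plane := latPt (((p : ℕ) : ℤ) / 2) (((q : ℕ) : ℤ) / 2)

/-- The mean of the translates of `F` by `Λ*/2` modulo `Λ*`: subsampling on `2Λ` followed by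
zero padding, in the Fourier domain. -/
def aliasMean (F : Plane → ℂ) (ξ : Plane) : ℂ := 1 / 4 * ∑ p, ∑ q, F (ξ + halfPt p q)

lemma IsPeriodic.memLp_aliasMean {F : Plane → ℂ} (h : IsPeriodic F) (hF : MemLp F 2 cellMeasure) :
    MemLp (aliasMean F) 2 cellMeasure := by
  have hq (p : Fin 2) : MemLp (fun ξ => ∑ q, F (ξ + halfPt p q)) 2 cellMeasure :=
    memLp_finsetSum _ fun q _ => h.memLp_shift hF (halfPt p q)
  have hp : MemLp (fun ξ => ∑ p, ∑ q, F (ξ + halfPt p q)) 2 cellMeasure :=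
    memLp_finsetSum _ fun p _ => hq p
  exact hp.const_mul (1 / 4)

lemma integrable_mul_character {F : Plane → ℂ} (hF : MemLp F 2 cellMeasure) (n : Plane) :
    Integrable (fun ξ => F ξ * Complex.exp (-(Complex.I * (inner ℝ n ξ : ℝ)))) cellMeasure :=
  (memLp_mul_character hF n).integrable (by norm_num)

lemma coeff_sum {ι : Type*} (s : Finset ι) {F : ι → Plane → ℂ}
    (hF : ∀ i ∈ s, MemLp (F i) 2 cellMeasure) (n : hexLattice) :
    coeff (fun ξ => ∑ i ∈ s, F i ξ) n = ∑ i ∈ s, coeff (F i) n := by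
  simp only [coeff_eq_integral, Finset.sum_mul]
  exact integral_finsetSum _ fun i hi => integrable_mul_character (hF i hi) _

lemma coeff_const_mul (c : ℂ) (F : Plane → ℂ) (n : hexLattice) :
    coeff (fun ξ => c * F ξ) n = c * coeff F n := by
  simp only [coeff_eq_integral, mul_assoc]
  exact integral_const_mul _ _

/-- Subsampling on `2Λ` followed by zero padding is `aliasMean` in the Fourier domain, because the
mean of the characters at the four half-lattice vectors is the indicator of `2Λ`. -/
lemma coeff_aliasMean {F : Plane → ℂ} (h : IsPeriodic F) (hF : MemLp F 2 cellMeasure) (k : Fin 7) :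
    coeff (aliasMean F) = subUpSample (frameLattice k) (coeff F) := by
  funext n
  have hsh : ∀ p q, MemLp (fun ξ => F (ξ + halfPt p q)) 2 cellMeasure := fun p q =>
    h.memLp_shift hF (halfPt p q)
  change coeff (fun ξ => 1 / 4 * ∑ p, ∑ q, F (ξ + halfPt p q)) n = _
  have hsum : coeff (fun ξ => ∑ p, ∑ q, F (ξ + halfPt p q)) n = ∑ p, ∑ q,
      Complex.exp (Complex.I * (inner ℝ (n : Plane) (halfPt p q) : ℝ)) * coeff F n := by
    rw [coeff_sum _ fun p _ => memLp_finsetSum _ fun q _ => hsh p q]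
    refine Finset.sum_congr rfl fun p _ => ?_
    rw [coeff_sum _ fun q _ => hsh p q]
    exact Finset.sum_congr rfl fun q _ => coeff_shift h hF _ n
  rw [coeff_const_mul, hsum, subUpSample]
  obtain ⟨⟨m, j⟩, rfl⟩ := latticeEquiv.surjective n
  rw [latticeEquiv_mem_frameLattice]
  have hch : ∀ p q : Fin 2, Complex.exp (Complex.I *
      (inner ℝ (latticeEquiv (m, j) : Plane) (halfPt p q) : ℝ)) =
      (-1) ^ (m * ((p : ℕ) : ℤ) + j * ((q : ℕ) : ℤ)) := by
    intro p q
    rw [coe_latticeEquiv, halfPt, inner_hexPt_latPt, ← exp_pi_int]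
    congr 3; push_cast; ring
  simp only [hch, Fin.sum_univ_two, Fin.val_zero, Fin.val_one, Nat.cast_zero, Nat.cast_one,
    mul_zero, mul_one, add_zero, zero_add, zpow_zero, one_mul]
  rw [zpow_add₀ (by norm_num)]
  rcases Int.even_or_odd m with hm | hm <;> rcases Int.even_or_odd j with hj | hj <;>
    simp [hm.neg_one_zpow, hj.neg_one_zpow, hm, hj, ← Int.not_odd_iff_even]
  ring

/-- Filtering is multiplication in the Fourier domain. -/
lemma filterSeq_coeff {F X : Plane → ℂ} (hF : MemLp F 2 cellMeasure) (hX : MemLp X 2 cellMeasure)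
    (n : hexLattice) : filterSeq F (coeff X) n = coeff (fun ξ => F ξ * X ξ) n := by
  have hA : MemLp (fun ξ => (starRingEnd ℂ)
      (X ξ * Complex.exp (-(Complex.I * (inner ℝ (n : Plane) ξ : ℝ))))) 2 cellMeasure :=
    (memLp_mul_character hX (n : Plane)).star
  have h := hasSum_coeff_mul hA hF
  rw [filterSeq, coeff_eq_integral, ← integral_congr_ae (.of_forall fun ξ => ?_), ← h.tsum_eq]
  · refine tsum_congr fun p => ?_
    rw [mul_comm]
    congr 1
    rw [coeff_eq_integral, coeff_eq_integral, ← integral_conj]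
    refine integral_congr_ae (.of_forall fun ξ => ?_)
    simp only [map_mul, Complex.conj_conj, ← Complex.exp_conj, map_neg, Complex.conj_I,
      Complex.conj_ofReal, AddSubgroup.coe_sub, inner_sub_left]
    rw [mul_assoc, ← Complex.exp_add]
    congr 2; push_cast; ring
  · simp only [Complex.conj_conj]; ring

/-! ### Perfect reconstruction -/

lemma continuous_sector (ε : ℝ) (j : Fin 6) : Continuous fun p : ℝ × ℝ => sector ε j p.1 p.2 := by
  have hcut := continuous_cut ε
  have key {u v : ℝ × ℝ → ℝ} (hu : Continuous u) (hv : Continuous v) :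
      Continuous fun p => wedge ε (u p) (v p) := by
    unfold wedge; fun_prop
  have h0 : Continuous fun p : ℝ × ℝ => (2 * p.2 - p.1) / √3 := by fun_prop
  have h1 : Continuous fun p : ℝ × ℝ => p.2 - p.1 := by fun_prop
  have h2 : Continuous fun p : ℝ × ℝ => (p.2 - 2 * p.1) / √3 := by fun_prop
  have h3 : Continuous fun p : ℝ × ℝ => -p.1 := by fun_prop
  have h4 : Continuous fun p : ℝ × ℝ => -(p.1 + p.2) / √3 := by fun_prop
  have h5 : Continuous fun p : ℝ × ℝ => -p.2 := by fun_prop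
  fin_cases j
  · exact key h0 h1
  · exact key h1 h2
  · exact key h2 h3
  · exact key h3 h4
  · exact key h4 h5
  · exact key h5 h0.neg

lemma cut_le_one (ε t : ℝ) : cut ε t ≤ 1 := Real.cos_le_one _

lemma abs_sector_le (ε : ℝ) (j : Fin 6) (a b : ℝ) : |sector ε j a b| ≤ 2 := by
  have key (u v : ℝ) : |wedge ε u v| ≤ 2 := by
    rw [abs_of_nonneg (wedge_nonneg _ _ _), wedge]
    have h1 := mul_le_one₀ (cut_le_one ε (-u)) (cut_nonneg ε v) (cut_le_one ε v)
    have h2 := mul_le_one₀ (cut_le_one ε u) (cut_nonneg ε (-v)) (cut_le_one ε (-v))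
    linarith
  fin_cases j <;> exact key _ _

lemma modM_succ_eq {ε : ℝ} {M0 : Plane → ℝ} (hε : SmallEps ε) (h : IsRefinementModulus ε M0)
    (k : Fin 6) (ξ : Plane) : modM ε M0 k.succ ξ =
      sector ε (sectorIdx k) (cellRep ξ 0) (hexB (cellRep ξ)) * √(1 - periodize M0 ξ ^ 2) := by
  by_cases hS : cellRep ξ ∈ hexSeps ε
  · have : periodize M0 ξ = 1 := by rw [periodize_eq, h.eq_one _ hS]
    simp [modM, this]
  · rw [← modN_eq hε k ⟨hexCell_subset (cellRep_mem ξ), hS⟩, ← periodize_eq (modN ε k)]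
    rfl

namespace IsRefinementModulus

variable {ε : ℝ} {M0 : Plane → ℝ}

lemma measurable_periodize (h : IsRefinementModulus ε M0) : Measurable (periodize M0) := by
  classical
  have h1 : Measurable (hexCell.piecewise M0 0) :=
    (h.continuousOn.mono hexCell_subset).measurable_piecewise continuousOn_const measurableSet_hexCell
  have h2 : periodize M0 = hexCell.piecewise M0 0 ∘ cellRep := by
    funext ξ
    rw [periodize_eq, Function.comp_apply, Set.piecewise_eq_of_mem _ _ _ (cellRep_mem ξ)]
  rw [h2]
  exact h1.comp measurable_cellRep

lemma measurable_modM (hε : SmallEps ε) (h : IsRefinementModulus ε M0) (k : Fin 7) :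
    Measurable (modM ε M0 k) := by
  have hP := h.measurable_periodize
  refine Fin.cases hP (fun j => ?_) k
  rw [funext (modM_succ_eq hε h j)]
  have hc : Measurable fun ξ => (cellRep ξ 0, hexB (cellRep ξ)) := by
    have h1 : Measurable fun ξ : Plane => (ξ 0, hexB ξ) :=
      (by have := continuous_hexB; fun_prop : Continuous fun ξ : Plane => (ξ 0, hexB ξ)).measurable
    exact h1.comp measurable_cellRep
  have hs := (continuous_sector ε (sectorIdx j)).measurable.comp hc
  exact hs.mul ((measurable_const.sub (hP.pow_const 2)).sqrt)

lemma abs_modM_le (hε : SmallEps ε) (h : IsRefinementModulus ε M0) (k : Fin 7) (ξ : Plane) :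
    |modM ε M0 k ξ| ≤ 2 := by
  have hP := h.periodize_mem ξ
  refine Fin.cases ?_ (fun j => ?_) k
  · change |periodize M0 ξ| ≤ 2
    rw [abs_of_nonneg hP.1]; linarith [hP.2]
  · rw [modM_succ_eq hε h, abs_mul, abs_of_nonneg (Real.sqrt_nonneg _)]
    have h1 : √(1 - periodize M0 ξ ^ 2) ≤ 1 := by
      exact Real.sqrt_le_iff.2 ⟨zero_le_one, by nlinarith [sq_nonneg (periodize M0 ξ)]⟩
    have h2 := abs_sector_le ε (sectorIdx j) (cellRep ξ 0) (hexB (cellRep ξ))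
    calc _ ≤ 2 * 1 := mul_le_mul h2 h1 (Real.sqrt_nonneg _) (by norm_num)
      _ = 2 := by norm_num

lemma norm_filt_le (hε : SmallEps ε) (h : IsRefinementModulus ε M0) (k : Fin 7) (ξ : Plane) :
    ‖filt ε M0 k ξ‖ ≤ 2 := by
  rw [filt, norm_mul, mul_comm Complex.I, Complex.norm_exp_ofReal_mul_I, mul_one,
    Complex.norm_real, Real.norm_eq_abs]
  exact h.abs_modM_le hε k ξ

lemma measurable_filt (hε : SmallEps ε) (h : IsRefinementModulus ε M0) (k : Fin 7) :
    Measurable (filt ε M0 k) := by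
  have := h.measurable_modM hε k
  unfold filt
  fun_prop

lemma isPeriodic_filt (ε : ℝ) (M0 : Plane → ℝ) (k : Fin 7) : IsPeriodic (filt ε M0 k) :=
  fun _ hγ ξ => filt_add_reciprocal ε M0 k hγ ξ

/-- Products of square integrable functions with the filters are square integrable. -/
lemma memLp_filt_mul (hε : SmallEps ε) (h : IsRefinementModulus ε M0) (k : Fin 7)
    {μ : Measure Plane} {F : Plane → ℂ} (hF : MemLp F 2 μ) :
    MemLp (fun ξ => filt ε M0 k ξ * F ξ) 2 μ := by
  refine (hF.const_mul 2).of_le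
    ((h.measurable_filt hε k).aestronglyMeasurable.mul hF.1) (.of_forall fun ξ => ?_)
  rw [norm_mul, norm_mul]
  gcongr
  simpa using h.norm_filt_le hε k ξ

lemma memLp_conj_filt_mul (hε : SmallEps ε) (h : IsRefinementModulus ε M0) (k : Fin 7)
    {μ : Measure Plane} {F : Plane → ℂ} (hF : MemLp F 2 μ) :
    MemLp (fun ξ => (starRingEnd ℂ) (filt ε M0 k ξ) * F ξ) 2 μ := by
  have := (h.memLp_filt_mul hε k hF.star).star
  have e : (fun ξ => (starRingEnd ℂ) (filt ε M0 k ξ) * F ξ) =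
      star fun ξ => filt ε M0 k ξ * star F ξ := by
    funext ξ; simp
  rwa [e]

lemma memLp_filt (hε : SmallEps ε) (h : IsRefinementModulus ε M0) (k : Fin 7) :
    MemLp (filt ε M0 k) 2 cellMeasure := by
  simpa using h.memLp_filt_mul hε k (memLp_const (1 : ℂ) (μ := cellMeasure) (p := 2))

end IsRefinementModulus

lemma frameLattice_le (k : Fin 7) : frameLattice k ≤ hexLattice := by
  intro x hx
  obtain ⟨y, hy, rfl⟩ := AddSubgroup.mem_smul_pointwise_iff_exists _ _ _ |>.1 hx
  rw [two_smul]
  exact add_mem hy hy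

lemma transfer_eq' (ε : ℝ) (M0 : Plane → ℝ) (k : Fin 7) :
    transfer ε M0 k = fun ξ => 2 * filt ε M0 k ξ := funext (transfer_eq ε M0 k)

lemma halfPt_even (p q : Fin 2) :
    (Even (((p : ℕ) : ℤ)) ∧ Even (((q : ℕ) : ℤ))) ↔ p = 0 ∧ q = 0 := by
  fin_cases p <;> fin_cases q <;> simp

lemma halfPt_zero_zero : halfPt 0 0 = 0 := by apply plane_ext <;> simp [halfPt]

/-- In the Fourier domain the output of the filter bank is
`∑_γ X(ξ + γ) ∑_k m_k(ξ) conj (m_k(ξ + γ))`, which is `X(ξ)` by `sum_filt`. -/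
lemma isPRFilterBank_transfer {ε : ℝ} {M0 : Plane → ℝ} (hε : SmallEps ε)
    (h : IsRefinementModulus ε M0) : IsPRFilterBank frameLattice (transfer ε M0) := by
  have hT (k : Fin 7) : MemLp (transfer ε M0 k) 2 cellMeasure := by
    rw [transfer_eq']; exact (h.memLp_filt hε k).const_mul 2
  have hTp (k : Fin 7) : IsPeriodic (transfer ε M0 k) := fun γ hγ ξ => by
    rw [transfer_eq, transfer_eq, filt_add_reciprocal ε M0 k hγ]
  refine ⟨fun k => ⟨frameLattice_le k, by rw [relIndex_frameLattice]; norm_num⟩,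
    fun k => ⟨hTp k, memLp_hexS_iff.2 (hT k)⟩, fun x hx n => ?_⟩
  obtain ⟨X, hX, hXp, rfl⟩ := exists_coeff_eq hx
  have hY (k : Fin 7) : MemLp (fun ξ => (starRingEnd ℂ) (transfer ε M0 k ξ) * X ξ) 2
      cellMeasure := by
    have := (h.memLp_conj_filt_mul hε k hX).const_mul 2
    simpa only [transfer_eq, map_mul, map_ofNat, mul_assoc] using this
  have hYp (k : Fin 7) : IsPeriodic (fun ξ => (starRingEnd ℂ) (transfer ε M0 k ξ) * X ξ) :=
    fun γ hγ ξ => by simp only [hTp k γ hγ, hXp γ hγ]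
  have hZ (k : Fin 7) := (hYp k).memLp_aliasMean (hY k)
  have hW (k : Fin 7) : MemLp (fun ξ => transfer ε M0 k ξ *
      aliasMean (fun ξ => (starRingEnd ℂ) (transfer ε M0 k ξ) * X ξ) ξ) 2 cellMeasure := by
    have := (h.memLp_filt_mul hε k (hZ k)).const_mul 2
    simpa only [transfer_eq, mul_assoc] using this
  have e1 (k : Fin 7) : filterSeq (fun ξ => (starRingEnd ℂ) (transfer ε M0 k ξ)) (coeff X) =
      coeff (fun ξ => (starRingEnd ℂ) (transfer ε M0 k ξ) * X ξ) :=
    funext fun n => filterSeq_coeff (hT k).star hX n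
  calc _ = ∑ k, coeff (fun ξ => transfer ε M0 k ξ *
        aliasMean (fun ξ => (starRingEnd ℂ) (transfer ε M0 k ξ) * X ξ) ξ) n := by
        refine Finset.sum_congr rfl fun k _ => ?_
        rw [e1, ← coeff_aliasMean (hYp k) (hY k), filterSeq_coeff (hT k) (hZ k)]
    _ = coeff (fun ξ => ∑ k, transfer ε M0 k ξ *
        aliasMean (fun ξ => (starRingEnd ℂ) (transfer ε M0 k ξ) * X ξ) ξ) n :=
        (coeff_sum _ (fun k _ => hW k) n).symm
    _ = coeff X n := by
        congr 1
        funext ξ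
        calc _ = ∑ p : Fin 2, ∑ q : Fin 2, X (ξ + halfPt p q) * (starRingEnd ℂ) (∑ k : Fin 7,
              filt ε M0 k (ξ + halfPt p q) * (starRingEnd ℂ) (filt ε M0 k ξ)) := by
              simp only [aliasMean, transfer_eq, map_sum, Finset.mul_sum, map_mul, map_ofNat,
                Complex.conj_conj]
              rw [Finset.sum_comm]
              refine Finset.sum_congr rfl fun p _ => ?_
              rw [Finset.sum_comm]
              refine Finset.sum_congr rfl fun q _ => Finset.sum_congr rfl fun k _ => ?_
              ring
          _ = _ := by
              simp only [halfPt, sum_filt hε h, halfPt_even]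
              simp only [← halfPt.eq_1, Fin.sum_univ_two, halfPt_zero_zero]
              simp

lemma redundancy_frameLattice : redundancy frameLattice = 2 := by
  simp only [redundancy, relIndex_frameLattice]
  norm_num

/-! ### The scaling function and the wavelets in the frequency domain -/

/-- `𝓜_0` on the cell `S`, extended by `0` (not periodically) to the plane. This function of `ξ/2`
is `φ̂(ξ)`. -/
def scal (M0 : Plane → ℝ) : Plane → ℝ := hexS.indicator M0

/-- `φ̂(ζ) m_k(ζ)` with the periodizations removed; this function of `ξ/2` is `ψ̂^k(ξ)`. -/
def waveCore (ε : ℝ) (M0 : Plane → ℝ) (k : Fin 6) (ζ : Plane) : ℂ :=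
  ((scal M0 ((1 / 2 : ℝ) • ζ) *
    (sector ε (sectorIdx k) (ζ 0) (hexB ζ) * √(1 - scal M0 ζ ^ 2)) : ℝ) : ℂ) *
    Complex.exp (Complex.I * (inner ℝ ζ (etaFr k.succ) : ℝ))

lemma continuous_coord : Continuous fun ξ : Plane => (ξ 0, hexB ξ) := by
  have := continuous_hexB; fun_prop

lemma continuous_sector_coord (ε : ℝ) (j : Fin 6) :
    Continuous fun ξ : Plane => sector ε j (ξ 0) (hexB ξ) := by
  have h := Continuous.comp (g := fun p : ℝ × ℝ => sector ε j p.1 p.2) (continuous_sector ε j)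
    continuous_coord
  simpa only [Function.comp_def] using h

lemma isClosed_inHex (r : ℝ) : IsClosed {ξ : Plane | InHex r (ξ 0) (hexB ξ)} := by
  have := continuous_hexB
  have h1 : IsClosed {ξ : Plane | |ξ 0| ≤ r} := isClosed_le (by fun_prop) continuous_const
  have h2 : IsClosed {ξ : Plane | |hexB ξ| ≤ r} := isClosed_le (by fun_prop) continuous_const
  have h3 : IsClosed {ξ : Plane | |ξ 0 - hexB ξ| ≤ r} := isClosed_le (by fun_prop) continuous_const
  exact h1.inter (h2.inter h3)

lemma isOpen_inHexLt (r : ℝ) : IsOpen {ξ : Plane | InHexLt r (ξ 0) (hexB ξ)} := by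
  have := continuous_hexB
  have h1 : IsOpen {ξ : Plane | |ξ 0| < r} := isOpen_lt (by fun_prop) continuous_const
  have h2 : IsOpen {ξ : Plane | |hexB ξ| < r} := isOpen_lt (by fun_prop) continuous_const
  have h3 : IsOpen {ξ : Plane | |ξ 0 - hexB ξ| < r} := isOpen_lt (by fun_prop) continuous_const
  exact h1.inter (h2.inter h3)

lemma isClosed_hexS : IsClosed hexS := by
  have : hexS = {ξ : Plane | InHex Real.pi (ξ 0) (hexB ξ)} := Set.ext fun ξ => mem_hexS
  rw [this]; exact isClosed_inHex _

lemma isClosed_hexA0 : IsClosed hexA0 := by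
  have : hexA0 = {ξ : Plane | InHex (Real.pi / 2) (ξ 0) (hexB ξ)} := Set.ext fun ξ => mem_hexA0
  rw [this]; exact isClosed_inHex _

lemma InHexLt.smul {r a b c : ℝ} (hc : 0 < c) (h : InHexLt r a b) :
    InHexLt (c * r) (c * a) (c * b) := by
  obtain ⟨h1, h2, h3⟩ := h
  refine ⟨?_, ?_, ?_⟩
  · rw [abs_mul, abs_of_pos hc]; gcongr
  · rw [abs_mul, abs_of_pos hc]; gcongr
  · rw [← mul_sub, abs_mul, abs_of_pos hc]; gcongr

lemma InHexLt.mono {r s a b : ℝ} (hrs : r ≤ s) (h : InHexLt r a b) : InHexLt s a b :=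
  ⟨h.1.trans_le hrs, h.2.1.trans_le hrs, h.2.2.trans_le hrs⟩

lemma InHexLt.mem_hexCell {ξ : Plane} (h : InHexLt Real.pi (ξ 0) (hexB ξ)) : ξ ∈ hexCell := by
  obtain ⟨h1, h2, h3⟩ := h
  rw [abs_lt] at h1 h2 h3
  simp only [hexB] at h2 h3
  exact ⟨⟨by linarith, by linarith⟩, ⟨by linarith, by linarith⟩, ⟨by linarith, by linarith⟩⟩

namespace IsRefinementModulus

variable {ε : ℝ} {M0 : Plane → ℝ}

lemma inHexLt_of_scal_ne_zero (h : IsRefinementModulus ε M0) {ξ : Plane} (h0 : scal M0 ξ ≠ 0) :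
    InHexLt (Real.pi / 2) (ξ 0) (hexB ξ) := by
  have hξ : ξ ∈ hexS := Set.mem_of_indicator_ne_zero h0
  rw [scal, Set.indicator_of_mem hξ] at h0
  exact h.inHexLt_of_ne_zero hξ h0

lemma inHexLt_of_scal_half_ne_zero (h : IsRefinementModulus ε M0) {ξ : Plane}
    (h0 : scal M0 ((1 / 2 : ℝ) • ξ) ≠ 0) : InHexLt Real.pi (ξ 0) (hexB ξ) := by
  have := (h.inHexLt_of_scal_ne_zero h0).smul (c := 2) two_pos
  rw [hexB_smul, PiLp.smul_apply, smul_eq_mul] at this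
  convert this using 1 <;> ring

lemma scal_mem (h : IsRefinementModulus ε M0) (ξ : Plane) : scal M0 ξ ∈ Set.Icc 0 1 := by
  by_cases hξ : ξ ∈ hexS
  · rw [scal, Set.indicator_of_mem hξ]; exact ⟨h.nonneg ξ hξ, h.le_one ξ hξ⟩
  · rw [scal, Set.indicator_of_notMem hξ]; simp

lemma periodize_eq_scal (h : IsRefinementModulus ε M0) {ξ : Plane} (hξ : ξ ∈ hexS) :
    periodize M0 ξ = scal M0 ξ := by
  rw [h.periodize_eq_of_mem hξ, scal, Set.indicator_of_mem hξ]

lemma scal_eq_one (hε : SmallEps ε) (h : IsRefinementModulus ε M0) {ξ : Plane}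
    (hξ : InHex (Real.pi / 2 - ε) (ξ 0) (hexB ξ)) : scal M0 ξ = 1 := by
  obtain ⟨h0, h1, h2, h3⟩ := hε.bounds
  have hS : ξ ∈ hexS := mem_hexS.2
    ⟨hξ.1.trans (by linarith [Real.pi_pos]), hξ.2.1.trans (by linarith [Real.pi_pos]),
      hξ.2.2.trans (by linarith [Real.pi_pos])⟩
  rw [scal, Set.indicator_of_mem hS]
  exact h.eq_one _ ((mem_hexSeps (by linarith)).2 hξ)

lemma continuous_scal (h : IsRefinementModulus ε M0) : Continuous (scal M0) := by
  refine continuous_indicator (fun ξ hξ => ?_) (by rw [isClosed_hexS.closure_eq]; exact h.continuousOn)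
  rw [isClosed_hexS.frontier_eq] at hξ
  by_contra h0
  refine hξ.2 (mem_interior.2 ⟨_, fun x hx => mem_hexS.2 ?_, isOpen_inHexLt (Real.pi / 2),
    h.inHexLt_of_ne_zero hξ.1 h0⟩)
  exact (InHexLt.mono (by linarith [Real.pi_pos]) hx).inHex

lemma phiFactor_eq (ξ : Plane) (p : ℕ) : phiFactor (transfer ε M0) ξ p =
    (periodize M0 (((2 : ℝ) ^ (p + 1))⁻¹ • ξ) : ℂ) := by
  have hη : etaFr 0 = 0 := by apply plane_ext <;> simp [etaFr]
  rw [phiFactor, transfer_eq, filt, hη, inner_zero_right, modM, Fin.cons_zero]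
  simp

/-- The factors of the product are `1` from some index on. -/
lemma eventually_phiFactor (hε : SmallEps ε) (h : IsRefinementModulus ε M0) (ξ : Plane) :
    ∀ᶠ p in Filter.atTop, phiFactor (transfer ε M0) ξ p = 1 ∧ ((2 : ℝ) ^ (p + 1))⁻¹ • ξ ∈ hexS := by
  obtain ⟨h0, h1, h2, h3⟩ := hε.bounds
  have hp := Real.pi_pos
  have hlim : Filter.Tendsto (fun p : ℕ => ((2 : ℝ) ^ (p + 1))⁻¹ • ξ) Filter.atTop
      (nhds ((0 : ℝ) • ξ)) := by
    refine Filter.Tendsto.smul_const ?_ ξ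
    have := (tendsto_pow_atTop_nhds_zero_of_lt_one (r := (1 / 2 : ℝ)) (by norm_num)
      (by norm_num)).comp (Filter.tendsto_add_atTop_nat 1)
    refine this.congr fun p => ?_
    simp
  rw [zero_smul] at hlim
  have hmem := (isOpen_inHexLt (Real.pi / 2 - ε)).mem_nhds (x := (0 : Plane))
    (by simp [InHexLt, hexB]; linarith)
  filter_upwards [hlim hmem] with p hpp
  have hpp' : InHexLt (Real.pi / 2 - ε) _ _ := hpp
  have hS : ((2 : ℝ) ^ (p + 1))⁻¹ • ξ ∈ hexS :=
    mem_hexS.2 (hpp'.mono (by linarith)).inHex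
  refine ⟨?_, hS⟩
  rw [phiFactor_eq, h.periodize_eq_scal hS, h.scal_eq_one hε hpp'.inHex, Complex.ofReal_one]

lemma multipliable_phiFactor (hε : SmallEps ε) (h : IsRefinementModulus ε M0) (ξ : Plane) :
    Multipliable (phiFactor (transfer ε M0) ξ) := by
  obtain ⟨N, hN⟩ := Filter.eventually_atTop.1 (h.eventually_phiFactor hε ξ)
  exact multipliable_of_ne_finset_one (s := Finset.range N)
    fun p hp => (hN p (by simpa using hp)).1

/-- The infinite product reduces to its first factor. For `ξ / 2 ∈ A_0` the other factors are `1`,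
because `𝓜_0 = 1` on `S_ε ⊇ A_0 / 2`. If `ξ / 2` is not in `S`, the first of the points `2^{-p} ξ`
to be in `S` is not in `A_0`, and the corresponding factor is `0`. -/
lemma phiHat_eq (hε : SmallEps ε) (h : IsRefinementModulus ε M0) (ξ : Plane) :
    phiHat (transfer ε M0) ξ = (scal M0 ((1 / 2 : ℝ) • ξ) : ℂ) := by
  obtain ⟨h0, h1, h2, h3⟩ := hε.bounds
  have hp := Real.pi_pos
  rw [phiHat]
  by_cases hne : scal M0 ((1 / 2 : ℝ) • ξ) = 0
  · -- one of the factors vanishes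
    rw [hne, Complex.ofReal_zero]
    obtain ⟨N, hN⟩ := Filter.eventually_atTop.1 (h.eventually_phiFactor hε ξ)
    suffices hz : ∃ p, phiFactor (transfer ε M0) ξ p = 0 by
      obtain ⟨p, hp⟩ := hz
      rw [tprod_eq_prod (s := Finset.range N) fun p hp => (hN p (by simpa using hp)).1]
      refine Finset.prod_eq_zero (i := p) (Finset.mem_range.2 ?_) hp
      by_contra hle
      have := (hN p (not_lt.1 hle)).1
      rw [hp] at this
      exact zero_ne_one this
    classical
    have hex : ∃ p : ℕ, ((2 : ℝ) ^ (p + 1))⁻¹ • ξ ∈ hexS := ⟨N, (hN N le_rfl).2⟩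
    -- the first of the points `ξ / 2 ^ p` to be in the cell is not in `A_0`
    refine ⟨Nat.find hex, ?_⟩
    have hS := Nat.find_spec hex
    rw [phiFactor_eq, h.periodize_eq_of_mem hS, Complex.ofReal_eq_zero]
    rcases hq : Nat.find hex with _ | q
    · rw [hq] at hS
      norm_num at hS
      rw [scal, Set.indicator_of_mem (by norm_num; exact hS)] at hne
      norm_num at hne ⊢
      exact hne
    · refine h.eq_zero _ ⟨by rw [← hq]; exact hS, fun hA => ?_⟩
      refine Nat.find_min hex (m := q) (by omega) ?_
      rw [mem_hexS]
      have := (mem_hexA0.1 hA).smul (c := 2)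
      rw [hexB_smul, PiLp.smul_apply, smul_eq_mul, ← mul_assoc, ← mul_assoc] at this
      rw [hexB_smul, PiLp.smul_apply, smul_eq_mul]
      have e : (2 : ℝ) * (2 ^ (q + 1 + 1))⁻¹ = (2 ^ (q + 1))⁻¹ := by
        rw [pow_succ _ (q + 1)]; field_simp
      have e' : |(2 : ℝ)| * (Real.pi / 2) = Real.pi := by rw [abs_two]; ring
      rwa [e, e'] at this
  · -- only the first factor differs from `1`
    have hlt := h.inHexLt_of_scal_ne_zero hne
    rw [tprod_eq_mulSingle 0 fun p hp0 => ?_]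
    · rw [phiFactor_eq]
      norm_num at hlt ⊢
      exact h.periodize_eq_scal (mem_hexS.2 (hlt.mono (by linarith)).inHex)
    · obtain ⟨q, rfl⟩ := Nat.exists_eq_succ_of_ne_zero hp0
      have hin : InHex (Real.pi / 2 - ε) ((((2 : ℝ) ^ (q.succ + 1))⁻¹ • ξ) 0)
          (hexB (((2 : ℝ) ^ (q.succ + 1))⁻¹ • ξ)) := by
        have := hlt.smul (c := ((2 : ℝ) ^ (q + 1))⁻¹) (by positivity)
        have e : ((2 : ℝ) ^ (q.succ + 1))⁻¹ = (2 ^ (q + 1))⁻¹ * (1 / 2) := by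
          rw [pow_succ _ q.succ]; field_simp
        rw [e, hexB_smul, PiLp.smul_apply, smul_eq_mul, mul_assoc, mul_assoc]
        rw [hexB_smul, PiLp.smul_apply, smul_eq_mul] at this
        refine (this.mono ?_).inHex
        have : ((2 : ℝ) ^ (q + 1))⁻¹ ≤ 1 / 2 := by
          rw [one_div]
          exact inv_anti₀ two_pos (le_self_pow₀ one_le_two (by omega))
        nlinarith
      have hS : ((2 : ℝ) ^ (q.succ + 1))⁻¹ • ξ ∈ hexS := mem_hexS.2
        ⟨hin.1.trans (by linarith), hin.2.1.trans (by linarith), hin.2.2.trans (by linarith)⟩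
      rw [phiFactor_eq, h.periodize_eq_scal hS, h.scal_eq_one hε hin, Complex.ofReal_one]

/-- Since `φ̂` is supported in the cell, only the central period of the filter enters `ψ̂^k`; the
points of `∂S`, where the periodized filter need not be continuous, are outside the support. -/
lemma phiHat_mul_filt (hε : SmallEps ε) (h : IsRefinementModulus ε M0) (k : Fin 6) (ζ : Plane) :
    phiHat (transfer ε M0) ζ * filt ε M0 k.succ ζ = waveCore ε M0 k ζ := by
  rw [h.phiHat_eq hε, waveCore]
  rcases eq_or_ne (scal M0 ((1 / 2 : ℝ) • ζ)) 0 with h0 | h0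
  · rw [h0]; simp
  · have hlt := h.inHexLt_of_scal_half_ne_zero h0
    rw [filt, modM_succ_eq hε h, cellRep_of_mem hlt.mem_hexCell,
      h.periodize_eq_scal (mem_hexS.2 hlt.inHex)]
    push_cast
    ring

lemma psiHat_eq (hε : SmallEps ε) (h : IsRefinementModulus ε M0) (k : Fin 6) (ξ : Plane) :
    psiHat (transfer ε M0) k ξ = waveCore ε M0 k ((1 / 2 : ℝ) • ξ) := by
  rw [psiHat, transfer_eq, ← h.phiHat_mul_filt hε]
  ring

lemma dilateHat_phiHat (hε : SmallEps ε) (h : IsRefinementModulus ε M0) (ξ : Plane) :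
    dilateHat 1 (phiHat (transfer ε M0)) ξ = 2 * (scal M0 ξ : ℂ) := by
  rw [dilateHat, h.phiHat_eq hε, smul_smul]
  norm_num

lemma dilateHat_psiHat (hε : SmallEps ε) (h : IsRefinementModulus ε M0) (k : Fin 6) (ξ : Plane) :
    dilateHat 1 (psiHat (transfer ε M0) k) ξ = 2 * waveCore ε M0 k ξ := by
  rw [dilateHat, h.psiHat_eq hε, smul_smul]
  norm_num

lemma continuous_phiHat (hε : SmallEps ε) (h : IsRefinementModulus ε M0) :
    Continuous (phiHat (transfer ε M0)) := by
  have := h.continuous_scal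
  rw [funext (h.phiHat_eq hε)]
  fun_prop

lemma continuous_waveCore (h : IsRefinementModulus ε M0) (k : Fin 6) :
    Continuous (waveCore ε M0 k) := by
  have h1 := h.continuous_scal
  have h2 := continuous_sector_coord ε (sectorIdx k)
  unfold waveCore
  fun_prop

lemma continuous_psiHat (hε : SmallEps ε) (h : IsRefinementModulus ε M0) (k : Fin 6) :
    Continuous (psiHat (transfer ε M0) k) := by
  have := h.continuous_waveCore k
  rw [funext (h.psiHat_eq hε k)]
  fun_prop

lemma waveCore_ne_zero (h : IsRefinementModulus ε M0) {k : Fin 6} {ξ : Plane} :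
    waveCore ε M0 k ξ ≠ 0 ↔ scal M0 ((1 / 2 : ℝ) • ξ) ≠ 0 ∧
      sector ε (sectorIdx k) (ξ 0) (hexB ξ) ≠ 0 ∧ scal M0 ξ ≠ 1 := by
  have hs := h.scal_mem ξ
  have hsq : √(1 - scal M0 ξ ^ 2) ≠ 0 ↔ scal M0 ξ ≠ 1 := by
    rw [Real.sqrt_ne_zero (by nlinarith [hs.1, hs.2]), ne_eq, sub_eq_zero, eq_comm,
      pow_eq_one_iff_of_nonneg hs.1 two_ne_zero]
  rw [waveCore, mul_ne_zero_iff, and_iff_left (Complex.exp_ne_zero _), Complex.ofReal_ne_zero,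
    mul_ne_zero_iff, mul_ne_zero_iff, hsq]

lemma support_dilateHat_phiHat (hε : SmallEps ε) (h : IsRefinementModulus ε M0) :
    Function.support (dilateHat 1 (phiHat (transfer ε M0))) = {ξ | ξ ∈ hexS ∧ M0 ξ ≠ 0} := by
  ext ξ
  rw [Function.mem_support, h.dilateHat_phiHat hε]
  simp [scal]

lemma tsupport_dilateHat_phiHat_subset (hε : SmallEps ε) (h : IsRefinementModulus ε M0) :
    tsupport (dilateHat 1 (phiHat (transfer ε M0))) ⊆ hexA0 := by
  refine closure_minimal ?_ isClosed_hexA0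
  rw [h.support_dilateHat_phiHat hε]
  exact fun ξ hξ => mem_hexA0.2 (h.inHexLt_of_ne_zero hξ.1 hξ.2).inHex

lemma tsupport_dilateHat_phiHat (hε : SmallEps ε) (h : IsRefinementModulus ε M0)
    (hd : hexA0 ⊆ closure {ξ | ξ ∈ hexS ∧ M0 ξ ≠ 0}) :
    tsupport (dilateHat 1 (phiHat (transfer ε M0))) = hexA0 := by
  refine (h.tsupport_dilateHat_phiHat_subset hε).antisymm ?_
  rwa [tsupport, h.support_dilateHat_phiHat hε]

lemma support_dilateHat_psiHat_eq (hε : SmallEps ε) (h : IsRefinementModulus ε M0) (k : Fin 6) :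
    Function.support (dilateHat 1 (psiHat (transfer ε M0) k)) =
      {ξ | waveCore ε M0 k ξ ≠ 0} := by
  ext ξ
  rw [Function.mem_support, h.dilateHat_psiHat hε]
  simp

lemma support_dilateHat_psiHat_subset (hε : SmallEps ε) (h : IsRefinementModulus ε M0)
    (k : Fin 6) :
    Function.support (dilateHat 1 (psiHat (transfer ε M0) k)) ⊆ setA ε k := by
  rw [h.support_dilateHat_psiHat_eq hε]
  intro ξ hξ
  obtain ⟨h1, h2, h3⟩ := h.waveCore_ne_zero.1 hξ
  have hS : ξ ∈ hexS := mem_hexS.2 (h.inHexLt_of_scal_half_ne_zero h1).inHex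
  have hann : ξ ∈ hexS \ hexSeps ε := by
    refine ⟨hS, fun hSe => h3 ?_⟩
    rw [scal, Set.indicator_of_mem hS, h.eq_one _ hSe]
  rw [← modN_eq hε k hann] at h2
  exact modN_support h2

end IsRefinementModulus

/-- The interior part of `setA`, where the sector function does not vanish. -/
def openA (ε : ℝ) (k : Fin 6) : Set Plane :=
  {ξ | InHexLt Real.pi (ξ 0) (hexB ξ) ∧ ¬ InHex (Real.pi / 2 - ε) (ξ 0) (hexB ξ) ∧
    sector ε (sectorIdx k) (ξ 0) (hexB ξ) ≠ 0}

lemma isOpen_openA (ε : ℝ) (k : Fin 6) : IsOpen (openA ε k) :=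
  (isOpen_inHexLt _).inter ((isClosed_inHex _).isOpen_compl.inter
    (isOpen_ne_fun (continuous_sector_coord ε (sectorIdx k)) continuous_const))

lemma symMap_smul (k : Fin 6) (x : Plane) (t : ℝ) :
    symMap k (t • x) 0 = t * symMap k x 0 ∧ hexB (symMap k (t • x)) = t * hexB (symMap k x) := by
  have h1 := symMap_coord k x
  have h2 := symMap_coord k (t • x)
  rw [hexB_smul, PiLp.smul_apply, smul_eq_mul] at h2
  fin_cases k <;> simp only [Fin.zero_eta, Fin.mk_one, Fin.reduceFinMk, Matrix.cons_val,
    Prod.mk.injEq] at h1 h2 ⊢ <;> rw [h1.1, h1.2, h2.1, h2.2] <;> constructor <;> ring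

/-- Points of `setA` are moved into `openA` by slight contractions. -/
lemma setA_subset_closure_openA {ε : ℝ} (hε : SmallEps ε) (k : Fin 6) :
    setA ε k ⊆ closure (openA ε k) := by
  intro ξ hξ
  have h0 := hε.pos
  obtain ⟨hann, hcone⟩ := (mem_setA1 hε).1 (mem_setA_iff_symMap.1 hξ)
  rw [mem_annulus hε, inHex_symMap, inHex_symMap] at hann
  have hlim : Filter.Tendsto (fun t : ℝ => t • ξ) (nhdsWithin 1 (Set.Ioo 0 1)) (nhds ξ) := by
    have : Filter.Tendsto (fun t : ℝ => t • ξ) (nhds 1) (nhds ((1 : ℝ) • ξ)) :=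
      (continuous_id.smul continuous_const).tendsto _
    rw [one_smul] at this
    exact this.mono_left nhdsWithin_le_nhds
  have : (nhdsWithin (1 : ℝ) (Set.Ioo 0 1)).NeBot := by
    rw [nhdsWithin_Ioo_eq_nhdsLT one_pos]; infer_instance
  refine mem_closure_of_tendsto hlim ?_
  filter_upwards [self_mem_nhdsWithin,
    hlim ((isClosed_inHex (Real.pi / 2 - ε)).isOpen_compl.mem_nhds hann.2)] with t ht hout
  have h3 := sqrt_three_pos
  have hc : 0 < √3 * ε := mul_pos h3 h0
  refine ⟨?_, hout, ?_⟩
  · have := hann.1.smul (c := t)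
    rw [hexB_smul, PiLp.smul_apply, smul_eq_mul]
    have hlt : |t| * Real.pi < Real.pi := by
      rw [abs_of_pos ht.1]; nlinarith [Real.pi_pos, ht.2]
    exact ⟨this.1.trans_lt hlt, this.2.1.trans_lt hlt, this.2.2.trans_lt hlt⟩
  · rw [← sector_symMap, (symMap_smul k ξ t).1, (symMap_smul k ξ t).2]
    refine (wedge_pos h0 ?_).ne'
    rw [lt_div_iff₀ h3, div_lt_iff₀ h3]
    obtain ⟨t0, t1⟩ := ht
    refine hcone.imp (fun hh => ⟨?_, ?_⟩) fun hh => ⟨?_, ?_⟩ <;> nlinarith [hh.1, hh.2]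

namespace IsRefinementModulus

variable {ε : ℝ} {M0 : Plane → ℝ}

lemma tsupport_dilateHat_psiHat (hε : SmallEps ε) (h : IsRefinementModulus ε M0)
    (hd : hexA0 ⊆ closure {ξ | ξ ∈ hexS ∧ M0 ξ ≠ 0})
    (hd' : hexS \ hexSeps ε ⊆ closure {ξ | ξ ∈ hexS ∧ M0 ξ ≠ 1}) (k : Fin 6) :
    tsupport (dilateHat 1 (psiHat (transfer ε M0) k)) = closure (setA ε k) := by
  refine (closure_mono (h.support_dilateHat_psiHat_subset hε k)).antisymm
    (closure_minimal ((setA_subset_closure_openA hε k).trans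
      (closure_minimal ?_ isClosed_closure)) isClosed_closure)
  rw [h.support_dilateHat_psiHat_eq hε]
  set V₁ : Set Plane := {ξ | scal M0 ((1 / 2 : ℝ) • ξ) ≠ 0}
  set V₂ : Set Plane := {ξ | scal M0 ξ ≠ 1}
  have hV₁ : IsOpen V₁ :=
    isOpen_ne_fun (h.continuous_scal.comp (continuous_const_smul _)) continuous_const
  have hA₁ : openA ε k ⊆ closure V₁ := by
    intro ξ hξ
    have hmem : (1 / 2 : ℝ) • ξ ∈ hexA0 :=
      Set.smul_mem_smul_set (mem_hexS.2 hξ.1.inHex)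
    have h2 : (2 : ℝ) • ((1 / 2 : ℝ) • ξ) = ξ := by rw [smul_smul]; norm_num
    rw [← h2]
    refine map_mem_closure (continuous_const_smul (2 : ℝ)) (hd hmem) fun x hx => ?_
    change scal M0 ((1 / 2 : ℝ) • (2 : ℝ) • x) ≠ 0
    rw [smul_smul, one_div, inv_mul_cancel₀ two_ne_zero, one_smul, scal,
      Set.indicator_of_mem hx.1]
    exact hx.2
  have hA₂ : openA ε k ⊆ closure V₂ := fun ξ hξ =>
    closure_mono (fun x hx => by
      change scal M0 x ≠ 1
      rw [scal, Set.indicator_of_mem hx.1]; exact hx.2)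
      (hd' ((mem_annulus hε).2 ⟨hξ.1.inHex, hξ.2.1⟩))
  have hO := isOpen_openA ε k
  have h1 : openA ε k ⊆ closure (openA ε k ∩ V₁) := fun ξ hξ =>
    hO.inter_closure ⟨hξ, hA₁ hξ⟩
  have h2 : openA ε k ∩ V₁ ⊆ closure (openA ε k ∩ V₁ ∩ V₂) := fun ξ hξ =>
    (hO.inter hV₁).inter_closure ⟨hξ, hA₂ hξ.1⟩
  refine h1.trans (closure_minimal (h2.trans (closure_mono fun ξ hξ => ?_)) isClosed_closure)
  exact h.waveCore_ne_zero.2 ⟨hξ.1.2, hξ.1.1.2.2, hξ.2⟩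

end IsRefinementModulus

/-! ### Inverse Fourier transforms of integrable, square integrable functions -/

lemma continuous_neg_inner :
    Continuous fun p : Plane × Plane => (-innerₗ Plane) p.1 p.2 := by
  have h : Continuous fun p : Plane × Plane => -inner ℝ p.1 p.2 := by fun_prop
  simpa using h

/-- The `L²` inverse Fourier transform is given by the Fourier integral on `L¹ ∩ L²`: both sides
have the same integrals against test functions. -/
lemma fourierInv_ae_eq {G : Plane → ℂ} (h1 : Integrable G) (h2 : MemLp G 2) :
    𝓕⁻ G =ᵐ[volume] (𝓕⁻ (h2.toLp G) : Lp ℂ 2 (volume : Measure Plane)) := by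
  have hcont : Continuous (𝓕⁻ G) := by
    have := VectorFourier.fourierIntegral_continuous (L := -innerₗ Plane) (μ := volume)
      Real.continuous_fourierChar continuous_neg_inner h1
    exact this
  refine ae_eq_of_integral_contDiff_smul_eq hcont.locallyIntegrable
    ((Lp.memLp _).locallyIntegrable one_le_two) fun g hg hgc => ?_
  have hg₁ : HasCompactSupport (Complex.ofRealCLM ∘ g) := hgc.comp_left rfl
  have hg₂ : ContDiff ℝ (⊤ : ℕ∞) (Complex.ofRealCLM ∘ g) := by fun_prop
  set s : SchwartzMap Plane ℂ := hg₁.toSchwartzMap hg₂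
  have hs (x : Plane) : s x = (g x : ℂ) := rfl
  have e1 : ∫ x, s x • 𝓕⁻ G x = ∫ x, (𝓕⁻ s) x • G x := by
    have := (VectorFourier.integral_fourierIntegral_smul_eq_flip (L := -innerₗ Plane)
      (μ := volume) (ν := volume)
      Real.continuous_fourierChar continuous_neg_inner s.integrable h1).symm
    rw [show (-innerₗ Plane).flip = -innerₗ Plane by
      ext x y; simp [real_inner_comm]] at this
    simpa [SchwartzMap.fourierInv_coe] using! this
  have e2 : ∫ x, s x • (𝓕⁻ (h2.toLp G) : Lp ℂ 2 (volume : Measure Plane)) x =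
      ∫ x, (𝓕⁻ s) x • (h2.toLp G) x := by
    have h3 := congrArg (fun T => T s) (Lp.fourierInv_toTemperedDistribution_eq (h2.toLp G))
    simp only [TemperedDistribution.fourierInv_apply, Lp.toTemperedDistribution_apply] at h3
    exact h3.symm
  calc ∫ x, g x • 𝓕⁻ G x = ∫ x, s x • 𝓕⁻ G x := by simp [hs]
    _ = ∫ x, (𝓕⁻ s) x • (h2.toLp G) x := by
      rw [e1]
      refine integral_congr_ae ?_
      filter_upwards [h2.coeFn_toLp] with x hx
      rw [hx]
    _ = ∫ x, g x • (𝓕⁻ (h2.toLp G) : Lp ℂ 2 (volume : Measure Plane)) x := by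
      rw [← e2]; simp [hs]

lemma hexDet_eq : hexDet = 2 / √3 := by
  have h := sqrt_three_pos
  have h2 : (hexMatrix.transpose * hexMatrix).det = (2 / √3) ^ 2 := by
    rw [Matrix.det_mul, Matrix.det_transpose, Matrix.det_fin_two]
    simp [hexMatrix]; ring
  rw [hexDet, h2, Real.sqrt_sq (by positivity)]

lemma hexDet_pos : 0 < hexDet := by rw [hexDet_eq]; have := sqrt_three_pos; positivity

lemma finrank_plane : Module.finrank ℝ Plane = 2 := by simp

lemma integral_comp_smul_plane (f : Plane → ℂ) {r : ℝ} (hr : 0 < r) :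
    ∫ x, f (r • x) = ((r ^ 2)⁻¹ : ℝ) * ∫ x, f x := by
  rw [Measure.integral_comp_smul, finrank_plane, abs_of_pos (by positivity)]
  rfl

/-- The inverse transform in the normalization of the kernel `e^{2πi⟨x, w⟩}`. -/
lemma invFourier_eq (g : Plane → ℂ) (x : Plane) :
    invFourier g x = (√hexDet : ℂ) * 𝓕⁻ (fun w => g ((2 * Real.pi) • w)) x := by
  have hp := Real.pi_pos
  rw [invFourier, Real.fourierInv_eq']
  have h := integral_comp_smul_plane
    (fun ξ => g ξ * Complex.exp (Complex.I * (inner ℝ x ξ : ℝ))) (r := 2 * Real.pi) (by positivity)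
  have e : (∫ v : Plane, Complex.exp (↑(2 * Real.pi * inner ℝ v x) * Complex.I) •
      g ((2 * Real.pi) • v)) = ∫ v : Plane, g ((2 * Real.pi) • v) *
        Complex.exp (Complex.I * (inner ℝ x ((2 * Real.pi) • v) : ℝ)) := by
    congr 1
    funext v
    rw [smul_eq_mul, mul_comm, real_inner_smul_right, real_inner_comm, mul_comm Complex.I]
  rw [e, h]
  push_cast
  ring

lemma integrable_comp_two_pi {g : Plane → ℂ} (h : Integrable g) :
    Integrable fun w : Plane => g ((2 * Real.pi) • w) :=
  h.comp_smul (by positivity)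

lemma memLp_comp_smul {g : Plane → ℂ} (h : MemLp g 2) {r : ℝ} (hr : r ≠ 0) :
    MemLp (fun w : Plane => g (r • w)) 2 := by
  have hm : Measure.map (fun w : Plane => r • w) volume =
      ENNReal.ofReal |(r ^ Module.finrank ℝ Plane)⁻¹| • volume :=
    Measure.map_addHaar_smul volume hr
  have h2 : MemLp g 2 (Measure.map (fun w : Plane => r • w) volume) := by
    rw [hm]; exact h.smul_measure ENNReal.ofReal_ne_top
  exact h2.comp_of_map (by fun_prop)

/-- For `g ∈ L¹ ∩ L²` the function `invFourier g` represents the `L²` inverse transform. -/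
lemma invFourier_ae_eq {g : Plane → ℂ} (h1 : Integrable g) (h2 : MemLp g 2) :
    invFourier g =ᵐ[volume] ((√hexDet : ℂ) • 𝓕⁻ ((memLp_comp_smul h2
      (by positivity : 2 * Real.pi ≠ 0)).toLp _) : Lp ℂ 2 (volume : Measure Plane)) := by
  filter_upwards [fourierInv_ae_eq (integrable_comp_two_pi h1) (memLp_comp_smul h2
    (by positivity : 2 * Real.pi ≠ 0)), Lp.coeFn_smul (√hexDet : ℂ) (𝓕⁻ ((memLp_comp_smul h2
      (by positivity : 2 * Real.pi ≠ 0)).toLp _) : Lp ℂ 2 (volume : Measure Plane))] with x h3 h4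
  rw [h4, invFourier_eq, h3]
  rfl

lemma memLp_invFourier {g : Plane → ℂ} (h1 : Integrable g) (h2 : MemLp g 2) :
    MemLp (invFourier g) 2 :=
  (memLp_congr_ae (invFourier_ae_eq h1 h2)).2 (Lp.memLp _)

lemma toLp_invFourier {g : Plane → ℂ} (h1 : Integrable g) (h2 : MemLp g 2)
    (hf : MemLp (invFourier g) 2) : hf.toLp _ = ((√hexDet : ℂ) • 𝓕⁻ ((memLp_comp_smul h2
      (by positivity : 2 * Real.pi ≠ 0)).toLp _) : Lp ℂ 2 (volume : Measure Plane)) :=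
  Lp.ext (hf.coeFn_toLp.trans (invFourier_ae_eq h1 h2))

lemma fourier_toLp_invFourier {g : Plane → ℂ} (h1 : Integrable g) (h2 : MemLp g 2)
    (hf : MemLp (invFourier g) 2) :
    (𝓕 (hf.toLp _) : Lp ℂ 2 (volume : Measure Plane)) =
      (√hexDet : ℂ) • (memLp_comp_smul h2 (by positivity : 2 * Real.pi ≠ 0)).toLp _ := by
  rw [toLp_invFourier h1 h2, FourierTransform.fourier_smul,
    FourierTransform.fourier_fourierInv_eq]

lemma hasFourierTransform_invFourier {g : Plane → ℂ} (h1 : Integrable g) (h2 : MemLp g 2) :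
    HasFourierTransform (invFourier g) g := by
  refine ⟨memLp_invFourier h1 h2, ?_⟩
  rw [fourier_toLp_invFourier h1 h2]
  filter_upwards [Lp.coeFn_smul (√hexDet : ℂ)
      ((memLp_comp_smul h2 (by positivity : 2 * Real.pi ≠ 0)).toLp _),
    (memLp_comp_smul h2 (by positivity : 2 * Real.pi ≠ 0)).coeFn_toLp] with w h3 h4
  have hne : (√hexDet : ℂ) ≠ 0 := by
    exact_mod_cast (Real.sqrt_pos.2 hexDet_pos).ne'
  rw [h3, Pi.smul_apply, smul_eq_mul, inv_mul_cancel_left₀ hne, h4]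

/-- Plancherel's formula for the coefficients of `f ∈ L²` with respect to inverse transforms. -/
lemma inner_toLp_invFourier {g : Plane → ℂ} (h1 : Integrable g) (h2 : MemLp g 2)
    (hf : MemLp (invFourier g) 2) (f : Lp ℂ 2 (volume : Measure Plane)) :
    inner ℂ (hf.toLp _) f = ((√hexDet * ((2 * Real.pi) ^ 2)⁻¹ : ℝ) : ℂ) *
      ∫ ξ, (starRingEnd ℂ) (g ξ) *
        (𝓕 f : Lp ℂ 2 (volume : Measure Plane)) ((2 * Real.pi)⁻¹ • ξ) := by
  have hp := Real.pi_pos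
  rw [← Lp.inner_fourier_eq, fourier_toLp_invFourier h1 h2, inner_smul_left, L2.inner_def,
    Complex.conj_ofReal]
  have e : (fun w : Plane => inner ℂ ((memLp_comp_smul h2
      (by positivity : 2 * Real.pi ≠ 0)).toLp _ w) ((𝓕 f : Lp ℂ 2 (volume : Measure Plane)) w))
      =ᵐ[volume] fun w => (fun ξ : Plane => (starRingEnd ℂ) (g ξ) *
        (𝓕 f : Lp ℂ 2 (volume : Measure Plane)) ((2 * Real.pi)⁻¹ • ξ)) ((2 * Real.pi) • w) := by
    filter_upwards [(memLp_comp_smul h2 (by positivity : 2 * Real.pi ≠ 0)).coeFn_toLp] with w hw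
    rw [hw, smul_smul, inv_mul_cancel₀ (by positivity), one_smul]
    simp [mul_comm]
  rw [integral_congr_ae e, integral_comp_smul_plane (fun ξ : Plane => (starRingEnd ℂ) (g ξ) *
        (𝓕 f : Lp ℂ 2 (volume : Measure Plane)) ((2 * Real.pi)⁻¹ • ξ)) (r := 2 * Real.pi)
        (by positivity)]
  push_cast
  ring

/-- Dilations and translations of an inverse transform. -/
lemma dilate_invFourier (g : Plane → ℂ) (j : ℤ) (x n : Plane) :
    dilate j (invFourier g) (x - n) = invFourier (fun ξ => dilateHat j g ξ *
      Complex.exp (-(Complex.I * (inner ℝ n ξ : ℝ)))) x := by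
  have h2 : (0 : ℝ) < 2 ^ j := by positivity
  have h := integral_comp_smul_plane (fun ζ => g ζ *
    Complex.exp (Complex.I * (inner ℝ ((2 : ℝ) ^ (-j) • (x - n)) ζ : ℝ))) h2
  have e : (∫ ξ : Plane, dilateHat j g ξ * Complex.exp (-(Complex.I * (inner ℝ n ξ : ℝ))) *
      Complex.exp (Complex.I * (inner ℝ x ξ : ℝ))) = ((2 : ℝ) ^ j : ℝ) *
      ∫ ξ : Plane, g ((2 : ℝ) ^ j • ξ) * Complex.exp (Complex.I *
        (inner ℝ ((2 : ℝ) ^ (-j) • (x - n)) ((2 : ℝ) ^ j • ξ) : ℝ)) := by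
    rw [← integral_const_mul]
    congr 1
    funext ξ
    rw [dilateHat, real_inner_smul_left, real_inner_smul_right, zpow_neg,
      inv_mul_cancel_left₀ h2.ne', inner_sub_left, mul_assoc _ (Complex.exp _),
      ← Complex.exp_add, mul_assoc]
    congr 3
    push_cast
    ring
  rw [invFourier, e, h, dilate, invFourier, zpow_neg]
  have hc : ((2 : ℂ) ^ j) ≠ 0 := zpow_ne_zero _ two_ne_zero
  push_cast
  field_simp

lemma dilate_one_invFourier (g : Plane → ℂ) :
    dilate 1 (invFourier g) = invFourier (dilateHat 1 g) := by
  funext x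
  have := dilate_invFourier g 1 x 0
  simpa using this

/-! ### Integrability of the wavelets in the frequency domain -/

lemma isCompact_hexS : IsCompact hexS := by
  refine Metric.isCompact_of_isClosed_isBounded isClosed_hexS
    (Metric.isBounded_closedBall (x := (0 : Plane)) (r := 4 * Real.pi) |>.subset fun ξ hξ => ?_)
  obtain ⟨h1, h2, h3⟩ := hξ
  have h := sqrt_three_sq
  have hp := Real.pi_pos
  rw [abs_le] at h1 h2 h3
  rw [mem_closedBall_zero_iff, EuclideanSpace.norm_eq, Fin.sum_univ_two, Real.norm_eq_abs,
    Real.norm_eq_abs, sq_abs, sq_abs]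
  refine Real.sqrt_le_iff.2 ⟨by positivity, ?_⟩
  nlinarith [mul_nonneg (sub_nonneg.2 h2.1) (sub_nonneg.2 h2.2),
    mul_nonneg (sub_nonneg.2 h3.1) (sub_nonneg.2 h3.2)]

lemma hasCompactSupport_of_half_mem {f : Plane → ℂ}
    (h : ∀ ξ, f ξ ≠ 0 → (1 / 2 : ℝ) • ξ ∈ hexS) : HasCompactSupport f := by
  refine HasCompactSupport.intro (isCompact_hexS.smul (2 : ℝ)) fun ξ hξ => ?_
  by_contra h0
  refine hξ ⟨_, h ξ h0, ?_⟩
  simp [smul_smul]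

namespace IsRefinementModulus

variable {ε : ℝ} {M0 : Plane → ℝ}

lemma hasCompactSupport_phiHat (hε : SmallEps ε) (h : IsRefinementModulus ε M0) :
    HasCompactSupport (phiHat (transfer ε M0)) := by
  refine hasCompactSupport_of_half_mem fun ξ hξ => ?_
  rw [h.phiHat_eq hε, Complex.ofReal_ne_zero] at hξ
  exact Set.mem_of_indicator_ne_zero hξ

lemma hasCompactSupport_psiHat (hε : SmallEps ε) (h : IsRefinementModulus ε M0) (k : Fin 6) :
    HasCompactSupport (psiHat (transfer ε M0) k) := by
  refine hasCompactSupport_of_half_mem fun ξ hξ => ?_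
  rw [h.psiHat_eq hε] at hξ
  exact mem_hexS.2 (h.inHexLt_of_scal_half_ne_zero (h.waveCore_ne_zero.1 hξ).1).inHex

end IsRefinementModulus

lemma hasCompactSupport_dilateHat {g : Plane → ℂ} (h : HasCompactSupport g) (j : ℤ) :
    HasCompactSupport (dilateHat j g) :=
  (h.comp_smul (by positivity)).mul_left

lemma continuous_dilateHat {g : Plane → ℂ} (h : Continuous g) (j : ℤ) :
    Continuous (dilateHat j g) := by
  unfold dilateHat; fun_prop

lemma hasFourierTransform_of_continuous {g : Plane → ℂ} (h : Continuous g)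
    (hc : HasCompactSupport g) : HasFourierTransform (invFourier g) g :=
  hasFourierTransform_invFourier (h.integrable_of_hasCompactSupport hc)
    (h.memLp_of_hasCompactSupport hc)

lemma hasFourierTransform_dilate {g : Plane → ℂ} (h : Continuous g)
    (hc : HasCompactSupport g) :
    HasFourierTransform (dilate 1 (invFourier g)) (dilateHat 1 g) := by
  rw [dilate_one_invFourier]
  exact hasFourierTransform_of_continuous (continuous_dilateHat h 1)
    (hasCompactSupport_dilateHat hc 1)

/-! ### Energy of the subsampled channels -/

lemma integral_cellMeasure {E : Type*} [NormedAddCommGroup E] [NormedSpace ℝ E]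
    (F : Plane → E) :
    ∫ ξ, F ξ ∂cellMeasure = hexArea⁻¹ • ∫ ξ in hexCell, F ξ := by
  rw [cellMeasure, integral_smul_measure, ENNReal.toReal_inv, ENNReal.toReal_ofReal hexArea_pos.le]

lemma memLp_cellMeasure {F : Plane → ℂ} (hF : MemLp F 2) : MemLp F 2 cellMeasure := by
  have h0 : ENNReal.ofReal hexArea ≠ 0 := by simpa using hexArea_pos
  exact (hF.restrict hexCell).smul_measure (ENNReal.inv_ne_top.2 h0)

lemma integral_comp_smul_plane_real (f : Plane → ℝ) {r : ℝ} (hr : 0 < r) :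
    ∫ x, f (r • x) = (r ^ 2)⁻¹ * ∫ x, f x := by
  rw [Measure.integral_comp_smul, finrank_plane, abs_of_pos (by positivity)]
  rfl

namespace IsRefinementModulus

variable {ε : ℝ} {M0 : Plane → ℝ}

/-- The aliasing terms with `γ ∉ Λ*` cancel in the sum over the six channels. -/
lemma sum_conj_mul_aliasMean (hε : SmallEps ε) (h : IsRefinementModulus ε M0) (X : Plane → ℂ)
    (ζ : Plane) : ∑ k : Fin 6, (starRingEnd ℂ) ((starRingEnd ℂ) (filt ε M0 k.succ ζ) * X ζ) *
      aliasMean (fun ζ => (starRingEnd ℂ) (filt ε M0 k.succ ζ) * X ζ) ζ =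
      ((1 / 4 * ((1 - periodize M0 ζ ^ 2) * ‖X ζ‖ ^ 2) : ℝ) : ℂ) := by
  calc _ = 1 / 4 * (starRingEnd ℂ) (X ζ) * ∑ p : Fin 2, ∑ q : Fin 2, X (ζ + halfPt p q) *
        (starRingEnd ℂ) (∑ k : Fin 6,
          filt ε M0 k.succ (ζ + halfPt p q) * (starRingEnd ℂ) (filt ε M0 k.succ ζ)) := by
        simp only [aliasMean, map_sum, Finset.mul_sum, map_mul, Complex.conj_conj]
        rw [Finset.sum_comm]
        refine Finset.sum_congr rfl fun p _ => ?_
        rw [Finset.sum_comm]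
        refine Finset.sum_congr rfl fun q _ => Finset.sum_congr rfl fun k _ => ?_
        ring
    _ = _ := by
        simp only [halfPt, sum_filt_succ hε h, halfPt_even]
        simp only [← halfPt.eq_1, Fin.sum_univ_two, halfPt_zero_zero]
        have := Complex.conj_mul' (X ζ)
        simp
        linear_combination (1 / 4 * (1 - (periodize M0 ζ : ℂ) ^ 2)) * this

/-- The energies of the six subsampled channels of a periodic signal. -/
lemma exists_hasSum_channels (hε : SmallEps ε) (h : IsRefinementModulus ε M0) {X : Plane → ℂ}
    (hX : MemLp X 2 cellMeasure) (hXp : IsPeriodic X) :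
    ∃ S : Fin 6 → ℝ, (∀ k, HasSum (fun n : hexLattice =>
      {n : hexLattice | (n : Plane) ∈ frameLattice k.succ}.indicator (fun n =>
        ‖coeff (fun ζ => (starRingEnd ℂ) (filt ε M0 k.succ ζ) * X ζ) n‖ ^ 2) n) (S k)) ∧
      ∑ k, S k = ∫ ζ, 1 / 4 * ((1 - periodize M0 ζ ^ 2) * ‖X ζ‖ ^ 2) ∂cellMeasure := by
  set F : Fin 6 → Plane → ℂ := fun k ζ => (starRingEnd ℂ) (filt ε M0 k.succ ζ) * X ζ with hFdef
  have hF (k : Fin 6) : MemLp (F k) 2 cellMeasure := h.memLp_conj_filt_mul hε k.succ hX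
  have hFp (k : Fin 6) : IsPeriodic (F k) := fun γ hγ ξ => by
    simp only [hFdef, isPeriodic_filt ε M0 k.succ γ hγ, hXp γ hγ]
  refine ⟨fun k => (∫ ζ, (starRingEnd ℂ) (F k ζ) * aliasMean (F k) ζ ∂cellMeasure).re,
    fun k => ?_, ?_⟩
  · have hs := Complex.hasSum_re (hasSum_coeff_mul (hF k) ((hFp k).memLp_aliasMean (hF k)))
    convert hs using 2 with n
    rw [coeff_aliasMean (hFp k) (hF k) k.succ, subUpSample]
    by_cases hn : (n : Plane) ∈ frameLattice k.succ
    · rw [Set.indicator_of_mem (by exact hn), if_pos hn, Complex.conj_mul']; norm_cast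
    · rw [Set.indicator_of_notMem (by exact hn), if_neg hn]; simp
  · rw [← Complex.re_sum, ← integral_finsetSum _ fun k _ => ?_]
    · simp only [hFdef, h.sum_conj_mul_aliasMean hε]
      exact (congrArg Complex.re integral_complex_ofReal).trans (Complex.ofReal_re _)
    · exact (hF k).star.integrable_mul ((hFp k).memLp_aliasMean (hF k))

lemma scal_half_eq_one (hε : SmallEps ε) (h : IsRefinementModulus ε M0) {ξ : Plane}
    (h0 : scal M0 ξ ≠ 0) : scal M0 ((1 / 2 : ℝ) • ξ) = 1 := by
  obtain ⟨h1, h2, h3, h4⟩ := hε.bounds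
  have := (h.inHexLt_of_scal_ne_zero h0).smul (c := 1 / 2) (by norm_num)
  refine h.scal_eq_one hε ?_
  rw [hexB_smul, PiLp.smul_apply, smul_eq_mul]
  exact (this.mono (by linarith)).inHex

/-- The restriction of the product of `φ̂` with `H` to the cell, extended periodically. -/
lemma memLp_localized (h : IsRefinementModulus ε M0) {H : Plane → ℂ} (hH : MemLp H 2) :
    MemLp (fun ζ => (scal M0 ((1 / 2 : ℝ) • cellRep ζ) : ℂ) * H (cellRep ζ)) 2 cellMeasure := by
  have hs := h.continuous_scal
  have h1 : MemLp (fun ζ => (scal M0 ((1 / 2 : ℝ) • ζ) : ℂ) * H ζ) 2 := by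
    refine hH.of_le ((by fun_prop : Continuous fun ζ : Plane =>
      (scal M0 ((1 / 2 : ℝ) • ζ) : ℂ)).aestronglyMeasurable.mul hH.1) (.of_forall fun ζ => ?_)
    rw [norm_mul, Complex.norm_real, Real.norm_eq_abs]
    have := h.scal_mem ((1 / 2 : ℝ) • ζ)
    exact mul_le_of_le_one_left (norm_nonneg _) (abs_le.2 ⟨by linarith [this.1], this.2⟩)
  refine (memLp_congr_ae ?_).1 (memLp_cellMeasure h1)
  filter_upwards [ae_cellMeasure_mem] with ζ hζ
  rw [cellRep_of_mem hζ]

lemma isPeriodic_localized (M0 : Plane → ℝ) (H : Plane → ℂ) :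
    IsPeriodic (fun ζ => (scal M0 ((1 / 2 : ℝ) • cellRep ζ) : ℂ) * H (cellRep ζ)) :=
  fun γ hγ ζ => by simp only [cellRep_add hγ]

/-- The energy that the six channels extract at one scale, in terms of `φ̂`: since `φ̂(ξ) = 1` where
`φ̂(2ξ) ≠ 0`, the product `φ̂(ξ)² (1 - 𝓜_0(ξ)²)` equals `φ̂(ξ)² - φ̂(2ξ)²`. -/
lemma integral_localized (hε : SmallEps ε) (h : IsRefinementModulus ε M0) (H : Plane → ℂ) :
    ∫ ζ, 1 / 4 * ((1 - periodize M0 ζ ^ 2) *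
      ‖(scal M0 ((1 / 2 : ℝ) • cellRep ζ) : ℂ) * H (cellRep ζ)‖ ^ 2) ∂cellMeasure =
    1 / 4 * hexArea⁻¹ *
      ∫ ζ, (scal M0 ((1 / 2 : ℝ) • ζ) ^ 2 - scal M0 ζ ^ 2) * ‖H ζ‖ ^ 2 := by
  have hzero : ∀ ζ, ζ ∉ hexCell →
      (scal M0 ((1 / 2 : ℝ) • ζ) ^ 2 - scal M0 ζ ^ 2) * ‖H ζ‖ ^ 2 = 0 := by
    intro ζ hζ
    have h1 : scal M0 ((1 / 2 : ℝ) • ζ) = 0 := by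
      by_contra h0
      exact hζ (h.inHexLt_of_scal_half_ne_zero h0).mem_hexCell
    have h2 : scal M0 ζ = 0 := by
      by_contra h0
      rw [h.scal_half_eq_one hε h0] at h1
      exact one_ne_zero h1
    rw [h1, h2]; ring
  rw [integral_const_mul, integral_cellMeasure, smul_eq_mul, ← mul_assoc]
  congr 1
  rw [← setIntegral_eq_integral_of_forall_compl_eq_zero hzero]
  · refine setIntegral_congr_fun measurableSet_hexCell fun ζ hζ => ?_
    simp only [cellRep_of_mem hζ, h.periodize_eq_scal (hexCell_subset hζ), norm_mul, mul_pow,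
      Complex.norm_real, Real.norm_eq_abs, sq_abs]
    rcases eq_or_ne (scal M0 ζ) 0 with h0 | h0
    · rw [h0]; ring
    · rw [h.scal_half_eq_one hε h0]; ring

/-- The coefficients of a signal with respect to the wavelets of one scale are Fourier
coefficients of the periodized filtered signal. -/
lemma integral_waveCore_mul (hε : SmallEps ε) (h : IsRefinementModulus ε M0) (H : Plane → ℂ)
    (k : Fin 6) (n : hexLattice) :
    ∫ ζ, (starRingEnd ℂ) (waveCore ε M0 k ζ) * H ζ *
        Complex.exp (-(Complex.I * (inner ℝ (n : Plane) ζ : ℝ))) =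
      hexArea * coeff (fun ζ => (starRingEnd ℂ) (filt ε M0 k.succ ζ) *
        ((scal M0 ((1 / 2 : ℝ) • cellRep ζ) : ℂ) * H (cellRep ζ))) n := by
  have hA : (hexArea : ℂ) ≠ 0 := by exact_mod_cast hexArea_pos.ne'
  rw [coeff_eq_integral, integral_cellMeasure, Complex.real_smul, Complex.ofReal_inv,
    mul_inv_cancel_left₀ hA,
    ← setIntegral_eq_integral_of_forall_compl_eq_zero (s := hexCell) fun ζ hζ => ?_]
  · refine setIntegral_congr_fun measurableSet_hexCell fun ζ hζ => ?_
    simp only [cellRep_of_mem hζ, ← h.phiHat_mul_filt hε, h.phiHat_eq hε, map_mul,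
      Complex.conj_ofReal]
    ring
  · have h1 : waveCore ε M0 k ζ = 0 := by
      by_contra h0
      exact hζ (h.inHexLt_of_scal_half_ne_zero (h.waveCore_ne_zero.1 h0).1).mem_hexCell
    rw [h1]; simp

/-! ### Summation over the scales -/

lemma scal_sq_sub_nonneg (hε : SmallEps ε) (h : IsRefinementModulus ε M0) (ζ : Plane) :
    0 ≤ scal M0 ((1 / 2 : ℝ) • ζ) ^ 2 - scal M0 ζ ^ 2 := by
  rcases eq_or_ne (scal M0 ζ) 0 with h0 | h0
  · rw [h0]; nlinarith [sq_nonneg (scal M0 ((1 / 2 : ℝ) • ζ))]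
  · rw [h.scal_half_eq_one hε h0]
    have := h.scal_mem ζ
    nlinarith [this.1, this.2]

/-- The series telescopes, with limits `φ̂(0)² = 1` as `j → -∞` and `0` as `j → ∞`. -/
lemma hasSum_scal_sq_sub (hε : SmallEps ε) (h : IsRefinementModulus ε M0) {ξ : Plane}
    (hξ : ξ ≠ 0) : HasSum (fun j : ℤ => scal M0 ((1 / 2 : ℝ) • (2 : ℝ) ^ (j - 1) • ξ) ^ 2 -
      scal M0 ((2 : ℝ) ^ (j - 1) • ξ) ^ 2) 1 := by
  have hn : 0 < ‖ξ‖ := norm_pos_iff.2 hξ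
  set a : ℤ → ℝ := fun j => scal M0 ((2 : ℝ) ^ (j - 2) • ξ) ^ 2 with ha
  have e (j : ℤ) : scal M0 ((1 / 2 : ℝ) • (2 : ℝ) ^ (j - 1) • ξ) ^ 2 -
      scal M0 ((2 : ℝ) ^ (j - 1) • ξ) ^ 2 = a j - a (j + 1) := by
    simp only [ha, smul_smul]
    rw [show j - 1 = (j - 2) + 1 by ring, zpow_add_one₀ two_ne_zero,
      show j + 1 - 2 = (j - 2) + 1 by ring, zpow_add_one₀ two_ne_zero]
    ring_nf
  simp only [e]
  -- `φ̂` equals `1` near the origin and vanishes far away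
  obtain ⟨n₀, hn₀⟩ : ∃ n : ℕ, ∀ j : ℤ, j ≤ -n → a j = 1 := by
    obtain ⟨h0, h1, h2, h3⟩ := hε.bounds
    obtain ⟨δ, hδ, hball⟩ := Metric.isOpen_iff.1 (isOpen_inHexLt (Real.pi / 2 - ε)) 0
      (by simp [InHexLt, hexB]; linarith [Real.pi_pos])
    obtain ⟨n, hn'⟩ := exists_pow_lt_of_lt_one (div_pos hδ hn) (by norm_num : (1 / 2 : ℝ) < 1)
    refine ⟨n, fun j hj => ?_⟩
    have hlt : (2 : ℝ) ^ (j - 2) • ξ ∈ Metric.ball (0 : Plane) δ := by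
      rw [mem_ball_zero_iff, norm_smul, Real.norm_of_nonneg (by positivity), ← lt_div_iff₀ hn]
      refine lt_of_le_of_lt ?_ hn'
      rw [one_div, inv_pow, ← zpow_natCast, ← zpow_neg]
      exact zpow_le_zpow_right₀ one_le_two (by omega)
    have hin : InHexLt (Real.pi / 2 - ε) _ _ := hball hlt
    simp only [ha, h.scal_eq_one hε hin.inHex, one_pow]
  obtain ⟨n₁, hn₁⟩ : ∃ n : ℕ, ∀ j : ℤ, n ≤ j → a j = 0 := by
    obtain ⟨R, hR⟩ := isCompact_hexS.isBounded.subset_closedBall (0 : Plane)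
    obtain ⟨n, hn'⟩ := pow_unbounded_of_one_lt (R / ‖ξ‖) one_lt_two
    refine ⟨n + 2, fun j hj => ?_⟩
    have hS : (2 : ℝ) ^ (j - 2) • ξ ∉ hexS := by
      intro hS
      have := hR hS
      rw [mem_closedBall_zero_iff, norm_smul, Real.norm_of_nonneg (by positivity),
        ← le_div_iff₀ hn] at this
      refine absurd (hn'.trans_le ?_) this.not_gt
      rw [← zpow_natCast]
      exact zpow_le_zpow_right₀ one_le_two (by push_cast at hj; omega)
    simp only [ha, scal, Set.indicator_of_notMem hS]
    norm_num
  have hz : ∀ j ∉ (Finset.range (n₀ + n₁)).image (fun i : ℕ => (i : ℤ) - n₀),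
      a j - a (j + 1) = 0 := by
    intro j hj
    rcases lt_or_ge j (-n₀) with hlt | hge
    · rw [hn₀ j (by omega), hn₀ (j + 1) (by omega), sub_self]
    · have : (n₁ : ℤ) ≤ j := by
        by_contra hc
        refine hj (Finset.mem_image.2 ⟨(j + n₀).toNat, Finset.mem_range.2 (by omega), by omega⟩)
      rw [hn₁ j this, hn₁ (j + 1) (by omega), sub_self]
  have hs : HasSum (fun j => a j - a (j + 1)) _ := hasSum_sum_of_ne_finset_zero hz
  rw [Finset.sum_image (fun i _ i' _ hi => by simpa using hi)] at hs
  have ht := Finset.sum_range_sub' (fun i : ℕ => a ((i : ℤ) - n₀)) (n₀ + n₁)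
  have e2 (i : ℕ) : ((i + 1 : ℕ) : ℤ) - n₀ = (i : ℤ) - n₀ + 1 := by push_cast; ring
  simp only [e2] at ht
  rw [ht, hn₀ _ (by simp), hn₁ _ (by push_cast; omega), sub_zero] at hs
  exact hs

/-- The energies of the scales add up to the energy of the signal. -/
lemma hasSum_integral_scales (hε : SmallEps ε) (h : IsRefinementModulus ε M0) {H : Plane → ℂ}
    (hH : MemLp H 2) : HasSum (fun j : ℤ => ∫ ξ, (scal M0 ((1 / 2 : ℝ) • (2 : ℝ) ^ (j - 1) • ξ) ^ 2 -
      scal M0 ((2 : ℝ) ^ (j - 1) • ξ) ^ 2) * ‖H ξ‖ ^ 2) (∫ ξ, ‖H ξ‖ ^ 2) := by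
  have hs := h.continuous_scal
  have hsum : ∀ᵐ ξ : Plane, HasSum (fun j : ℤ =>
      (scal M0 ((1 / 2 : ℝ) • (2 : ℝ) ^ (j - 1) • ξ) ^ 2 -
        scal M0 ((2 : ℝ) ^ (j - 1) • ξ) ^ 2) * ‖H ξ‖ ^ 2) (‖H ξ‖ ^ 2) := by
    filter_upwards [compl_mem_ae_iff.2 (measure_singleton (0 : Plane))] with ξ hξ
    simpa using (h.hasSum_scal_sq_sub hε hξ).mul_right (‖H ξ‖ ^ 2)
  have hint : Integrable fun ξ => ‖H ξ‖ ^ 2 := hH.integrable_norm_pow two_ne_zero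
  refine hasSum_integral_of_dominated_convergence (fun j ξ =>
      (scal M0 ((1 / 2 : ℝ) • (2 : ℝ) ^ (j - 1) • ξ) ^ 2 -
        scal M0 ((2 : ℝ) ^ (j - 1) • ξ) ^ 2) * ‖H ξ‖ ^ 2) (fun j => ?_) (fun j => ?_)
    (hsum.mono fun ξ h => h.summable) ?_ hsum
  · exact (by fun_prop : Continuous fun ξ : Plane =>
      (scal M0 ((1 / 2 : ℝ) • (2 : ℝ) ^ (j - 1) • ξ) ^ 2 -
        scal M0 ((2 : ℝ) ^ (j - 1) • ξ) ^ 2)).aestronglyMeasurable.mul hint.1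
  · refine .of_forall fun ξ => ?_
    rw [Real.norm_of_nonneg (mul_nonneg (h.scal_sq_sub_nonneg hε _) (sq_nonneg _))]
  · exact hint.congr (hsum.mono fun ξ h => h.tsum_eq.symm)

end IsRefinementModulus

/-! ### The wavelet frame -/

lemma integral_norm_sq_fourier (f : Lp ℂ 2 (volume : Measure Plane)) :
    ∫ ξ : Plane, ‖(𝓕 f : Lp ℂ 2 (volume : Measure Plane)) ((2 * Real.pi)⁻¹ • ξ)‖ ^ 2 =
      (2 * Real.pi) ^ 2 * ‖f‖ ^ 2 := by
  have h1 : ∫ w : Plane, ‖(𝓕 f : Lp ℂ 2 (volume : Measure Plane)) w‖ ^ 2 = ‖f‖ ^ 2 := by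
    rw [← Lp.norm_fourier_eq f]
    have h2 := L2.inner_def (𝕜 := ℂ) (𝓕 f : Lp ℂ 2 (volume : Measure Plane)) (𝓕 f)
    simp only [inner_self_eq_norm_sq_to_K] at h2
    have h3 : (∫ w : Plane, ((‖(𝓕 f : Lp ℂ 2 (volume : Measure Plane)) w‖ : ℂ) ^ 2)) =
        ((∫ w : Plane, ‖(𝓕 f : Lp ℂ 2 (volume : Measure Plane)) w‖ ^ 2 : ℝ) : ℂ) := by
      rw [← integral_complex_ofReal]; simp
    have h4 : ((‖(𝓕 f : Lp ℂ 2 (volume : Measure Plane))‖ ^ 2 : ℝ) : ℂ) =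
        ((∫ w : Plane, ‖(𝓕 f : Lp ℂ 2 (volume : Measure Plane)) w‖ ^ 2 : ℝ) : ℂ) := by
      rw [Complex.ofReal_pow]; exact h2.trans h3
    exact_mod_cast h4.symm
  have h := integral_comp_smul_plane_real
    (fun w => ‖(𝓕 f : Lp ℂ 2 (volume : Measure Plane)) w‖ ^ 2) (r := (2 * Real.pi)⁻¹)
    (by positivity)
  rw [h, h1, inv_pow, inv_inv]

/-- The index `(k, j, n)` corresponds to the lattice point `-2^{1-j} n ∈ 2Λ`. -/
def scaledIndex (k : Fin 7) (j : ℤ) (n : ((2 : ℝ) ^ (j - 1) • frameLattice k : AddSubgroup Plane)) :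
    hexLattice :=
  ⟨-(((2 : ℝ) ^ (j - 1))⁻¹ • (n : Plane)), by
    obtain ⟨m, hm, hmn⟩ := (AddSubgroup.mem_smul_pointwise_iff_exists _ _ _).1 n.2
    rw [← hmn, inv_smul_smul₀ (by positivity)]
    exact neg_mem (frameLattice_le k hm)⟩

lemma injective_scaledIndex (k : Fin 7) (j : ℤ) : Function.Injective (scaledIndex k j) := by
  intro n n' h
  have h2 := congrArg Subtype.val h
  simp only [scaledIndex, neg_inj] at h2
  exact Subtype.ext (smul_right_injective Plane (by positivity : ((2 : ℝ) ^ (j - 1))⁻¹ ≠ 0) h2)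

lemma range_scaledIndex (k : Fin 7) (j : ℤ) :
    Set.range (scaledIndex k j) = {n : hexLattice | (n : Plane) ∈ frameLattice k} := by
  ext n
  constructor
  · rintro ⟨⟨x, hx⟩, rfl⟩
    obtain ⟨m, hm, rfl⟩ := (AddSubgroup.mem_smul_pointwise_iff_exists _ _ _).1 hx
    change -(((2 : ℝ) ^ (j - 1))⁻¹ • ((2 : ℝ) ^ (j - 1) • m)) ∈ frameLattice k
    rw [inv_smul_smul₀ (by positivity)]
    exact neg_mem hm
  · intro hn
    refine ⟨⟨(2 : ℝ) ^ (j - 1) • (-(n : Plane)),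
      AddSubgroup.smul_mem_pointwise_smul _ _ _ (neg_mem hn)⟩, Subtype.ext ?_⟩
    change -(((2 : ℝ) ^ (j - 1))⁻¹ • ((2 : ℝ) ^ (j - 1) • (-(n : Plane)))) = n
    rw [inv_smul_smul₀ (by positivity), neg_neg]

/-- Sums over the translation parameters of one scale and channel are sums over `2Λ`. -/
lemma hasSum_scaledIndex {k : Fin 7} (j : ℤ) {u : hexLattice → ℝ} {s : ℝ}
    (h : HasSum ({n : hexLattice | (n : Plane) ∈ frameLattice k}.indicator u) s) :
    HasSum (fun n => u (scaledIndex k j n)) s := by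
  rw [← (injective_scaledIndex k j).hasSum_iff fun n hn =>
    Set.indicator_of_notMem (by rwa [range_scaledIndex] at hn) _] at h
  have e : {n : hexLattice | (n : Plane) ∈ frameLattice k}.indicator u ∘ scaledIndex k j =
      fun n => u (scaledIndex k j n) := funext fun n =>
    Set.indicator_of_mem ((range_scaledIndex k j).subset (Set.mem_range_self n)) _
  rwa [e] at h

lemma waveletSystem_eq (M : Fin 7 → Plane → ℂ) (i : WaveletIndex frameLattice) :
    waveletSystem frameLattice M i = invFourier (fun ξ => dilateHat i.2.1 (psiHat M i.1) ξ *
      Complex.exp (-(Complex.I * (inner ℝ (i.2.2 : Plane) ξ : ℝ)))) :=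
  funext fun x => dilate_invFourier _ _ x _

namespace IsRefinementModulus

variable {ε : ℝ} {M0 : Plane → ℝ}

lemma continuous_waveletHat (hε : SmallEps ε) (h : IsRefinementModulus ε M0) (k : Fin 6) (j : ℤ)
    (n : Plane) : Continuous fun ξ => dilateHat j (psiHat (transfer ε M0) k) ξ *
      Complex.exp (-(Complex.I * (inner ℝ n ξ : ℝ))) := by
  have := continuous_dilateHat (h.continuous_psiHat hε k) j
  fun_prop

lemma hasCompactSupport_waveletHat (hε : SmallEps ε) (h : IsRefinementModulus ε M0) (k : Fin 6)
    (j : ℤ) (n : Plane) : HasCompactSupport fun ξ => dilateHat j (psiHat (transfer ε M0) k) ξ *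
      Complex.exp (-(Complex.I * (inner ℝ n ξ : ℝ))) :=
  (hasCompactSupport_dilateHat (h.hasCompactSupport_psiHat hε k) j).mul_right

lemma memLp_waveletSystem (hε : SmallEps ε) (h : IsRefinementModulus ε M0)
    (i : WaveletIndex frameLattice) :
    MemLp (waveletSystem frameLattice (transfer ε M0) i) 2 := by
  rw [waveletSystem_eq]
  have hc := h.continuous_waveletHat hε i.1 i.2.1 i.2.2
  have hs := h.hasCompactSupport_waveletHat hε i.1 i.2.1 i.2.2
  exact memLp_invFourier (hc.integrable_of_hasCompactSupport hs) (hc.memLp_of_hasCompactSupport hs)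

/-- The coefficients of `f` in the wavelet system as Fourier coefficients. -/
lemma norm_inner_waveletSystem (hε : SmallEps ε) (h : IsRefinementModulus ε M0)
    (f : Lp ℂ 2 (volume : Measure Plane)) (k : Fin 6) (j : ℤ)
    (n : ((2 : ℝ) ^ (j - 1) • frameLattice k.succ : AddSubgroup Plane)) :
    ‖inner ℂ ((h.memLp_waveletSystem hε ⟨k, j, n⟩).toLp _) f‖ ^ 2 =
      4 * hexArea * ((2 * Real.pi) ^ 2)⁻¹ * (((2 : ℝ) ^ (j - 1)) ^ 2)⁻¹ *
      ‖coeff (fun ζ => (starRingEnd ℂ) (filt ε M0 k.succ ζ) *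
        ((scal M0 ((1 / 2 : ℝ) • cellRep ζ) : ℂ) *
          (fun ζ => (𝓕 f : Lp ℂ 2 (volume : Measure Plane))
            ((2 * Real.pi)⁻¹ • ((2 : ℝ) ^ (j - 1))⁻¹ • ζ)) (cellRep ζ)))
        (scaledIndex k.succ j n)‖ ^ 2 := by
  have hp := Real.pi_pos
  have hc := h.continuous_waveletHat hε k j n
  have hs := h.hasCompactSupport_waveletHat hε k j n
  have key : ∀ (e : Plane → ℂ) (_ : e = invFourier fun ξ =>
      dilateHat j (psiHat (transfer ε M0) k) ξ *
        Complex.exp (-(Complex.I * (inner ℝ (n : Plane) ξ : ℝ)))) (he : MemLp e 2),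
      inner ℂ (he.toLp e) f = ((√hexDet * ((2 * Real.pi) ^ 2)⁻¹ : ℝ) : ℂ) *
        ∫ ξ, (starRingEnd ℂ) (dilateHat j (psiHat (transfer ε M0) k) ξ *
          Complex.exp (-(Complex.I * (inner ℝ (n : Plane) ξ : ℝ)))) *
          (𝓕 f : Lp ℂ 2 (volume : Measure Plane)) ((2 * Real.pi)⁻¹ • ξ) := by
    rintro _ rfl he
    exact inner_toLp_invFourier (hc.integrable_of_hasCompactSupport hs)
      (hc.memLp_of_hasCompactSupport hs) he f
  rw [key _ (waveletSystem_eq _ ⟨k, j, n⟩)]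
  have hu0 : 0 < (2 : ℝ) ^ (j - 1) := by positivity
  have hj : (2 : ℝ) ^ j = 2 * (2 : ℝ) ^ (j - 1) := by rw [zpow_sub_one₀ two_ne_zero]; ring
  have hsub := integral_comp_smul_plane (fun ζ => (starRingEnd ℂ) (waveCore ε M0 k ζ) *
    (fun ζ => (𝓕 f : Lp ℂ 2 (volume : Measure Plane))
      ((2 * Real.pi)⁻¹ • ((2 : ℝ) ^ (j - 1))⁻¹ • ζ)) ζ *
    Complex.exp (-(Complex.I * (inner ℝ (scaledIndex k.succ j n : Plane) ζ : ℝ)))) hu0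
  rw [h.integral_waveCore_mul hε] at hsub
  have e : (∫ ξ, (starRingEnd ℂ) (dilateHat j (psiHat (transfer ε M0) k) ξ *
      Complex.exp (-(Complex.I * (inner ℝ (n : Plane) ξ : ℝ)))) *
      (𝓕 f : Lp ℂ 2 (volume : Measure Plane)) ((2 * Real.pi)⁻¹ • ξ)) = ((2 : ℝ) ^ j : ℝ) *
      ∫ ξ, (starRingEnd ℂ) (waveCore ε M0 k ((2 : ℝ) ^ (j - 1) • ξ)) *
        (fun ζ => (𝓕 f : Lp ℂ 2 (volume : Measure Plane))
          ((2 * Real.pi)⁻¹ • ((2 : ℝ) ^ (j - 1))⁻¹ • ζ)) ((2 : ℝ) ^ (j - 1) • ξ) *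
        Complex.exp (-(Complex.I *
          (inner ℝ (scaledIndex k.succ j n : Plane) ((2 : ℝ) ^ (j - 1) • ξ) : ℝ))) := by
    rw [← integral_const_mul]
    congr 1
    funext ξ
    have hin : inner ℝ (scaledIndex k.succ j n : Plane) ((2 : ℝ) ^ (j - 1) • ξ) =
        -inner ℝ (n : Plane) ξ := by
      simp only [scaledIndex]
      rw [inner_neg_left, real_inner_smul_left, real_inner_smul_right, inv_mul_cancel_left₀ hu0.ne']
    have hh : (1 / 2 : ℝ) * (2 : ℝ) ^ j = (2 : ℝ) ^ (j - 1) := by rw [hj]; ring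
    simp only [inv_smul_smul₀ hu0.ne']
    rw [hin, dilateHat, h.psiHat_eq hε, smul_smul, map_mul, map_mul,
      Complex.conj_ofReal, ← Complex.exp_conj, map_neg, map_mul, Complex.conj_I,
      Complex.conj_ofReal, hh]
    push_cast
    ring_nf
  rw [e, hsub]
  simp only [norm_mul, Complex.norm_real, mul_pow, Real.norm_eq_abs, sq_abs]
  rw [Real.sq_sqrt hexDet_pos.le, hj]
  have hdet : hexDet = (2 * Real.pi) ^ 2 * hexArea⁻¹ := by
    rw [hexDet_eq, hexArea]
    have := sqrt_three_pos
    have h3 := sqrt_three_sq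
    field_simp
  have hA := hexArea_pos
  rw [hdet]
  field_simp
  ring

/-- The squared coefficients of one scale add up to the energy computed in `integral_localized`, and
these energies add up to `‖f‖²` by `hasSum_integral_scales`. -/
lemma isParsevalFrame_waveletSystem (hε : SmallEps ε) (h : IsRefinementModulus ε M0) :
    IsParsevalFrame (waveletSystem frameLattice (transfer ε M0)) := by
  refine ⟨h.memLp_waveletSystem hε, fun f => ?_⟩
  have hp := Real.pi_pos
  have hA := hexArea_pos
  set H : Plane → ℂ := fun ξ => (𝓕 f : Lp ℂ 2 (volume : Measure Plane)) ((2 * Real.pi)⁻¹ • ξ)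
    with hH
  have hH2 : MemLp H 2 := memLp_comp_smul (Lp.memLp _) (by positivity)
  -- the signal at scale `j`
  have hHj (j : ℤ) : MemLp (fun ζ => H (((2 : ℝ) ^ (j - 1))⁻¹ • ζ)) 2 :=
    memLp_comp_smul hH2 (by positivity)
  choose S hS hS' using fun j => h.exists_hasSum_channels hε (h.memLp_localized (hHj j))
    (isPeriodic_localized M0 fun ζ => H (((2 : ℝ) ^ (j - 1))⁻¹ • ζ))
  -- the ratio of the squared frame coefficients to the squared Fourier coefficients on the cell
  set C : ℤ → ℝ := fun j => 4 * hexArea * ((2 * Real.pi) ^ 2)⁻¹ * (((2 : ℝ) ^ (j - 1)) ^ 2)⁻¹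
    with hC
  have hC0 (j : ℤ) : 0 ≤ C j := by positivity
  have hn (k : Fin 6) (j : ℤ) : HasSum (fun n =>
      ‖inner ℂ ((h.memLp_waveletSystem hε ⟨k, j, n⟩).toLp _) f‖ ^ 2) (C j * S j k) := by
    simp only [h.norm_inner_waveletSystem hε f k j]
    exact (hasSum_scaledIndex j (hS j k)).mul_left (C j)
  have hS0 (j : ℤ) (k : Fin 6) : 0 ≤ S j k :=
    (hS j k).nonneg fun n => Set.indicator_nonneg (fun _ _ => sq_nonneg _) n
  have hscale (j : ℤ) : ∑ k, C j * S j k = ((2 * Real.pi) ^ 2)⁻¹ *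
      ∫ ξ, (scal M0 ((1 / 2 : ℝ) • (2 : ℝ) ^ (j - 1) • ξ) ^ 2 -
        scal M0 ((2 : ℝ) ^ (j - 1) • ξ) ^ 2) * ‖H ξ‖ ^ 2 := by
    rw [← Finset.mul_sum, hS', h.integral_localized hε fun ζ => H (((2 : ℝ) ^ (j - 1))⁻¹ • ζ)]
    have hu0 : (0 : ℝ) < (2 : ℝ) ^ (j - 1) := by positivity
    have := integral_comp_smul_plane_real (fun ζ => (scal M0 ((1 / 2 : ℝ) • ζ) ^ 2 -
      scal M0 ζ ^ 2) * ‖H (((2 : ℝ) ^ (j - 1))⁻¹ • ζ)‖ ^ 2) hu0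
    simp only [inv_smul_smul₀ hu0.ne'] at this
    rw [this, hC]
    field_simp
  have hj : HasSum (fun j => ∑ k, C j * S j k) (‖f‖ ^ 2) := by
    simp only [hscale]
    have := (h.hasSum_integral_scales hε hH2).mul_left ((2 * Real.pi) ^ 2)⁻¹
    rwa [integral_norm_sq_fourier, inv_mul_cancel_left₀ (by positivity)] at this
  have hk (k : Fin 6) : Summable fun j => C j * S j k :=
    hj.summable.of_nonneg_of_le (fun j => mul_nonneg (hC0 j) (hS0 j k)) fun j =>
      Finset.single_le_sum (f := fun k => C j * S j k)
        (fun k _ => mul_nonneg (hC0 j) (hS0 j k)) (Finset.mem_univ k)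
  have hkj (k : Fin 6) : HasSum (fun i : Σ j : ℤ,
      ((2 : ℝ) ^ (j - 1) • frameLattice k.succ : AddSubgroup Plane) =>
      ‖inner ℂ ((h.memLp_waveletSystem hε ⟨k, i⟩).toLp _) f‖ ^ 2) (∑' j, C j * S j k) := by
    refine HasSum.sigma_of_hasSum (hk k).hasSum (fun j => hn k j) ?_
    refine (summable_sigma_of_nonneg fun i => sq_nonneg _).2 ⟨fun j => (hn k j).summable, ?_⟩
    simp only [(hn k _).tsum_eq]
    exact hk k
  have htot : HasSum (fun k => ∑' j, C j * S j k) (‖f‖ ^ 2) := by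
    have h1 : HasSum (fun j => ∑ k, C j * S j k) (∑ k, ∑' j, C j * S j k) :=
      hasSum_sum fun k _ => (hk k).hasSum
    rw [hj.unique h1]
    exact hasSum_fintype _
  refine HasSum.sigma_of_hasSum htot hkj ?_
  refine (summable_sigma_of_nonneg fun i => sq_nonneg _).2 ⟨fun k => (hkj k).summable, ?_⟩
  simp only [(hkj _).tsum_eq]
  exact htot.summable

end IsRefinementModulus

/-! ### Rotation invariance -/

/-- The rotation `rot θ` as a linear isometry. -/
def rotIso (θ : ℝ) : Plane ≃ₗᵢ[ℝ] Plane where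
  toFun := rot θ
  invFun := rot (-θ)
  map_add' x y := by apply plane_ext <;> simp [rot_zero, rot_one] <;> ring
  map_smul' c x := by apply plane_ext <;> simp [rot_zero, rot_one] <;> ring
  left_inv x := by rw [rot_add_angle, neg_add_cancel, rot_zero_angle]
  right_inv x := by rw [rot_add_angle, add_neg_cancel, rot_zero_angle]
  norm_map' x := by
    change ‖rot θ x‖ = ‖x‖
    rw [EuclideanSpace.norm_eq, EuclideanSpace.norm_eq]
    congr 1
    simp only [Fin.sum_univ_two, Real.norm_eq_abs, sq_abs, rot_zero, rot_one]
    linear_combination (x 0 ^ 2 + x 1 ^ 2) * Real.sin_sq_add_cos_sq θ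

lemma rot_smul (θ c : ℝ) (x : Plane) : rot θ (c • x) = c • rot θ x := (rotIso θ).map_smul c x

lemma invFourier_rot (g : Plane → ℂ) (θ : ℝ) (x : Plane) :
    invFourier g (rot θ x) = invFourier (fun ξ => g (rot θ ξ)) x := by
  rw [invFourier, invFourier, ← (rotIso θ).measurePreserving.integral_comp
    (rotIso θ).toHomeomorph.measurableEmbedding]
  have hin (ξ : Plane) : inner ℝ (rot θ x) (rot θ ξ) = inner ℝ x ξ := (rotIso θ).inner_map_map x ξ
  have hrot (ξ : Plane) : rotIso θ ξ = rot θ ξ := rfl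
  simp only [hrot, hin]

/-- The action of the rotation by `2π/3` on the six filters. -/
def rotPerm : Fin 6 → Fin 6 := ![4, 5, 0, 1, 2, 3]

lemma sector_rot_two (ε : ℝ) (k : Fin 6) (a b : ℝ) :
    sector ε (sectorIdx k) (-b) (a - b) = sector ε (sectorIdx (rotPerm k)) a b := by
  obtain ⟨h0, h1, h2, h3, h4, h5⟩ := sector_rot ε a b
  obtain ⟨g0, g1, g2, g3, g4, g5⟩ := sector_rot ε (a - b) a
  rw [show a - b - a = -b by ring] at g0 g1 g2 g3 g4 g5
  fin_cases k
  · exact g0.trans h4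
  · exact g5.trans h3
  · exact g4.trans h2
  · exact g3.trans h1
  · exact g2.trans h0
  · exact g1.trans h5

lemma inner_etaFr (k : Fin 7) (ζ : Plane) : inner ℝ ζ (etaFr k) =
    (etaCoord k).1 * ζ 0 + (2 * (etaCoord k).2 - (etaCoord k).1) * (2 * hexB ζ - ζ 0) / 3 := by
  have h := sqrt_three_sq
  have h0 := sqrt_three_pos
  rw [etaFr_eq, inner_plane, hexPt_zero, hexPt_one, sqrt_three_mul_apply_one ζ]
  field_simp
  rw [sq, h]
  ring

/-- The rotation by `2π/3` permutes the phase vectors like the sectors, see `sector_rot_two`. -/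
lemma inner_rot_etaFr (k : Fin 6) (ζ : Plane) :
    inner ℝ (rot (2 * Real.pi / 3) ζ) (etaFr k.succ) = inner ℝ ζ (etaFr (rotPerm k).succ) := by
  rw [inner_etaFr, inner_etaFr, (rot_two_pi_div_three ζ).1, (rot_two_pi_div_three ζ).2]
  fin_cases k <;> simp [etaCoord, rotPerm] <;> ring

namespace IsRefinementModulus

variable {ε : ℝ} {M0 : Plane → ℝ}

lemma scal_rot (h : IsRefinementModulus ε M0) (ξ : Plane) :
    scal M0 (rot (2 * Real.pi / 3) ξ) = scal M0 ξ := by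
  have key (ξ : Plane) : scal M0 (rot (Real.pi / 3) ξ) = scal M0 ξ := by
    have hmem : rot (Real.pi / 3) ξ ∈ hexS ↔ ξ ∈ hexS := by
      rw [mem_hexS, mem_hexS, (rot_pi_div_three ξ).1, (rot_pi_div_three ξ).2]
      exact ⟨InHex.of_rot, InHex.rot⟩
    by_cases hξ : ξ ∈ hexS
    · rw [scal, Set.indicator_of_mem hξ, Set.indicator_of_mem (hmem.2 hξ), h.rot_invariant ξ hξ]
    · rw [scal, Set.indicator_of_notMem hξ, Set.indicator_of_notMem (hmem.not.2 hξ)]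
  rw [show 2 * Real.pi / 3 = Real.pi / 3 + Real.pi / 3 by ring, ← rot_add_angle, key, key]

lemma waveCore_rot (h : IsRefinementModulus ε M0) (k : Fin 6) (ζ : Plane) :
    waveCore ε M0 k (rot (2 * Real.pi / 3) ζ) = waveCore ε M0 (rotPerm k) ζ := by
  rw [waveCore, waveCore, ← rot_smul, h.scal_rot, h.scal_rot, inner_rot_etaFr,
    (rot_two_pi_div_three ζ).1, (rot_two_pi_div_three ζ).2, sector_rot_two]

lemma phi_comp_rot (hε : SmallEps ε) (h : IsRefinementModulus ε M0) :
    phi (transfer ε M0) ∘ rot (2 * Real.pi / 3) = phi (transfer ε M0) := by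
  funext x
  rw [Function.comp_apply, phi, invFourier_rot]
  congr 1
  funext ξ
  rw [h.phiHat_eq hε, h.phiHat_eq hε, ← rot_smul, h.scal_rot]

lemma psi_comp_rot (hε : SmallEps ε) (h : IsRefinementModulus ε M0) (k : Fin 6) :
    psi (transfer ε M0) k ∘ rot (2 * Real.pi / 3) = psi (transfer ε M0) (rotPerm k) := by
  funext x
  rw [Function.comp_apply, psi, invFourier_rot, psi]
  congr 1
  funext ξ
  rw [h.psiHat_eq hε, h.psiHat_eq hε, ← rot_smul, h.waveCore_rot]

lemma image_waveletPairs (hε : SmallEps ε) (h : IsRefinementModulus ε M0) :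
    (fun p : (Plane → ℂ) × (Plane → ℂ) =>
      (p.1 ∘ rot (2 * Real.pi / 3), p.2 ∘ rot (2 * Real.pi / 3))) ''
      waveletPairs (transfer ε M0) = waveletPairs (transfer ε M0) := by
  simp only [waveletPairs, Set.image_insert_eq, Set.image_singleton, h.psi_comp_rot hε, rotPerm,
    Matrix.cons_val]
  ext p
  simp only [Set.mem_insert_iff, Set.mem_singleton_iff]
  tauto

end IsRefinementModulus

end HexFrame

end

theorem mainTheorem2 (ε : ℝ) (hε0 : 0 < ε) (hε : ε < Real.pi / (4 + √3))
    (hdisj : Disjoint (HexFrame.setA12 ε) (HexFrame.setA16 ε))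
    (M0 : HexFrame.Plane → ℝ) (hM0 : HexFrame.IsRefinementModulus ε M0) :
    -- the filter bank is PR, and generates a Parseval frame of redundancy 2
    (HexFrame.IsPRFilterBank HexFrame.frameLattice (HexFrame.transfer ε M0) ∧
      HexFrame.IsParsevalFrame
        (HexFrame.waveletSystem HexFrame.frameLattice (HexFrame.transfer ε M0)) ∧
      HexFrame.redundancy HexFrame.frameLattice = 2) ∧
    -- the product converges and the displayed functions are the Fourier transforms
    ((∀ ξ, Multipliable (HexFrame.phiFactor (HexFrame.transfer ε M0) ξ)) ∧
      HexFrame.HasFourierTransform (HexFrame.phi (HexFrame.transfer ε M0))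
        (HexFrame.phiHat (HexFrame.transfer ε M0)) ∧
      HexFrame.HasFourierTransform (HexFrame.dilate 1 (HexFrame.phi (HexFrame.transfer ε M0)))
        (HexFrame.dilateHat 1 (HexFrame.phiHat (HexFrame.transfer ε M0))) ∧
      ∀ k, HexFrame.HasFourierTransform (HexFrame.psi (HexFrame.transfer ε M0) k)
          (HexFrame.psiHat (HexFrame.transfer ε M0) k) ∧
        HexFrame.HasFourierTransform (HexFrame.dilate 1 (HexFrame.psi (HexFrame.transfer ε M0) k))
          (HexFrame.dilateHat 1 (HexFrame.psiHat (HexFrame.transfer ε M0) k))) ∧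
    -- frequency localization
    (tsupport (HexFrame.dilateHat 1 (HexFrame.phiHat (HexFrame.transfer ε M0)))
        ⊆ HexFrame.hexA0 ∧
      (∀ k, Function.support (HexFrame.dilateHat 1 (HexFrame.psiHat (HexFrame.transfer ε M0) k))
        ⊆ HexFrame.setA ε k) ∧
      (HexFrame.hexA0 ⊆ closure {ξ | ξ ∈ HexFrame.hexS ∧ M0 ξ ≠ 0} →
        tsupport (HexFrame.dilateHat 1 (HexFrame.phiHat (HexFrame.transfer ε M0)))
            = HexFrame.hexA0 ∧
          (HexFrame.hexS \ HexFrame.hexSeps ε ⊆ closure {ξ | ξ ∈ HexFrame.hexS ∧ M0 ξ ≠ 1} →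
            ∀ k, tsupport (HexFrame.dilateHat 1 (HexFrame.psiHat (HexFrame.transfer ε M0) k))
              = closure (HexFrame.setA ε k)))) ∧
    -- continuity of the Fourier transforms
    (Continuous (HexFrame.phiHat (HexFrame.transfer ε M0)) ∧
      ∀ k, Continuous (HexFrame.psiHat (HexFrame.transfer ε M0) k)) ∧
    -- invariance under the rotation by `2π/3`
    (HexFrame.phi (HexFrame.transfer ε M0) ∘ HexFrame.rot (2 * Real.pi / 3)
        = HexFrame.phi (HexFrame.transfer ε M0) ∧
      (fun p : (HexFrame.Plane → ℂ) × (HexFrame.Plane → ℂ) =>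
          (p.1 ∘ HexFrame.rot (2 * Real.pi / 3), p.2 ∘ HexFrame.rot (2 * Real.pi / 3))) ''
          HexFrame.waveletPairs (HexFrame.transfer ε M0)
        = HexFrame.waveletPairs (HexFrame.transfer ε M0)) := by
  have h := HexFrame.smallEps_of_disjoint hε0 hε hdisj
  have hφ := hM0.continuous_phiHat h
  have hφc := hM0.hasCompactSupport_phiHat h
  have hψ := hM0.continuous_psiHat h
  have hψc := hM0.hasCompactSupport_psiHat h
  exact ⟨⟨HexFrame.isPRFilterBank_transfer h hM0, hM0.isParsevalFrame_waveletSystem h,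
      HexFrame.redundancy_frameLattice⟩,
    ⟨hM0.multipliable_phiFactor h, HexFrame.hasFourierTransform_of_continuous hφ hφc,
      HexFrame.hasFourierTransform_dilate hφ hφc, fun k =>
        ⟨HexFrame.hasFourierTransform_of_continuous (hψ k) (hψc k),
          HexFrame.hasFourierTransform_dilate (hψ k) (hψc k)⟩⟩,
    ⟨hM0.tsupport_dilateHat_phiHat_subset h, hM0.support_dilateHat_psiHat_subset h,
      fun hd => ⟨hM0.tsupport_dilateHat_phiHat h hd, hM0.tsupport_dilateHat_psiHat h hd⟩⟩,
    ⟨hφ, hψ⟩, hM0.phi_comp_rot h, hM0.image_waveletPairs h⟩
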